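/- Let $\ell^2=\ell^2(\mathbb N)$, $\mathbb N=\{1,2,\dots\}$, with unit vectors $e_k$, and $\|x\|_\infty=\sup_n|x_n|$. Let $(\lambda_i)_{i\ge1}$ be positive numbers with $\kappa_\lambda i^2\le\lambda_i\le\kappa_\lambda^{-1}i^2$ for all $i$, where $\kappa_\lambda>0$. Let $a$ be a map from $\ell^2$ to the bounded self-adjoint operators on $\ell^2$, with matrix entries $a_{ij}(x)=\langle a(x)e_j,e_i\rangle$, such that for constants $0<\Lambda_0\le\Lambda_1<\infty$ $$\Lambda_0|w|^2\le\langle a(x)w,w\rangle\le\Lambda_1|w|^2\qquad(x,w\in\ell^2),$$ and such that $a$ is of Toeplitz form: $a_{ij}(x)$ depends on $i,j$ only through $i-j$. Suppose that for some $\alpha\in(\tfrac12,1]$, $\beta>\tfrac92-\alpha$, $\gamma>\frac{2\alpha}{2\alpha-1}$ and constants $\kappa_\gamma,\kappa_\beta$, $$|a_{ij}(x)|\le\frac{\kappa_\gamma}{1+|i-j|^\gamma},\qquad |a_{ij}(y+he_k)-a_{ij}(y)|\le\kappa_\beta|h|^\alpha k^{-\beta}$$ for all $i,j,k\ge1$,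 $x,y\in\ell^2$, $h\in\mathbb R$. For $K\in\mathbb N$ let $\pi_K(x)=(x_1,\dots,x_K,0,0,\dots)$, and identify $\mathbb R^K$ with $\pi_K(\ell^2)$. Put $a^K_{ij}(x)=a_{ij}(\pi_K(x))$. For $t>0$ let $A^K(y,t)$ be the inverse of the $K\times K$ matrix with entries $a^K_{ij}(y)\int_0^te^{-(\lambda_i+\lambda_j)s}\,ds$, $1\le i,j\le K$, and let $$N_K(t,x,y)=(2\pi)^{-K/2}\big(\det A^K(y,t)\big)^{1/2}\exp\!\big(-\tfrac12\langle w,A^K(y,t)w\rangle\big),\qquad w_i=y_i-e^{-\lambda_it}x_i\quad(1\le i\le K).$$ Let $D_{ij}N_K(t,x,y)$ be the second partial derivative in the variables $x_i,x_j$; it is $0$ if $i>K$ or $j>K$. **Theorem.** There are a constant $\eta>0$, depending only on $\alpha$ and $\gamma$, and a constant $c>0$, depending only on $\alpha,\beta,\gamma,\kappa_\beta,\kappa_\gamma,\kappa_\lambda,\Lambda_0,\Lambda_1$ (in particular not on $K$), such that for all $x\in\ell^2$, $K\in\mathbb N$ and $t>0$ the function $y\mapsto\sum_{i,j=1}^\infty[a^K_{ij}(x)-a^K_{ij}(y)]D_{ij}N_K(t,x,y)$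 is integrable on $\mathbb R^K$ and $$\int_{\mathbb R^K}\Big|\sum_{i,j=1}^\infty[a^K_{ij}(x)-a^K_{ij}(y)]\,D_{ij}N_K(t,x,y)\Big|\,dy_1\cdots dy_K\le c\,t^{-1+\eta}\,(1+\|x\|_\infty^\alpha).$$ -/

import Mathlib

open MeasureTheory

noncomputable section

/-- The real sequence space `ℓ²`.  The coordinate of index `n : ℕ` here is the `(n + 1)`-st
coordinate when coordinates are numbered `1, 2, 3, …`. -/
abbrev EllTwo : Type := lp (fun _ : ℕ => ℝ) 2

namespace OUKernel

/-- The `k`-th standard unit vector of `ℓ²`. -/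
def unitVec (k : ℕ) : EllTwo := lp.single 2 k (1 : ℝ)

/-- The supremum norm `sup_n |x_n|` of a point of `ℓ²`. -/
def supNorm (x : EllTwo) : ℝ := ⨆ n : ℕ, |x n|

/-- The point `(y_1, …, y_K, 0, 0, …)` of `ℓ²`; this identifies `ℝ^K` with a subset of `ℓ²`. -/
def embed (K : ℕ) (y : Fin K → ℝ) : EllTwo := ∑ i : Fin K, lp.single 2 (i : ℕ) (y i)

/-- The projection `π_K x = (x_1, …, x_K, 0, 0, …)`. -/
def proj (K : ℕ) (x : EllTwo) : EllTwo := embed K (fun i => x i)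

/-- The matrix entry `a_{ij}(x) = ⟨a(x) e_j, e_i⟩` of an operator-valued map on `ℓ²`. -/
def entry (a : EllTwo → EllTwo →L[ℝ] EllTwo) (x : EllTwo) (i j : ℕ) : ℝ :=
  inner ℝ (unitVec i) (a x (unitVec j))

/-- Quadratic growth `κ i² ≤ λ_i ≤ κ⁻¹ i²`, `i = 1, 2, …`. -/
def QuadraticGrowth (κ : ℝ) (lam : ℕ → ℝ) : Prop :=
  ∀ i : ℕ, κ * ((i : ℝ) + 1) ^ 2 ≤ lam i ∧ lam i ≤ κ⁻¹ * ((i : ℝ) + 1) ^ 2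

/-- `Λ₀ |w|² ≤ ⟨a(x) w, w⟩ ≤ Λ₁ |w|²`. -/
def UniformlyElliptic (Λ₀ Λ₁ : ℝ) (a : EllTwo → EllTwo →L[ℝ] EllTwo) : Prop :=
  ∀ x w : EllTwo, Λ₀ * ‖w‖ ^ 2 ≤ inner ℝ (a x w) w ∧ inner ℝ (a x w) w ≤ Λ₁ * ‖w‖ ^ 2

/-- Off-diagonal decay `|a_{ij}(x)| ≤ κ / (1 + |i - j|^γ)`. -/
def OffDiagonalDecay (γ κ : ℝ) (a : EllTwo → EllTwo →L[ℝ] EllTwo) : Prop :=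
  ∀ (x : EllTwo) (i j : ℕ), |entry a x i j| ≤ κ / (1 + |(i : ℝ) - (j : ℝ)| ^ γ)

/-- Coordinatewise Hölder continuity
`|a_{ij}(y + h e_k) - a_{ij}(y)| ≤ κ |h|^α k^{-β}`, `k = 1, 2, …`. -/
def CoordHolder (α β κ : ℝ) (a : EllTwo → EllTwo →L[ℝ] EllTwo) : Prop :=
  ∀ (y : EllTwo) (h : ℝ) (i j k : ℕ),
    |entry a (y + h • unitVec k) i j - entry a y i j| ≤ κ * |h| ^ α * ((k : ℝ) + 1) ^ (-β)

/-- Toeplitz form: `a_{ij}(x)` depends on `i, j` only through `i - j`. -/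
def IsToeplitz (a : EllTwo → EllTwo →L[ℝ] EllTwo) : Prop :=
  ∀ (x : EllTwo) (i j i' j' : ℕ), (i : ℤ) - (j : ℤ) = (i' : ℤ) - (j' : ℤ) →
    entry a x i j = entry a x i' j'

/-- `a^K_{ij}(x) = a_{ij}(π_K x)`. -/
def entryK (a : EllTwo → EllTwo →L[ℝ] EllTwo) (K : ℕ) (x : EllTwo) (i j : ℕ) : ℝ :=
  entry a (proj K x) i j

/-- The `K × K` matrix `a^K(x, t)` with entries
`a^K_{ij}(x) ∫₀ᵗ exp (-(λ_i + λ_j) s) ds`. -/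
def covMatrix (lam : ℕ → ℝ) (a : EllTwo → EllTwo →L[ℝ] EllTwo) (K : ℕ) (x : EllTwo) (t : ℝ) :
    Matrix (Fin K) (Fin K) ℝ :=
  Matrix.of fun i j =>
    entryK a K x i j * ∫ s in (0 : ℝ)..t, Real.exp (-(lam i + lam j) * s)

/-- `Q_K(w, C) = (2π)^{-K/2} (det C)^{1/2} exp (-⟨w, C w⟩ / 2)`. -/
def gaussQ (K : ℕ) (w : Fin K → ℝ) (C : Matrix (Fin K) (Fin K) ℝ) : ℝ :=
  (2 * Real.pi) ^ (-(K : ℝ) / 2) * Real.sqrt C.det * Real.exp (-(w ⬝ᵥ C.mulVec w) / 2)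

/-- The kernel `N_K(t, x, y) = Q_K(π_K(y - x'), A^K(y, t))`, where `x'_i = exp (-λ_i t) x_i` and
`A^K(y, t)` is the inverse of `a^K(y, t)`. -/
def kernelN (lam : ℕ → ℝ) (a : EllTwo → EllTwo →L[ℝ] EllTwo) (K : ℕ) (t : ℝ) (x y : EllTwo) : ℝ :=
  gaussQ K (fun i => y i - Real.exp (-lam i * t) * x i) (covMatrix lam a K y t)⁻¹

/-- The partial derivative `D_i f` of a function on `ℓ²`. -/
def partialD (i : ℕ) (f : EllTwo → ℝ) (x : EllTwo) : ℝ :=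
  deriv (fun h : ℝ => f (x + h • unitVec i)) 0

/-- `∑_{i,j = 1}^∞ [a^K_{ij}(x) - a^K_{ij}(y)] D_{ij} N_K(t, x, y)`, the derivatives being taken in
the `x` variable.  Since `N_K(t, x, y)` depends on `x` only through `x_1, …, x_K`, all terms with
`i > K` or `j > K` vanish. -/
def perturbation (lam : ℕ → ℝ) (a : EllTwo → EllTwo →L[ℝ] EllTwo) (K : ℕ) (t : ℝ)
    (x y : EllTwo) : ℝ :=
  ∑' p : ℕ × ℕ, (entryK a K x p.1 p.2 - entryK a K y p.1 p.2) *
    partialD p.1 (partialD p.2 (fun z => kernelN lam a K t z y)) x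

end OUKernel

end

/-! Put `σ_i² = ∫₀ᵗ e^{-2λ_i s} ds` (`scale`) and substitute `y_i = e^{-λ_i t} x_i + σ_i z_i`. The
kernel becomes the Gaussian density in `z` whose covariance `gram` is `a_ij(y)` times a correlation
factor in `[0, 1]`. With `v = G⁻¹ z` and `A = G⁻¹`, the derivative `D_ij N_K` becomes `d_i d_j (v_i
v_j - A_ij)` times the density, where `d_i = e^{-λ_i t} / σ_i` (`damp`). By the Toeplitz property
the coefficient difference is constant along each diagonal, so the integrand is a sum over `n` of a
scalar `diagDiff` times the quadratic functional `S_n = ∑_i d_i d_{i+n} (v_i v_{i+n} - A_{i,i+n})`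
(`bandForm`).

The gain comes from cancellation inside `S_n`. Estimating its roughly `t^{-1/2}` relevant terms one
by one would give `t^{-3/2}`; the second moment of `S_n` is instead bounded by a constant times `∑_i
(d_i d_{i+n})²`, which is at most of order `t^{-5/2}` (`sum_damp_sq_le`), so `S_n` has `L²` size
`t^{-5/4}`. The coefficient difference is at most of order `n^{-γ}` by decay and of order `t^{α/2}`,
times moments of `z`, by Hölder continuity. Interpolating with weight `θ` gives `n^{-γ(1-θ)}
t^{αθ/2}`. The condition on `γ` is what allows `γ(1-θ) > 1`, hence summability over `n`, together
with `αθ > 1/2`, hence `η = αθ/2 - 1/4 > 0`.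

The main point is the second moment bound `exists_band_bound`, uniform in the dimension. For a
constant covariance `S_n` is a martingale in the number `m` of coordinates: conditionally on the
first `m`, its increment is a combination of Hermite polynomials of degrees one and two in the new
innovation (`bandForm_succ_update`), so the second moment grows by exactly the expected conditional
variance `bandIncr`. Regression coefficients decay away from the diagonal (`weighted_residual_le`),
and the resulting weights have square sums over `m` bounded uniformly in the index
(`sum_decayWt_sq_le`).

Here the covariance depends on `z`, and the function integrated is not a probability density. It is
therefore approximated by matrices `G m` seeing only the first `m` coordinates. Integrating out
coordinate `m` is exact for `G m`, and passing from `G m` to `G (m + 1)` costs a factor `1 + O((m +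
1)^{-5/4})` (`exists_step_pointwise`) plus summable errors. A discrete Grönwall argument then
closes: `exists_moment_bound` controls the total mass and the moments of each `v_j`, and these feed
`exists_band_bound`. -/

noncomputable section

/-! ### Recursive inversion of leading blocks and decay of regression coefficients -/

namespace TriGauss

open Finset

/-- The coefficients of the residual of the `m`-th coordinate after regression on the previous
ones, `A` being the inverse of the leading `m × m` block of `G`. -/
def residualOf (G A : ℕ → ℕ → ℝ) (m i : ℕ) : ℝ :=
  if i < m then -∑ j ∈ range m, A i j * G j m else if i = m then 1 else 0

/-- The conditional variance of the `m`-th coordinate given the previous ones. -/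
def pivotOf (G A : ℕ → ℕ → ℝ) (m : ℕ) : ℝ := ∑ j ∈ range (m + 1), G m j * residualOf G A m j

/-- The inverse of the leading `m × m` block of `G`, extended by zero. -/
def blockInv (G : ℕ → ℕ → ℝ) : ℕ → ℕ → ℕ → ℝ
  | 0 => fun _ _ => 0
  | m + 1 => fun i j => blockInv G m i j +
      residualOf G (blockInv G m) m i * residualOf G (blockInv G m) m j / pivotOf G (blockInv G m) m

/-- `residualOf` for the leading block of `G`. -/
def residual (G : ℕ → ℕ → ℝ) (m : ℕ) : ℕ → ℝ := residualOf G (blockInv G m) m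

/-- `pivotOf` for the leading block of `G`. -/
def pivot (G : ℕ → ℕ → ℝ) (m : ℕ) : ℝ := pivotOf G (blockInv G m) m

/-- The solution `v` of `G v = z` in the first `m` coordinates. -/
def solve (G : ℕ → ℕ → ℝ) (m : ℕ) (z : ℕ → ℝ) (i : ℕ) : ℝ := ∑ j ∈ range m, blockInv G m i j * z j

/-- The quadratic form of the inverse of the leading `m × m` block. -/
def invQuad (G : ℕ → ℕ → ℝ) (m : ℕ) (z : ℕ → ℝ) : ℝ := ∑ i ∈ range m, z i * solve G m z i

/-- The centred Gaussian density whose covariance is the leading `m × m` block of `G`. -/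
def density (G : ℕ → ℕ → ℝ) (m : ℕ) (z : ℕ → ℝ) : ℝ :=
  (∏ k ∈ range m, √(2 * Real.pi * pivot G k))⁻¹ * Real.exp (-invQuad G m z / 2)

/-- Sum of squares of the first `m` coordinates. -/
def sqSum (m : ℕ) (z : ℕ → ℝ) : ℝ := ∑ i ∈ range m, z i ^ 2

/-- Symmetric matrices with uniform ellipticity and summable first off-diagonal moment. -/
structure Admissible (Λ₀ Λ₁ Γ : ℝ) (G : ℕ → ℕ → ℝ) : Prop where
  symm : ∀ i j, G i j = G j i
  lower : ∀ (w : ℕ → ℝ) (m : ℕ),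
    Λ₀ * sqSum m w ≤ ∑ i ∈ range m, ∑ j ∈ range m, G i j * w i * w j
  upper : ∀ (w : ℕ → ℝ) (m : ℕ),
    ∑ i ∈ range m, ∑ j ∈ range m, G i j * w i * w j ≤ Λ₁ * sqSum m w
  moment : ∀ i m : ℕ, ∑ j ∈ range m, |(i : ℝ) - j| * |G i j| ≤ Γ

variable {Λ₀ Λ₁ Γ : ℝ} {G : ℕ → ℕ → ℝ}

lemma blockInv_succ (G : ℕ → ℕ → ℝ) (m i j : ℕ) :
    blockInv G (m + 1) i j = blockInv G m i j + residual G m i * residual G m j / pivot G m := rfl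

lemma residual_self (G : ℕ → ℕ → ℝ) (m : ℕ) : residual G m m = 1 := by
  simp [residual, residualOf]

lemma residual_of_lt (G : ℕ → ℕ → ℝ) {m i : ℕ} (h : i < m) :
    residual G m i = -∑ j ∈ range m, blockInv G m i j * G j m := by
  simp [residual, residualOf, h]

lemma residual_of_gt (G : ℕ → ℕ → ℝ) {m i : ℕ} (h : m < i) : residual G m i = 0 := by
  simp [residual, residualOf, h.not_gt, h.ne']

lemma blockInv_symm (G : ℕ → ℕ → ℝ) (m i j : ℕ) : blockInv G m i j = blockInv G m j i := by
  induction m with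
  | zero => rfl
  | succ m ih => rw [blockInv_succ, blockInv_succ, ih, mul_comm (residual G m i)]

lemma blockInv_eq_zero (G : ℕ → ℕ → ℝ) {m i : ℕ} (h : m ≤ i) (j : ℕ) : blockInv G m i j = 0 := by
  induction m with
  | zero => rfl
  | succ m ih => rw [blockInv_succ, ih (by omega), residual_of_gt G (by omega)]; simp

lemma blockInv_eq_zero' (G : ℕ → ℕ → ℝ) {m j : ℕ} (h : m ≤ j) (i : ℕ) : blockInv G m i j = 0 := by
  rw [blockInv_symm, blockInv_eq_zero G h]

lemma pivot_eq (G : ℕ → ℕ → ℝ) (m : ℕ) :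
    pivot G m = ∑ j ∈ range (m + 1), G m j * residual G m j := rfl

lemma sqSum_nonneg (m : ℕ) (z : ℕ → ℝ) : 0 ≤ sqSum m z := sum_nonneg fun _ _ => sq_nonneg _

lemma sq_le_sqSum {m i : ℕ} (h : i < m) (z : ℕ → ℝ) : z i ^ 2 ≤ sqSum m z :=
  single_le_sum (f := fun i => z i ^ 2) (fun _ _ => sq_nonneg _) (mem_range.2 h)

/-- These are the normal equations of the regression. The block inverse property is taken as a
hypothesis because it is itself proved by an induction that needs this orthogonality. -/
lemma residual_orthogonal_of {m : ℕ}
    (h : ∀ i < m, ∀ j < m, ∑ l ∈ range m, G i l * blockInv G m l j = if i = j then 1 else 0)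
    {i : ℕ} (hi : i < m) : ∑ j ∈ range (m + 1), G i j * residual G m j = 0 := by
  rw [sum_range_succ, residual_self, mul_one]
  have : ∑ x ∈ range m, G i x * residual G m x = -G i m := by
    calc _ = ∑ x ∈ range m, -∑ j ∈ range m, G i x * blockInv G m x j * G j m := by
          refine sum_congr rfl fun x hx => ?_
          rw [residual_of_lt G (mem_range.1 hx), mul_neg, mul_sum]
          simp only [mul_assoc]
      _ = -∑ j ∈ range m, (∑ x ∈ range m, G i x * blockInv G m x j) * G j m := by
          rw [sum_neg_distrib, sum_comm]; simp only [sum_mul]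
      _ = -∑ j ∈ range m, (if i = j then 1 else 0) * G j m := by
          congr 1
          exact sum_congr rfl fun j hj => by rw [h i hi j (mem_range.1 hj)]
      _ = _ := by simp [hi]
  rw [this]; ring

lemma pivot_eq_form_of {m : ℕ} (h : ∀ i < m, ∑ j ∈ range (m + 1), G i j * residual G m j = 0) :
    pivot G m = ∑ i ∈ range (m + 1), ∑ j ∈ range (m + 1),
      G i j * residual G m i * residual G m j := by
  have e : ∀ i, ∑ j ∈ range (m + 1), G i j * residual G m i * residual G m j =
      residual G m i * ∑ j ∈ range (m + 1), G i j * residual G m j := fun i => by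
    rw [mul_sum]; exact sum_congr rfl fun j _ => by ring
  simp only [e]
  rw [sum_range_succ (fun i => residual G m i * _), residual_self, one_mul, ← pivot_eq,
    sum_eq_zero, zero_add]
  intro i hi
  rw [h i (mem_range.1 hi), mul_zero]

lemma one_le_sqSum_residual (G : ℕ → ℕ → ℝ) (m : ℕ) : 1 ≤ sqSum (m + 1) (residual G m) := by
  have := sq_le_sqSum (Nat.lt_succ_self m) (residual G m)
  rwa [residual_self, one_pow] at this

/-- Bordering a block adds a rank-one term built from the residual vector. The residual is
orthogonal to the earlier rows and pairs with the new row to give the pivot. The pivot is nonzero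
because it is the quadratic form at a vector whose last coordinate is `1`. -/
lemma sum_mul_blockInv (h0 : 0 < Λ₀) (hG : Admissible Λ₀ Λ₁ Γ G) (m : ℕ) :
    ∀ i < m, ∀ j < m, ∑ l ∈ range m, G i l * blockInv G m l j = if i = j then 1 else 0 := by
  induction m with
  | zero => intro i hi; omega
  | succ m ih =>
    have ho : ∀ i < m, ∑ j ∈ range (m + 1), G i j * residual G m j = 0 := fun i hi =>
      residual_orthogonal_of ih hi
    have hs : 0 < pivot G m := by
      rw [pivot_eq_form_of ho]
      have := hG.lower (residual G m) (m + 1)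
      have := one_le_sqSum_residual G m
      nlinarith
    intro i hi j hj
    have e : ∑ l ∈ range (m + 1), G i l * blockInv G (m + 1) l j =
        ∑ l ∈ range m, G i l * blockInv G m l j +
          (∑ l ∈ range (m + 1), G i l * residual G m l) * (residual G m j / pivot G m) := by
      simp only [blockInv_succ, mul_add, sum_add_distrib]
      congr 1
      · rw [sum_range_succ, blockInv_eq_zero G le_rfl]; simp
      · rw [sum_mul]; exact sum_congr rfl fun l _ => by ring
    rw [e]
    rcases Nat.lt_succ_iff_lt_or_eq.1 hi with hi | rfl
    · rw [ho i hi, zero_mul, add_zero]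
      rcases Nat.lt_succ_iff_lt_or_eq.1 hj with hj | rfl
      · exact ih i hi j hj
      · rw [if_neg hi.ne]
        exact sum_eq_zero fun l _ => by rw [blockInv_eq_zero' G le_rfl, mul_zero]
    · rw [← pivot_eq]
      rcases Nat.lt_succ_iff_lt_or_eq.1 hj with hj | rfl
      · rw [if_neg hj.ne', mul_div_cancel₀ _ hs.ne', residual_of_lt G hj]
        have : ∑ l ∈ range i, G i l * blockInv G i l j = ∑ l ∈ range i, blockInv G i j l * G l i :=
          sum_congr rfl fun l _ => by rw [blockInv_symm G i l j, hG.symm i l, mul_comm]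
        rw [this]; ring
      · rw [if_pos rfl, residual_self, mul_one_div_cancel hs.ne',
          sum_eq_zero fun l _ => by rw [blockInv_eq_zero' G le_rfl, mul_zero], zero_add]

lemma residual_orthogonal (h0 : 0 < Λ₀) (hG : Admissible Λ₀ Λ₁ Γ G) {m i : ℕ} (hi : i < m) :
    ∑ j ∈ range (m + 1), G i j * residual G m j = 0 :=
  residual_orthogonal_of (sum_mul_blockInv h0 hG m) hi

lemma pivot_eq_form (h0 : 0 < Λ₀) (hG : Admissible Λ₀ Λ₁ Γ G) (m : ℕ) :
    pivot G m = ∑ i ∈ range (m + 1), ∑ j ∈ range (m + 1),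
      G i j * residual G m i * residual G m j :=
  pivot_eq_form_of fun _ hi => residual_orthogonal h0 hG hi

lemma sqSum_residual_le (h0 : 0 < Λ₀) (hG : Admissible Λ₀ Λ₁ Γ G) (m : ℕ) :
    Λ₀ * sqSum (m + 1) (residual G m) ≤ pivot G m := by
  rw [pivot_eq_form h0 hG]; exact hG.lower _ _

lemma le_pivot (h0 : 0 < Λ₀) (hG : Admissible Λ₀ Λ₁ Γ G) (m : ℕ) : Λ₀ ≤ pivot G m := by
  have := sqSum_residual_le h0 hG m
  have := one_le_sqSum_residual G m
  nlinarith

lemma pivot_pos (h0 : 0 < Λ₀) (hG : Admissible Λ₀ Λ₁ Γ G) (m : ℕ) : 0 < pivot G m :=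
  h0.trans_le (le_pivot h0 hG m)

/-- The pivot is the minimum of the quadratic form over vectors with last coordinate `1`. -/
lemma pivot_le_form (h0 : 0 < Λ₀) (hG : Admissible Λ₀ Λ₁ Γ G) (m : ℕ) (h : ℕ → ℝ) (hm : h m = 1) :
    pivot G m ≤ ∑ i ∈ range (m + 1), ∑ j ∈ range (m + 1), G i j * h i * h j := by
  set g := residual G m with hg
  -- Completing the square: in the cross term only the last coordinate survives the normal
  -- equations, and there `h m = 1`, so it equals the pivot.
  have key : ∑ i ∈ range (m + 1), ∑ j ∈ range (m + 1), G i j * (h i - g i) * (h j - g j) =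
      ∑ i ∈ range (m + 1), ∑ j ∈ range (m + 1), G i j * h i * h j -
      2 * ∑ i ∈ range (m + 1), h i * ∑ j ∈ range (m + 1), G i j * g j
      + ∑ i ∈ range (m + 1), ∑ j ∈ range (m + 1), G i j * g i * g j := by
    have e2 : ∑ i ∈ range (m + 1), ∑ j ∈ range (m + 1), G i j * g i * h j =
        ∑ i ∈ range (m + 1), ∑ j ∈ range (m + 1), G i j * h i * g j := by
      rw [sum_comm]
      exact sum_congr rfl fun i _ => sum_congr rfl fun j _ => by rw [hG.symm j i]; ring
    have e3 : ∑ i ∈ range (m + 1), h i * ∑ j ∈ range (m + 1), G i j * g j =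
        ∑ i ∈ range (m + 1), ∑ j ∈ range (m + 1), G i j * h i * g j := by
      refine sum_congr rfl fun i _ => ?_
      rw [mul_sum]; exact sum_congr rfl fun j _ => by ring
    rw [e3, two_mul]
    nth_rewrite 1 [← e2]
    simp only [← sum_add_distrib, ← sum_sub_distrib]
    exact sum_congr rfl fun i _ => sum_congr rfl fun j _ => by ring
  have h1 : ∑ i ∈ range (m + 1), h i * ∑ j ∈ range (m + 1), G i j * g j = pivot G m := by
    rw [sum_range_succ, hm, one_mul, ← pivot_eq, sum_eq_zero, zero_add]
    intro i hi
    rw [residual_orthogonal h0 hG (mem_range.1 hi), mul_zero]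
  have h2 := hG.lower (fun i => h i - g i) (m + 1)
  have h3 : 0 ≤ Λ₀ * sqSum (m + 1) (fun i => h i - g i) := mul_nonneg h0.le (sqSum_nonneg _ _)
  rw [key, h1, ← pivot_eq_form h0 hG] at h2
  linarith

lemma pivot_le (h0 : 0 < Λ₀) (hG : Admissible Λ₀ Λ₁ Γ G) (m : ℕ) : pivot G m ≤ Λ₁ := by
  have h := pivot_le_form h0 hG m (fun i => if i = m then 1 else 0) (by simp)
  have h' := hG.upper (fun i => if i = m then 1 else 0) (m + 1)
  have : sqSum (m + 1) (fun i => if i = m then 1 else 0) = 1 := by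
    simp [sqSum]
  rw [this] at h'
  linarith

lemma solve_succ (G : ℕ → ℕ → ℝ) (m : ℕ) (z : ℕ → ℝ) (i : ℕ) :
    solve G (m + 1) z i = solve G m z i +
      residual G m i * (∑ j ∈ range (m + 1), residual G m j * z j) / pivot G m := by
  simp only [solve, blockInv_succ, add_mul, sum_add_distrib]
  congr 1
  · rw [sum_range_succ, blockInv_eq_zero' G le_rfl]; simp
  · rw [mul_sum, sum_div]; exact sum_congr rfl fun j _ => by ring

lemma solve_eq_zero (G : ℕ → ℕ → ℝ) {m i : ℕ} (h : m ≤ i) (z : ℕ → ℝ) : solve G m z i = 0 :=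
  sum_eq_zero fun j _ => by rw [blockInv_eq_zero G h, zero_mul]

lemma solve_congr (G : ℕ → ℕ → ℝ) {m : ℕ} {z z' : ℕ → ℝ} (h : ∀ i < m, z i = z' i) (i : ℕ) :
    solve G m z i = solve G m z' i :=
  sum_congr rfl fun j hj => by rw [h j (mem_range.1 hj)]

lemma invQuad_succ (G : ℕ → ℕ → ℝ) (m : ℕ) (z : ℕ → ℝ) :
    invQuad G (m + 1) z = invQuad G m z +
      (∑ j ∈ range (m + 1), residual G m j * z j) ^ 2 / pivot G m := by
  simp only [invQuad, solve_succ, mul_add, sum_add_distrib]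
  congr 1
  · rw [sum_range_succ, solve_eq_zero G le_rfl]; simp
  · rw [sq, sum_mul, sum_div]; exact sum_congr rfl fun j _ => by ring

lemma sum_mul_solve (h0 : 0 < Λ₀) (hG : Admissible Λ₀ Λ₁ Γ G) (m : ℕ) (z : ℕ → ℝ) {i : ℕ}
    (hi : i < m) : ∑ j ∈ range m, G i j * solve G m z j = z i := by
  calc _ = ∑ l ∈ range m, (∑ j ∈ range m, G i j * blockInv G m j l) * z l := by
        simp only [solve, mul_sum, sum_mul]
        rw [sum_comm]
        exact sum_congr rfl fun _ _ => sum_congr rfl fun _ _ => by ring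
    _ = ∑ l ∈ range m, (if i = l then 1 else 0) * z l :=
        sum_congr rfl fun l hl => by rw [sum_mul_blockInv h0 hG m i hi l (mem_range.1 hl)]
    _ = z i := by simp [hi]

lemma form_solve (h0 : 0 < Λ₀) (hG : Admissible Λ₀ Λ₁ Γ G) (m : ℕ) (z w : ℕ → ℝ) :
    ∑ i ∈ range m, ∑ j ∈ range m, G i j * w i * solve G m z j = ∑ i ∈ range m, w i * z i := by
  refine sum_congr rfl fun i hi => ?_
  rw [← sum_mul_solve h0 hG m z (mem_range.1 hi), mul_sum]
  exact sum_congr rfl fun _ _ => by ring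

lemma form_solve_self (h0 : 0 < Λ₀) (hG : Admissible Λ₀ Λ₁ Γ G) (m : ℕ) (z : ℕ → ℝ) :
    ∑ i ∈ range m, ∑ j ∈ range m, G i j * solve G m z i * solve G m z j = invQuad G m z := by
  rw [form_solve h0 hG]
  exact sum_congr rfl fun _ _ => mul_comm _ _

lemma sum_mul_le_sqrt (m : ℕ) (x y : ℕ → ℝ) :
    ∑ i ∈ range m, x i * y i ≤ √(sqSum m x) * √(sqSum m y) :=
  Real.sum_mul_le_sqrt_mul_sqrt _ _ _

/-- Coercivity tested on the solution `v` itself, followed by Cauchy–Schwarz: `Λ₀ |v|² ≤ ⟨z, v⟩ ≤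
|z| |v|`. -/
lemma sqrt_sqSum_solve_le (h0 : 0 < Λ₀) (hG : Admissible Λ₀ Λ₁ Γ G) (m : ℕ) (z : ℕ → ℝ) :
    √(sqSum m (solve G m z)) ≤ Λ₀⁻¹ * √(sqSum m z) := by
  set v := √(sqSum m (solve G m z))
  have hv : v ^ 2 = sqSum m (solve G m z) := Real.sq_sqrt (sqSum_nonneg _ _)
  have h1 := hG.lower (solve G m z) m
  rw [form_solve_self h0 hG] at h1
  have h2 : invQuad G m z ≤ √(sqSum m z) * v := sum_mul_le_sqrt _ _ _
  rcases (Real.sqrt_nonneg (sqSum m (solve G m z))).eq_or_lt with h | h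
  · rw [show v = 0 from h.symm]; positivity
  · have : Λ₀ * v ≤ √(sqSum m z) := by
      have : (Λ₀ * v) * v ≤ √(sqSum m z) * v := by nlinarith
      exact le_of_mul_le_mul_right this h
    rw [inv_mul_eq_div, le_div_iff₀ h0]; linarith

/-- Lower bound of the inverse quadratic form. -/
lemma sqSum_le_invQuad (h0 : 0 < Λ₀) (hG : Admissible Λ₀ Λ₁ Γ G) (m : ℕ) (z : ℕ → ℝ) :
    sqSum m z ≤ Λ₁ * invQuad G m z := by
  have h1 : 0 < Λ₁ := h0.trans_le ((le_pivot h0 hG 0).trans (pivot_le h0 hG 0))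
  -- Nonnegativity of the form at `Λ₁⁻¹ z - G⁻¹ z` gives `G⁻¹ ≥ Λ₁⁻¹` without any spectral theory.
  have hb := hG.lower (fun i => Λ₁⁻¹ * z i - solve G m z i) m
  have e : ∑ i ∈ range m, ∑ j ∈ range m,
      G i j * (Λ₁⁻¹ * z i - solve G m z i) * (Λ₁⁻¹ * z j - solve G m z j) =
      Λ₁⁻¹ ^ 2 * ∑ i ∈ range m, ∑ j ∈ range m, G i j * z i * z j
       - 2 * Λ₁⁻¹ * ∑ i ∈ range m, ∑ j ∈ range m, G i j * z i * solve G m z j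
       + ∑ i ∈ range m, ∑ j ∈ range m, G i j * solve G m z i * solve G m z j := by
    have e2 : ∑ i ∈ range m, ∑ j ∈ range m, G i j * solve G m z i * z j =
        ∑ i ∈ range m, ∑ j ∈ range m, G i j * z i * solve G m z j := by
      rw [sum_comm]
      exact sum_congr rfl fun i _ => sum_congr rfl fun j _ => by rw [hG.symm j i]; ring
    rw [two_mul, add_mul]
    nth_rewrite 1 [← e2]
    simp only [mul_sum, ← sum_add_distrib, ← sum_sub_distrib]
    exact sum_congr rfl fun i _ => sum_congr rfl fun j _ => by ring
  rw [e, form_solve h0 hG, form_solve_self h0 hG] at hb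
  have hz : ∑ i ∈ range m, z i * z i = sqSum m z := sum_congr rfl fun _ _ => (sq _).symm
  rw [hz] at hb
  have hu := hG.upper z m
  have hn : 0 ≤ Λ₀ * sqSum m (fun i => Λ₁⁻¹ * z i - solve G m z i) :=
    mul_nonneg h0.le (sqSum_nonneg _ _)
  have hi : 0 < Λ₁⁻¹ := inv_pos.2 h1
  have h3 : Λ₁⁻¹ ^ 2 * ∑ i ∈ range m, ∑ j ∈ range m, G i j * z i * z j ≤ Λ₁⁻¹ * sqSum m z := by
    calc _ ≤ Λ₁⁻¹ ^ 2 * (Λ₁ * sqSum m z) := by gcongr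
      _ = _ := by field_simp
  have h4 : Λ₁⁻¹ * sqSum m z ≤ invQuad G m z := by linarith
  rwa [inv_mul_le_iff₀ h1] at h4

/-- Off-diagonal decay of the residual coefficients. -/
lemma weighted_residual_le (h0 : 0 < Λ₀) (hG : Admissible Λ₀ Λ₁ Γ G) (m : ℕ) {δ : ℝ} (hδ : 0 ≤ δ)
    (hδΓ : δ * Γ ≤ Λ₀ / 2) :
    ∑ i ∈ range (m + 1), (1 + δ * ((m : ℝ) - i)) ^ 2 * residual G m i ^ 2 ≤ 2 * Λ₁ / Λ₀ := by
  set g := residual G m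
  set φ : ℕ → ℝ := fun i => 1 + δ * ((m : ℝ) - i) with hφ
  have hφ1 : ∀ i ∈ range (m + 1), 1 ≤ φ i := fun i hi => by
    have : (i : ℝ) ≤ m := by exact_mod_cast Nat.lt_succ_iff.1 (mem_range.1 hi)
    simp only [hφ]; nlinarith
  set F := sqSum (m + 1) (fun i => φ i * g i) with hF
  have hl := hG.lower (fun i => φ i * g i) (m + 1)
  -- Commutator identity for the weight `φ`. Replacing `φ j` by `φ i` leaves `∑ φ_i² g_i (G g)_i`;
  -- the normal equations kill every term except `i = m`, where `φ m = 1`, and that term is the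
  -- pivot.
  have e : ∑ i ∈ range (m + 1), ∑ j ∈ range (m + 1), G i j * (φ i * g i) * (φ j * g j) =
      ∑ i ∈ range (m + 1), ∑ j ∈ range (m + 1), G i j * (φ i * g i) * ((φ j - φ i) * g j)
      + pivot G m := by
    have : pivot G m = ∑ i ∈ range (m + 1), φ i ^ 2 * g i * ∑ j ∈ range (m + 1), G i j * g j := by
      rw [sum_range_succ, sum_eq_zero (s := range m), zero_add, ← pivot_eq]
      · simp [hφ, g, residual_self]
      · intro i hi
        rw [residual_orthogonal h0 hG (mem_range.1 hi), mul_zero]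
    rw [this, ← sum_add_distrib]
    refine sum_congr rfl fun i _ => ?_
    rw [mul_sum, ← sum_add_distrib]
    exact sum_congr rfl fun j _ => by ring
  -- Schur test: `φ` is `δ`-Lipschitz, so the commutator has entries of size `δ |i - j| |G i j|`,
  -- whose row sums the moment condition bounds by `δ Γ`. Since `δ Γ ≤ Λ₀ / 2`, the commutator is
  -- absorbed by coercivity.
  have hs : ∀ i ∈ range (m + 1), ∀ j ∈ range (m + 1),
      G i j * (φ i * g i) * ((φ j - φ i) * g j) ≤
      δ / 2 * (|(i : ℝ) - j| * |G i j| * (φ i * g i) ^ 2) +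
      δ / 2 * (|(j : ℝ) - i| * |G j i| * (φ j * g j) ^ 2) := by
    intro i hi j hj
    have h1 : |φ j - φ i| = δ * |(i : ℝ) - j| := by
      have : φ j - φ i = δ * ((i : ℝ) - j) := by simp only [hφ]; ring
      rw [this, abs_mul, abs_of_nonneg hδ]
    have h2 : |g j| ≤ |φ j * g j| := by
      rw [abs_mul, abs_of_pos (zero_lt_one.trans_le (hφ1 j hj))]
      exact le_mul_of_one_le_left (abs_nonneg (g j)) (hφ1 j hj)
    rw [hG.symm j i, abs_sub_comm (j : ℝ) i]
    calc _ ≤ |G i j * (φ i * g i) * ((φ j - φ i) * g j)| := le_abs_self _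
      _ = |(i : ℝ) - j| * |G i j| * δ * (|φ i * g i| * |g j|) := by
          rw [abs_mul, abs_mul, abs_mul (φ j - φ i), h1]; ring
      _ ≤ |(i : ℝ) - j| * |G i j| * δ * (|φ i * g i| * |φ j * g j|) := by gcongr
      _ ≤ |(i : ℝ) - j| * |G i j| * δ * (((φ i * g i) ^ 2 + (φ j * g j) ^ 2) / 2) := by
          gcongr
          rw [← sq_abs (φ i * g i), ← sq_abs (φ j * g j)]
          nlinarith [sq_nonneg (|φ i * g i| - |φ j * g j|)]
      _ = _ := by ring
  have hrow : ∑ i ∈ range (m + 1), ∑ j ∈ range (m + 1),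
      (|(i : ℝ) - j| * |G i j| * (φ i * g i) ^ 2) ≤ Γ * F := by
    rw [hF, sqSum, mul_sum]
    refine sum_le_sum fun i _ => ?_
    rw [← sum_mul]
    exact mul_le_mul_of_nonneg_right (hG.moment i _) (sq_nonneg _)
  have hsum : ∑ i ∈ range (m + 1), ∑ j ∈ range (m + 1),
      G i j * (φ i * g i) * ((φ j - φ i) * g j) ≤ δ * Γ * F := by
    calc _ ≤ ∑ i ∈ range (m + 1), ∑ j ∈ range (m + 1),
        (δ / 2 * (|(i : ℝ) - j| * |G i j| * (φ i * g i) ^ 2) +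
          δ / 2 * (|(j : ℝ) - i| * |G j i| * (φ j * g j) ^ 2)) :=
          sum_le_sum fun i hi => sum_le_sum fun j hj => hs i hi j hj
      _ = δ * ∑ i ∈ range (m + 1), ∑ j ∈ range (m + 1),
          (|(i : ℝ) - j| * |G i j| * (φ i * g i) ^ 2) := by
          simp only [sum_add_distrib, ← mul_sum]
          rw [sum_comm (f := fun i j : ℕ => |(j : ℝ) - i| * |G j i| * (φ j * g j) ^ 2)]
          ring
      _ ≤ δ * (Γ * F) := by gcongr
      _ = _ := by ring
  have hF0 : 0 ≤ F := sqSum_nonneg _ _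
  have hp := pivot_le h0 hG m
  have hd : δ * Γ * F ≤ Λ₀ / 2 * F := by gcongr
  have : Λ₀ * F ≤ Λ₀ / 2 * F + Λ₁ := by
    have := hl.trans_eq e
    linarith
  have hfin : ∑ i ∈ range (m + 1), (1 + δ * ((m : ℝ) - i)) ^ 2 * g i ^ 2 = F :=
    sum_congr rfl fun i _ => (mul_pow _ _ _).symm
  rw [hfin, le_div_iff₀ h0]
  linarith

end TriGauss

end

/-! ### Stability of densities and banded functionals under entrywise perturbation -/

noncomputable section

namespace TriGauss

open Finset

variable {Λ₀ Λ₁ Γ : ℝ} {G G₁ G₂ : ℕ → ℕ → ℝ}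

/-- The banded quadratic functional `∑ᵢ bᵢ (vᵢ vᵢ₊ₙ - Aᵢ,ᵢ₊ₙ)`. -/
def bandForm (N n : ℕ) (b : ℕ → ℝ) (G : ℕ → ℕ → ℝ) (m : ℕ) (z : ℕ → ℝ) : ℝ :=
  ∑ i ∈ range N, b i * (solve G m z i * solve G m z (i + n) - blockInv G m i (i + n))

lemma abs_sum_le_sqrt (m : ℕ) (x : ℕ → ℝ) : ∑ i ∈ range m, |x i| ≤ √m * √(sqSum m x) := by
  have := sum_mul_le_sqrt m (fun _ => 1) (fun i => |x i|)
  simpa [sqSum] using this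

/-- An entrywise bound `δ` yields only operator norm `δ m`, through `|x|₁ ≤ √m |x|₂`. These powers
of `m` dictate how fast the increments of the adapted family must decay. -/
lemma form_sub_le (m : ℕ) {δ : ℝ} (hδ : 0 ≤ δ) (h : ∀ i < m, ∀ j < m, |G₁ i j - G₂ i j| ≤ δ)
    (x y : ℕ → ℝ) :
    |∑ i ∈ range m, ∑ j ∈ range m, (G₁ i j - G₂ i j) * x i * y j| ≤
      δ * m * (√(sqSum m x) * √(sqSum m y)) := by
  calc _ ≤ ∑ i ∈ range m, ∑ j ∈ range m, δ * (|x i| * |y j|) := by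
        refine (abs_sum_le_sum_abs _ _).trans (sum_le_sum fun i hi => ?_)
        refine (abs_sum_le_sum_abs _ _).trans (sum_le_sum fun j hj => ?_)
        rw [abs_mul, abs_mul, mul_assoc]
        exact mul_le_mul_of_nonneg_right (h i (mem_range.1 hi) j (mem_range.1 hj)) (by positivity)
    _ = δ * ((∑ i ∈ range m, |x i|) * ∑ j ∈ range m, |y j|) := by
        rw [sum_mul_sum]; simp only [mul_sum]
    _ ≤ δ * ((√m * √(sqSum m x)) * (√m * √(sqSum m y))) := by
        gcongr <;> exact abs_sum_le_sqrt _ _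
    _ = δ * (√m * √m) * (√(sqSum m x) * √(sqSum m y)) := by ring
    _ = _ := by rw [Real.mul_self_sqrt (Nat.cast_nonneg m)]

/-- Stability of the solution under entrywise perturbations. -/
lemma sqrt_sqSum_solve_sub_le (h0 : 0 < Λ₀) (hG₁ : Admissible Λ₀ Λ₁ Γ G₁)
    (hG₂ : Admissible Λ₀ Λ₁ Γ G₂) (m : ℕ) {δ : ℝ} (hδ : 0 ≤ δ)
    (h : ∀ i < m, ∀ j < m, |G₁ i j - G₂ i j| ≤ δ) (z : ℕ → ℝ) :
    √(sqSum m (fun i => solve G₂ m z i - solve G₁ m z i)) ≤ δ * m * Λ₀⁻¹ ^ 2 * √(sqSum m z) := by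
  set d : ℕ → ℝ := fun i => solve G₂ m z i - solve G₁ m z i with hd
  set D := √(sqSum m d) with hD
  have hD2 : D ^ 2 = sqSum m d := Real.sq_sqrt (sqSum_nonneg _ _)
  have h1 := hG₁.lower d m
  -- Resolvent identity in weak form: both solutions have the same right-hand side, so `G₁ d = (G₁ -
  -- G₂) v₂`.
  have e : ∑ i ∈ range m, ∑ j ∈ range m, G₁ i j * d i * d j =
      ∑ i ∈ range m, ∑ j ∈ range m, (G₁ i j - G₂ i j) * d i * solve G₂ m z j := by
    have e1 := form_solve h0 hG₁ m z d
    have e2 := form_solve h0 hG₂ m z d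
    have e3 : ∑ i ∈ range m, ∑ j ∈ range m, G₁ i j * d i * d j =
        ∑ i ∈ range m, ∑ j ∈ range m, (G₁ i j - G₂ i j) * d i * solve G₂ m z j +
        (∑ i ∈ range m, ∑ j ∈ range m, G₂ i j * d i * solve G₂ m z j -
          ∑ i ∈ range m, ∑ j ∈ range m, G₁ i j * d i * solve G₁ m z j) := by
      simp only [← sum_add_distrib, ← sum_sub_distrib]
      exact sum_congr rfl fun i _ => sum_congr rfl fun j _ => by simp only [hd]; ring
    rw [e3, e1, e2]; ring
  rw [e] at h1
  have h2 := (le_abs_self _).trans (form_sub_le m hδ h d (solve G₂ m z))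
  have h3 := sqrt_sqSum_solve_le h0 hG₂ m z
  rcases (Real.sqrt_nonneg (sqSum m d)).eq_or_lt with hz | hz
  · rw [hD, ← hz]; positivity
  · have h4 : (Λ₀ * D) * D ≤ (δ * m * (Λ₀⁻¹ * √(sqSum m z))) * D := by
      calc _ = Λ₀ * sqSum m d := by rw [← hD2]; ring
        _ ≤ δ * m * (D * √(sqSum m (solve G₂ m z))) := h1.trans h2
        _ ≤ δ * m * (D * (Λ₀⁻¹ * √(sqSum m z))) := by gcongr
        _ = _ := by ring
    have h5 := le_of_mul_le_mul_right h4 hz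
    calc D = Λ₀⁻¹ * (Λ₀ * D) := by field_simp
      _ ≤ Λ₀⁻¹ * (δ * m * (Λ₀⁻¹ * √(sqSum m z))) := by gcongr
      _ = _ := by ring

lemma solve_single (G : ℕ → ℕ → ℝ) {m j : ℕ} (hj : j < m) (i : ℕ) :
    solve G m (fun k => if k = j then 1 else 0) i = blockInv G m i j := by
  simp [solve, hj]

lemma sqSum_single {m j : ℕ} (hj : j < m) : sqSum m (fun k => if k = j then 1 else 0) = 1 := by
  simp [sqSum, hj]

lemma abs_le_sqrt_sqSum {m i : ℕ} (h : i < m) (z : ℕ → ℝ) : |z i| ≤ √(sqSum m z) :=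
  Real.abs_le_sqrt (sq_le_sqSum h z)

lemma abs_blockInv_le (h0 : 0 < Λ₀) (hG : Admissible Λ₀ Λ₁ Γ G) (m i j : ℕ) :
    |blockInv G m i j| ≤ Λ₀⁻¹ := by
  rcases lt_or_ge i m with hi | hi
  · rcases lt_or_ge j m with hj | hj
    · have := (abs_le_sqrt_sqSum hi _).trans
        (sqrt_sqSum_solve_le h0 hG m (fun k => if k = j then 1 else 0))
      rwa [sqSum_single hj, Real.sqrt_one, mul_one, solve_single G hj] at this
    · rw [blockInv_eq_zero' G hj]; simp [h0.le]
  · rw [blockInv_eq_zero G hi]; simp [h0.le]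

lemma abs_blockInv_sub_le (h0 : 0 < Λ₀) (hG₁ : Admissible Λ₀ Λ₁ Γ G₁)
    (hG₂ : Admissible Λ₀ Λ₁ Γ G₂) (m : ℕ) {δ : ℝ} (hδ : 0 ≤ δ)
    (h : ∀ i < m, ∀ j < m, |G₁ i j - G₂ i j| ≤ δ) (i j : ℕ) :
    |blockInv G₂ m i j - blockInv G₁ m i j| ≤ δ * m * Λ₀⁻¹ ^ 2 := by
  rcases lt_or_ge i m with hi | hi
  · rcases lt_or_ge j m with hj | hj
    · have := (abs_le_sqrt_sqSum hi _).trans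
        (sqrt_sqSum_solve_sub_le h0 hG₁ hG₂ m hδ h (fun k => if k = j then 1 else 0))
      rwa [sqSum_single hj, Real.sqrt_one, mul_one, solve_single G₁ hj, solve_single G₂ hj] at this
    · rw [blockInv_eq_zero' G₁ hj, blockInv_eq_zero' G₂ hj]; simp only [sub_self, abs_zero]
      positivity
  · rw [blockInv_eq_zero G₁ hi, blockInv_eq_zero G₂ hi]; simp only [sub_self, abs_zero]
    positivity

lemma abs_invQuad_sub_le (h0 : 0 < Λ₀) (hG₁ : Admissible Λ₀ Λ₁ Γ G₁)
    (hG₂ : Admissible Λ₀ Λ₁ Γ G₂) (m : ℕ) {δ : ℝ} (hδ : 0 ≤ δ)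
    (h : ∀ i < m, ∀ j < m, |G₁ i j - G₂ i j| ≤ δ) (z : ℕ → ℝ) :
    invQuad G₁ m z - invQuad G₂ m z ≤ δ * m * Λ₀⁻¹ ^ 2 * sqSum m z := by
  have e : invQuad G₁ m z - invQuad G₂ m z =
      ∑ i ∈ range m, -z i * (solve G₂ m z i - solve G₁ m z i) := by
    simp only [invQuad, ← sum_sub_distrib]
    exact sum_congr rfl fun i _ => by ring
  have h1 := sum_mul_le_sqrt m (fun i => -z i) (fun i => solve G₂ m z i - solve G₁ m z i)
  have h2 : sqSum m (fun i => -z i) = sqSum m z := by simp [sqSum]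
  have h3 := sqrt_sqSum_solve_sub_le h0 hG₁ hG₂ m hδ h z
  rw [e]
  calc _ ≤ √(sqSum m z) * (δ * m * Λ₀⁻¹ ^ 2 * √(sqSum m z)) := by
        rw [h2] at h1
        exact h1.trans (by gcongr)
    _ = δ * m * Λ₀⁻¹ ^ 2 * (√(sqSum m z) * √(sqSum m z)) := by ring
    _ = _ := by rw [Real.mul_self_sqrt (sqSum_nonneg _ _)]

/-- By the variational characterisation of the pivot, the residual of `G₂` is an admissible test
vector for `G₁`; its length is controlled by the pivot of `G₂`, which makes the error
multiplicative. -/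
lemma pivot_le_pivot_mul (h0 : 0 < Λ₀) (hG₁ : Admissible Λ₀ Λ₁ Γ G₁)
    (hG₂ : Admissible Λ₀ Λ₁ Γ G₂) (k : ℕ) {δ : ℝ} (hδ : 0 ≤ δ)
    (h : ∀ i < k + 1, ∀ j < k + 1, |G₁ i j - G₂ i j| ≤ δ) :
    pivot G₁ k ≤ pivot G₂ k * (1 + δ * (k + 1) / Λ₀) := by
  have h1 := pivot_le_form h0 hG₁ k (residual G₂ k) (residual_self _ _)
  have h2 := (le_abs_self _).trans (form_sub_le (k + 1) hδ h (residual G₂ k) (residual G₂ k))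
  have e : ∑ i ∈ range (k + 1), ∑ j ∈ range (k + 1), G₁ i j * residual G₂ k i * residual G₂ k j =
      ∑ i ∈ range (k + 1), ∑ j ∈ range (k + 1),
        (G₁ i j - G₂ i j) * residual G₂ k i * residual G₂ k j + pivot G₂ k := by
    rw [pivot_eq_form h0 hG₂, ← sum_add_distrib]
    refine sum_congr rfl fun i _ => ?_
    rw [← sum_add_distrib]
    exact sum_congr rfl fun j _ => by ring
  rw [Real.mul_self_sqrt (sqSum_nonneg _ _)] at h2
  have h3 := sqSum_residual_le h0 hG₂ k
  have h4 : sqSum (k + 1) (residual G₂ k) ≤ pivot G₂ k / Λ₀ := by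
    rw [le_div_iff₀ h0]; linarith
  push_cast at h2
  have h5 : δ * (k + 1) * sqSum (k + 1) (residual G₂ k) ≤ δ * (k + 1) * (pivot G₂ k / Λ₀) := by
    gcongr
  have h6 : pivot G₂ k * (1 + δ * (k + 1) / Λ₀) = δ * (k + 1) * (pivot G₂ k / Λ₀) + pivot G₂ k := by
    ring
  linarith

lemma prod_sqrt_pivot_pos (h0 : 0 < Λ₀) (hG : Admissible Λ₀ Λ₁ Γ G) (m : ℕ) :
    0 < ∏ k ∈ range m, √(2 * Real.pi * pivot G k) :=
  prod_pos fun k _ => Real.sqrt_pos.2 (by have := pivot_pos h0 hG k; positivity)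

lemma density_pos (h0 : 0 < Λ₀) (hG : Admissible Λ₀ Λ₁ Γ G) (m : ℕ) (z : ℕ → ℝ) :
    0 < density G m z :=
  mul_pos (inv_pos.2 (prod_sqrt_pivot_pos h0 hG m)) (Real.exp_pos _)

/-- Comparison of determinants pivot by pivot. Each of the `m` factors changes by at most `exp (δ m
/ (2 Λ₀))`, whence the exponent `δ m²`. -/
lemma prod_sqrt_pivot_le (h0 : 0 < Λ₀) (hG₁ : Admissible Λ₀ Λ₁ Γ G₁)
    (hG₂ : Admissible Λ₀ Λ₁ Γ G₂) (m : ℕ) {δ : ℝ} (hδ : 0 ≤ δ)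
    (h : ∀ i < m, ∀ j < m, |G₁ i j - G₂ i j| ≤ δ) :
    ∏ k ∈ range m, √(2 * Real.pi * pivot G₁ k) ≤
      (∏ k ∈ range m, √(2 * Real.pi * pivot G₂ k)) * Real.exp (δ * m ^ 2 / (2 * Λ₀)) := by
  have : Real.exp (δ * m ^ 2 / (2 * Λ₀)) = ∏ _k ∈ range m, Real.exp (δ * m / (2 * Λ₀)) := by
    rw [prod_const, card_range, ← Real.exp_nat_mul]; congr 1; ring
  rw [this, ← prod_mul_distrib]
  refine prod_le_prod (fun _ _ => Real.sqrt_nonneg _) fun k hk => ?_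
  have hk' := mem_range.1 hk
  have h1 := pivot_le_pivot_mul h0 hG₁ hG₂ k hδ
    (fun i hi j hj => h i (by omega) j (by omega))
  have hkm : ((k : ℝ) + 1) ≤ m := by exact_mod_cast hk'
  have hp := pivot_pos h0 hG₂ k
  have h2 : 1 + δ * (k + 1) / Λ₀ ≤ Real.exp (δ * m / (2 * Λ₀)) ^ 2 := by
    rw [← Real.exp_nat_mul]
    have : δ * (k + 1) / Λ₀ ≤ (2 : ℕ) * (δ * m / (2 * Λ₀)) := by
      have : (2 : ℕ) * (δ * m / (2 * Λ₀)) = δ * m / Λ₀ := by push_cast; field_simp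
      rw [this]; gcongr
    linarith [Real.add_one_le_exp ((2 : ℕ) * (δ * m / (2 * Λ₀)))]
  rw [← Real.sqrt_sq (Real.exp_pos (δ * m / (2 * Λ₀))).le, ← Real.sqrt_mul (by positivity)]
  apply Real.sqrt_le_sqrt
  calc 2 * Real.pi * pivot G₁ k ≤ 2 * Real.pi * (pivot G₂ k * (1 + δ * (k + 1) / Λ₀)) := by gcongr
    _ ≤ 2 * Real.pi * (pivot G₂ k * Real.exp (δ * m / (2 * Λ₀)) ^ 2) := by gcongr
    _ = _ := by ring

/-- Comparison of two Gaussian densities with entrywise close covariances. -/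
lemma density_le_density_mul (h0 : 0 < Λ₀) (hG₁ : Admissible Λ₀ Λ₁ Γ G₁)
    (hG₂ : Admissible Λ₀ Λ₁ Γ G₂) (m : ℕ) {δ : ℝ} (hδ : 0 ≤ δ)
    (h : ∀ i < m, ∀ j < m, |G₁ i j - G₂ i j| ≤ δ) (z : ℕ → ℝ) :
    density G₂ m z ≤ density G₁ m z *
      Real.exp (δ * m ^ 2 / (2 * Λ₀) + δ * m * Λ₀⁻¹ ^ 2 * sqSum m z / 2) := by
  have h1 := prod_sqrt_pivot_le h0 hG₁ hG₂ m hδ h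
  have h2 := abs_invQuad_sub_le h0 hG₁ hG₂ m hδ h z
  have p1 := prod_sqrt_pivot_pos h0 hG₁ m
  have p2 := prod_sqrt_pivot_pos h0 hG₂ m
  have h3 : (∏ k ∈ range m, √(2 * Real.pi * pivot G₂ k))⁻¹ ≤
      (∏ k ∈ range m, √(2 * Real.pi * pivot G₁ k))⁻¹ * Real.exp (δ * m ^ 2 / (2 * Λ₀)) := by
    rw [inv_mul_eq_div, inv_eq_one_div, div_le_div_iff₀ p2 p1]
    linarith
  have h4 : Real.exp (-invQuad G₂ m z / 2) ≤ Real.exp (-invQuad G₁ m z / 2) *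
      Real.exp (δ * m * Λ₀⁻¹ ^ 2 * sqSum m z / 2) := by
    rw [← Real.exp_add]
    apply Real.exp_le_exp.2
    linarith
  unfold density
  calc _ ≤ ((∏ k ∈ range m, √(2 * Real.pi * pivot G₁ k))⁻¹ * Real.exp (δ * m ^ 2 / (2 * Λ₀))) *
      (Real.exp (-invQuad G₁ m z / 2) * Real.exp (δ * m * Λ₀⁻¹ ^ 2 * sqSum m z / 2)) := by
        gcongr
    _ = _ := by rw [Real.exp_add]; ring

/-- Crude Gaussian upper bound. -/
lemma density_le (h0 : 0 < Λ₀) (hG : Admissible Λ₀ Λ₁ Γ G) (m : ℕ) (z : ℕ → ℝ) :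
    density G m z ≤ (√(2 * Real.pi * Λ₀))⁻¹ ^ m * Real.exp (-sqSum m z / (2 * Λ₁)) := by
  have h1 : 0 < Λ₁ := h0.trans_le ((le_pivot h0 hG 0).trans (pivot_le h0 hG 0))
  have h2 : (∏ k ∈ range m, √(2 * Real.pi * pivot G k))⁻¹ ≤ (√(2 * Real.pi * Λ₀))⁻¹ ^ m := by
    rw [inv_pow]
    apply inv_anti₀ (by positivity)
    rw [← card_range m, ← prod_const, card_range]
    refine prod_le_prod (fun _ _ => Real.sqrt_nonneg _) fun k _ => Real.sqrt_le_sqrt ?_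
    have := le_pivot h0 hG k
    gcongr
  have h3 : Real.exp (-invQuad G m z / 2) ≤ Real.exp (-sqSum m z / (2 * Λ₁)) := by
    apply Real.exp_le_exp.2
    have := sqSum_le_invQuad h0 hG m z
    rw [neg_div, neg_div, neg_le_neg_iff, div_le_div_iff₀ (by positivity) (by positivity)]
    linarith
  unfold density
  gcongr

/-- Cauchy–Schwarz, the shift by `n` being a contraction of `ℓ²`. The bound depends neither on `n`
nor on `N`, because both vectors are supported in the first `m` coordinates. -/
lemma sum_band_le (N n m : ℕ) (b x y : ℕ → ℝ) (hx : ∀ i, m ≤ i → x i = 0)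
    (hy : ∀ i, m ≤ i → y i = 0) {β : ℝ} (hβ : ∀ i ∈ range N, |b i| ≤ β) (hβ0 : 0 ≤ β) :
    |∑ i ∈ range N, b i * (x i * y (i + n))| ≤ β * (√(sqSum m x) * √(sqSum m y)) := by
  have ext : ∀ (w : ℕ → ℝ), (∀ i, m ≤ i → w i = 0) → ∀ M, sqSum M w ≤ sqSum m w := by
    intro w hw M
    calc sqSum M w ≤ sqSum (max m M) w :=
          sum_le_sum_of_subset_of_nonneg (range_mono (le_max_right m M))
            fun _ _ _ => sq_nonneg _
      _ = sqSum m w := (sum_subset (range_mono (le_max_left m M)) fun i _ hi => by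
          rw [hw i (by simpa using hi)]; simp).symm
  calc _ ≤ ∑ i ∈ range N, β * (|x i| * |y (i + n)|) := by
        refine (abs_sum_le_sum_abs _ _).trans (sum_le_sum fun i hi => ?_)
        rw [abs_mul, abs_mul]
        exact mul_le_mul_of_nonneg_right (hβ i hi) (by positivity)
    _ = β * ∑ i ∈ range N, |x i| * |y (i + n)| := by rw [mul_sum]
    _ ≤ β * (√(sqSum N x) * √(sqSum (N + n) y)) := by
        gcongr
        refine (sum_mul_le_sqrt N (fun i => |x i|) (fun i => |y (i + n)|)).trans ?_
        gcongr
        · simp [sqSum]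
        · simp only [sqSum, sq_abs]
          rw [Nat.add_comm N n, sum_range_add]
          have : 0 ≤ ∑ i ∈ range n, y i ^ 2 := sqSum_nonneg n y
          simp only [Nat.add_comm n] 
          linarith
    _ ≤ _ := by
        gcongr
        · exact ext x hx N
        · exact ext y hy _

lemma sum_band_const_le (N m : ℕ) (b x : ℕ → ℝ) (hx : ∀ i, m ≤ i → x i = 0) {β X : ℝ}
    (hβ : ∀ i ∈ range N, |b i| ≤ β) (hβ0 : 0 ≤ β) (hX : ∀ i, |x i| ≤ X) :
    |∑ i ∈ range N, b i * x i| ≤ m * (β * X) := by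
  have hX0 : 0 ≤ X := (abs_nonneg _).trans (hX 0)
  have hterm : ∀ i ∈ range N, |b i * x i| ≤ if i < m then β * X else 0 := fun i hi => by
    split_ifs with h
    · rw [abs_mul]; exact mul_le_mul (hβ i hi) (hX i) (abs_nonneg _) hβ0
    · rw [hx i (by omega)]; simp
  calc _ ≤ ∑ i ∈ range N, if i < m then β * X else 0 :=
        (abs_sum_le_sum_abs _ _).trans (sum_le_sum hterm)
    _ = ((range N).filter (· < m)).card * (β * X) := by
        rw [← sum_filter, sum_const, nsmul_eq_mul]
    _ ≤ m * (β * X) := by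
        gcongr
        calc _ ≤ (range m).card := card_le_card fun i hi => by
              simp only [mem_filter, mem_range] at hi ⊢; exact hi.2
          _ = m := card_range m

/-- Crude upper bound for the banded functional. -/
lemma abs_bandForm_le (h0 : 0 < Λ₀) (hG : Admissible Λ₀ Λ₁ Γ G) (N n m : ℕ) (b z : ℕ → ℝ) {β : ℝ}
    (hβ : ∀ i ∈ range N, |b i| ≤ β) (hβ0 : 0 ≤ β) :
    |bandForm N n b G m z| ≤ β * (Λ₀⁻¹ ^ 2 * sqSum m z + m * Λ₀⁻¹) := by
  have h1 := sum_band_le N n m b (solve G m z) (solve G m z) (fun i hi => solve_eq_zero G hi z)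
    (fun i hi => solve_eq_zero G hi z) hβ hβ0
  have h2 := sum_band_const_le N m b (fun i => blockInv G m i (i + n))
    (fun i hi => blockInv_eq_zero G hi _) hβ hβ0 (fun i => abs_blockInv_le h0 hG m i (i + n))
  have h3 := sqrt_sqSum_solve_le h0 hG m z
  have h4 : √(sqSum m (solve G m z)) * √(sqSum m (solve G m z)) ≤ Λ₀⁻¹ ^ 2 * sqSum m z := by
    calc _ ≤ (Λ₀⁻¹ * √(sqSum m z)) * (Λ₀⁻¹ * √(sqSum m z)) := by gcongr
      _ = Λ₀⁻¹ ^ 2 * (√(sqSum m z) * √(sqSum m z)) := by ring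
      _ = _ := by rw [Real.mul_self_sqrt (sqSum_nonneg _ _)]
  unfold bandForm
  simp only [mul_sub, sum_sub_distrib]
  calc _ ≤ _ := abs_sub _ _
    _ ≤ β * (Λ₀⁻¹ ^ 2 * sqSum m z) + m * (β * Λ₀⁻¹) :=
      add_le_add (h1.trans (by gcongr)) h2
    _ = _ := by ring

/-- Stability of the banded functional under entrywise perturbations. -/
lemma abs_bandForm_sub_le (h0 : 0 < Λ₀) (hG₁ : Admissible Λ₀ Λ₁ Γ G₁)
    (hG₂ : Admissible Λ₀ Λ₁ Γ G₂) (N n m : ℕ) (b z : ℕ → ℝ) {β : ℝ}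
    (hβ : ∀ i ∈ range N, |b i| ≤ β) (hβ0 : 0 ≤ β) {δ : ℝ} (hδ : 0 ≤ δ)
    (h : ∀ i < m, ∀ j < m, |G₁ i j - G₂ i j| ≤ δ) :
    |bandForm N n b G₂ m z - bandForm N n b G₁ m z| ≤
      β * (2 * δ * m * Λ₀⁻¹ ^ 3 * sqSum m z + δ * m ^ 2 * Λ₀⁻¹ ^ 2) := by
  set d : ℕ → ℝ := fun i => solve G₂ m z i - solve G₁ m z i with hd
  have hd0 : ∀ i, m ≤ i → d i = 0 := fun i hi => by
    simp [hd, solve_eq_zero G₁ hi, solve_eq_zero G₂ hi]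
  have z1 := fun i hi => solve_eq_zero G₁ (m := m) (i := i) hi z
  have z2 := fun i hi => solve_eq_zero G₂ (m := m) (i := i) hi z
  have h1 := sum_band_le N n m b d (solve G₂ m z) hd0 z2 hβ hβ0
  have h1' := sum_band_le N n m b (solve G₁ m z) d z1 hd0 hβ hβ0
  have h2 := sum_band_const_le N m b
    (fun i => blockInv G₂ m i (i + n) - blockInv G₁ m i (i + n))
    (fun i hi => by rw [blockInv_eq_zero G₁ hi, blockInv_eq_zero G₂ hi, sub_self]) hβ hβ0
    (fun i => abs_blockInv_sub_le h0 hG₁ hG₂ m hδ h i (i + n))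
  have s1 := sqrt_sqSum_solve_le h0 hG₁ m z
  have s2 := sqrt_sqSum_solve_le h0 hG₂ m z
  have sd := sqrt_sqSum_solve_sub_le h0 hG₁ hG₂ m hδ h z
  have hm := Real.mul_self_sqrt (sqSum_nonneg m z)
  have e : bandForm N n b G₂ m z - bandForm N n b G₁ m z =
      ∑ i ∈ range N, b i * (d i * solve G₂ m z (i + n)) +
      ∑ i ∈ range N, b i * (solve G₁ m z i * d (i + n)) -
      ∑ i ∈ range N, b i * (blockInv G₂ m i (i + n) - blockInv G₁ m i (i + n)) := by
    simp only [bandForm, ← sum_add_distrib, ← sum_sub_distrib]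
    exact sum_congr rfl fun i _ => by simp only [hd]; ring
  have q1 : √(sqSum m d) * √(sqSum m (solve G₂ m z)) ≤ δ * m * Λ₀⁻¹ ^ 3 * sqSum m z := by
    calc _ ≤ (δ * m * Λ₀⁻¹ ^ 2 * √(sqSum m z)) * (Λ₀⁻¹ * √(sqSum m z)) := by gcongr
      _ = δ * m * Λ₀⁻¹ ^ 3 * (√(sqSum m z) * √(sqSum m z)) := by ring
      _ = _ := by rw [hm]
  have q2 : √(sqSum m (solve G₁ m z)) * √(sqSum m d) ≤ δ * m * Λ₀⁻¹ ^ 3 * sqSum m z := by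
    calc _ ≤ (Λ₀⁻¹ * √(sqSum m z)) * (δ * m * Λ₀⁻¹ ^ 2 * √(sqSum m z)) := by gcongr
      _ = δ * m * Λ₀⁻¹ ^ 3 * (√(sqSum m z) * √(sqSum m z)) := by ring
      _ = _ := by rw [hm]
  rw [e]
  refine (abs_sub _ _).trans ((add_le_add_left (abs_add_le _ _) _).trans ?_)
  calc _ ≤ β * (δ * m * Λ₀⁻¹ ^ 3 * sqSum m z) + β * (δ * m * Λ₀⁻¹ ^ 3 * sqSum m z) +
        m * (β * (δ * m * Λ₀⁻¹ ^ 2)) :=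
      add_le_add (add_le_add (h1.trans (by gcongr)) (h1'.trans (by gcongr))) h2
    _ = _ := by ring

end TriGauss

end

/-! ### Gaussian moments and exact integration of the last coordinate -/

noncomputable section

namespace TriGauss

open Finset

variable {Λ₀ Λ₁ Γ : ℝ} {G G₁ G₂ : ℕ → ℕ → ℝ}

lemma integrable_pow_mul_gauss {s : ℝ} (hs : 0 < s) (k : ℕ) :
    Integrable fun x : ℝ => x ^ k * Real.exp (-x ^ 2 / (2 * s)) := by
  have := integrable_rpow_mul_exp_neg_mul_sq (b := 1 / (2 * s)) (by positivity)
    (s := (k : ℝ)) (by have : (0 : ℝ) ≤ k := k.cast_nonneg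
                       linarith)
  refine this.congr (Filter.Eventually.of_forall fun x => ?_)
  simp only [Real.rpow_natCast]
  congr 2; ring

/-- Integration by parts against the Gaussian weight. -/
lemma integral_pow_succ_mul_gauss {s : ℝ} (hs : 0 < s) (k : ℕ) :
    ∫ x : ℝ, x ^ (k + 1) * Real.exp (-x ^ 2 / (2 * s)) =
      s * k * ∫ x : ℝ, x ^ (k - 1) * Real.exp (-x ^ 2 / (2 * s)) := by
  have hd : ∀ x : ℝ, HasDerivAt (fun x : ℝ => x ^ k * Real.exp (-x ^ 2 / (2 * s)))
      (k * (x ^ (k - 1) * Real.exp (-x ^ 2 / (2 * s))) -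
        s⁻¹ * (x ^ (k + 1) * Real.exp (-x ^ 2 / (2 * s)))) x := fun x => by
    have h1 := hasDerivAt_pow k x
    have h2 : HasDerivAt (fun x : ℝ => -x ^ 2 / (2 * s)) (-(2 * x) / (2 * s)) x := by
      have := ((hasDerivAt_pow 2 x).neg).div_const (2 * s)
      simpa using this
    refine (h1.mul h2.exp).congr_deriv ?_
    rw [show -(2 * x) / (2 * s) = -(s⁻¹ * x) by field_simp]
    ring
  have hi := integral_eq_zero_of_hasDerivAt_of_integrable hd
    (((integrable_pow_mul_gauss hs (k - 1)).const_mul _).sub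
      ((integrable_pow_mul_gauss hs (k + 1)).const_mul _)) (integrable_pow_mul_gauss hs k)
  rw [integral_sub ((integrable_pow_mul_gauss hs (k - 1)).const_mul _)
    ((integrable_pow_mul_gauss hs (k + 1)).const_mul _), integral_const_mul,
    integral_const_mul] at hi
  have hs' : s * s⁻¹ = 1 := mul_inv_cancel₀ hs.ne'
  linear_combination (-s) * hi -
    (∫ x : ℝ, x ^ (k + 1) * Real.exp (-x ^ 2 / (2 * s))) * hs'

lemma integral_gauss {s : ℝ} (hs : 0 < s) :
    ∫ x : ℝ, Real.exp (-x ^ 2 / (2 * s)) = √(2 * Real.pi * s) := by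
  have := integral_gaussian (1 / (2 * s))
  rw [show Real.pi / (1 / (2 * s)) = 2 * Real.pi * s by field_simp] at this
  rw [← this]
  congr 1; ext x; congr 1; ring

/-- Second moment of a quadratic Hermite polynomial under a Gaussian density. -/
lemma lintegral_hermite_sq {s : ℝ} (hs : 0 < s) (A B D ν : ℝ) :
    ∫⁻ r : ℝ, ENNReal.ofReal ((A + B * (r + ν) + D * ((r + ν) ^ 2 - s)) ^ 2 *
      ((√(2 * Real.pi * s))⁻¹ * Real.exp (-(r + ν) ^ 2 / (2 * s)))) =
      ENNReal.ofReal (A ^ 2 + B ^ 2 * s + 2 * D ^ 2 * s ^ 2) := by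
  -- Translation invariance removes the shift `ν`. Afterwards `1`, `r` and `r² - s` are orthogonal
  -- with squared norms `1`, `s` and `2 s²`, so no cross terms appear.
  rw [lintegral_add_right_eq_self (μ := volume) (fun r : ℝ => ENNReal.ofReal
    ((A + B * r + D * (r ^ 2 - s)) ^ 2 * ((√(2 * Real.pi * s))⁻¹ * Real.exp (-r ^ 2 / (2 * s))))) ν]
  set E : ℝ → ℝ := fun x => Real.exp (-x ^ 2 / (2 * s)) with hE
  set Z := √(2 * Real.pi * s)
  have hZ : 0 < Z := Real.sqrt_pos.2 (by positivity)
  have e : (fun r : ℝ => (A + B * r + D * (r ^ 2 - s)) ^ 2 * (Z⁻¹ * E r)) = fun r =>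
      Z⁻¹ * (((A - D * s) ^ 2 * (r ^ 0 * E r) + 2 * (A - D * s) * B * (r ^ 1 * E r)) +
      ((B ^ 2 + 2 * (A - D * s) * D) * (r ^ 2 * E r) + 2 * B * D * (r ^ 3 * E r)) +
      D ^ 2 * (r ^ 4 * E r)) := by
    ext r; ring
  have I : ∀ (k : ℕ) (c : ℝ), Integrable (fun x => c * (x ^ k * E x)) := fun k c =>
    (integrable_pow_mul_gauss hs k).const_mul c
  have I01 := (I 0 ((A - D * s) ^ 2)).fun_add (I 1 (2 * (A - D * s) * B))
  have I23 := (I 2 (B ^ 2 + 2 * (A - D * s) * D)).fun_add (I 3 (2 * B * D))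
  have I03 := I01.fun_add I23
  have hint : Integrable (fun r : ℝ => (A + B * r + D * (r ^ 2 - s)) ^ 2 * (Z⁻¹ * E r)) := by
    rw [e]
    exact (I03.fun_add (I 4 (D ^ 2))).const_mul _
  rw [← ofReal_integral_eq_lintegral_ofReal hint
    (Filter.Eventually.of_forall fun r => by positivity)]
  congr 1
  rw [e, integral_const_mul, integral_add I03 (I 4 _), integral_add I01 I23,
    integral_add (I 0 _) (I 1 _), integral_add (I 2 _) (I 3 _)]
  simp only [integral_const_mul]
  have m0 : ∫ x : ℝ, x ^ 0 * E x = Z := by simpa using integral_gauss hs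
  have m1 : ∫ x : ℝ, x ^ 1 * E x = 0 := by
    simpa using integral_pow_succ_mul_gauss hs 0
  have m2 : ∫ x : ℝ, x ^ 2 * E x = s * Z := by
    rw [integral_pow_succ_mul_gauss hs 1, ← m0]; simp [hE]
  have m3 : ∫ x : ℝ, x ^ 3 * E x = 0 := by
    rw [integral_pow_succ_mul_gauss hs 2, m1]; simp
  have m4 : ∫ x : ℝ, x ^ 4 * E x = 3 * s ^ 2 * Z := by
    rw [integral_pow_succ_mul_gauss hs 3, m2]; push_cast; ring
  rw [m0, m1, m2, m3, m4]
  field_simp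
  ring

/-- The banded bilinear form `∑ᵢ bᵢ fᵢ hᵢ₊ₙ`. -/
def bandBilin (N n : ℕ) (b f h : ℕ → ℝ) : ℝ := ∑ i ∈ range N, b i * (f i * h (i + n))

/-- The increment of the second moment of the banded functional upon adding a coordinate. -/
def bandIncr (N n : ℕ) (b : ℕ → ℝ) (G : ℕ → ℕ → ℝ) (m : ℕ) (z : ℕ → ℝ) : ℝ :=
  (bandBilin N n b (residual G m) (solve G m z) +
    bandBilin N n b (solve G m z) (residual G m)) ^ 2 / pivot G m +
  2 * bandBilin N n b (residual G m) (residual G m) ^ 2 / pivot G m ^ 2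

lemma residual_sum_update (G : ℕ → ℕ → ℝ) (m : ℕ) (z : ℕ → ℝ) (r : ℝ) :
    ∑ j ∈ range (m + 1), residual G m j * Function.update z m r j =
      r + ∑ j ∈ range m, residual G m j * z j := by
  rw [sum_range_succ, residual_self, Function.update_self, one_mul, add_comm]
  congr 1
  refine sum_congr rfl fun j hj => ?_
  rw [Function.update_of_ne (mem_range.1 hj).ne]

lemma solve_update (G : ℕ → ℕ → ℝ) (m : ℕ) (z : ℕ → ℝ) (r : ℝ) :
    solve G m (Function.update z m r) = solve G m z :=
  funext fun i => solve_congr G (fun _ hj => Function.update_of_ne hj.ne _ _) i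

lemma invQuad_update (G : ℕ → ℕ → ℝ) (m : ℕ) (z : ℕ → ℝ) (r : ℝ) :
    invQuad G m (Function.update z m r) = invQuad G m z := by
  unfold invQuad
  rw [solve_update]
  exact sum_congr rfl fun j hj => by rw [Function.update_of_ne (mem_range.1 hj).ne]

/-- The joint density is the marginal of the first `m` coordinates times the conditional one, which
is Gaussian in the innovation with variance the pivot. -/
lemma density_succ_update (h0 : 0 < Λ₀) (hG : Admissible Λ₀ Λ₁ Γ G) (m : ℕ) (z : ℕ → ℝ) (r : ℝ) :
    density G (m + 1) (Function.update z m r) = density G m z *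
      ((√(2 * Real.pi * pivot G m))⁻¹ *
        Real.exp (-(r + ∑ j ∈ range m, residual G m j * z j) ^ 2 / (2 * pivot G m))) := by
  have hp := pivot_pos h0 hG m
  unfold density
  rw [prod_range_succ, invQuad_succ, residual_sum_update, invQuad_update, mul_inv]
  rw [show -(invQuad G m z + (r + ∑ j ∈ range m, residual G m j * z j) ^ 2 / pivot G m) / 2 =
    -invQuad G m z / 2 +
      -(r + ∑ j ∈ range m, residual G m j * z j) ^ 2 / (2 * pivot G m) by field_simp; ring,
    Real.exp_add]
  ring

/-- Martingale structure: subtracting `blockInv` in the definition of `bandForm` makes the increment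
a combination of the first two Hermite polynomials of the innovation, both centred under the
conditional law. -/
lemma bandForm_succ_update (h0 : 0 < Λ₀) (hG : Admissible Λ₀ Λ₁ Γ G) (N n : ℕ) (b : ℕ → ℝ) (m : ℕ)
    (z : ℕ → ℝ) (r : ℝ) :
    bandForm N n b G (m + 1) (Function.update z m r) = bandForm N n b G m z +
      (bandBilin N n b (residual G m) (solve G m z) +
        bandBilin N n b (solve G m z) (residual G m)) / pivot G m *
        (r + ∑ j ∈ range m, residual G m j * z j) +
      bandBilin N n b (residual G m) (residual G m) / pivot G m ^ 2 *
        ((r + ∑ j ∈ range m, residual G m j * z j) ^ 2 - pivot G m) := by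
  have hp := pivot_pos h0 hG m
  simp only [bandForm, bandBilin, solve_succ, residual_sum_update, solve_update, blockInv_succ,
    ← sum_add_distrib, sum_div, sum_mul]
  refine sum_congr rfl fun i _ => ?_
  field_simp
  ring

/-- Integrating out the last coordinate. -/
lemma lintegral_bandForm_succ (h0 : 0 < Λ₀) (hG : Admissible Λ₀ Λ₁ Γ G) (N n : ℕ) (b : ℕ → ℝ)
    (c : ℝ) (m : ℕ) (z : ℕ → ℝ) :
    ∫⁻ r : ℝ, ENNReal.ofReal ((c + bandForm N n b G (m + 1) (Function.update z m r)) ^ 2 *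
      density G (m + 1) (Function.update z m r)) =
    ENNReal.ofReal (((c + bandForm N n b G m z) ^ 2 + bandIncr N n b G m z) * density G m z) := by
  have hp := pivot_pos h0 hG m
  have hd := density_pos h0 hG m z
  set U := bandBilin N n b (residual G m) (solve G m z) +
        bandBilin N n b (solve G m z) (residual G m) with hU
  set T := bandBilin N n b (residual G m) (residual G m) with hT
  set ν := ∑ j ∈ range m, residual G m j * z j
  have e : ∀ r : ℝ, ENNReal.ofReal ((c + bandForm N n b G (m + 1) (Function.update z m r)) ^ 2 *
      density G (m + 1) (Function.update z m r)) = ENNReal.ofReal (density G m z) *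
      ENNReal.ofReal ((c + bandForm N n b G m z + U / pivot G m * (r + ν) +
        T / pivot G m ^ 2 * ((r + ν) ^ 2 - pivot G m)) ^ 2 *
        ((√(2 * Real.pi * pivot G m))⁻¹ * Real.exp (-(r + ν) ^ 2 / (2 * pivot G m)))) := by
    intro r
    rw [← ENNReal.ofReal_mul hd.le, density_succ_update h0 hG, bandForm_succ_update h0 hG]
    congr 1; ring
  simp only [e]
  rw [lintegral_const_mul' _ _ ENNReal.ofReal_ne_top, lintegral_hermite_sq hp,
    ← ENNReal.ofReal_mul hd.le, bandIncr, ← hU, ← hT]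
  congr 1
  field_simp
  ring

end TriGauss

end

/-! ### Iterated integrals, adapted families of covariances, and a discrete Grönwall inequality -/

noncomputable section

namespace TriGauss

open Finset

variable {Λ₀ Λ₁ Γ L : ℝ}

/-- Iterated Lebesgue integral over the first `m` coordinates. -/
def iterInt (m : ℕ) (f : (ℕ → ℝ) → ENNReal) : ENNReal :=
  lmarginal (fun _ : ℕ => (volume : Measure ℝ)) (range m) f 0

lemma iterInt_zero (f : (ℕ → ℝ) → ENNReal) : iterInt 0 f = f 0 := by
  simp [iterInt]

lemma iterInt_succ (m : ℕ) {f : (ℕ → ℝ) → ENNReal} (hf : Measurable f) :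
    iterInt (m + 1) f = iterInt m fun z => ∫⁻ r : ℝ, f (Function.update z m r) := by
  unfold iterInt
  rw [range_add_one, lmarginal_insert' f hf notMem_range_self]

lemma iterInt_mono (m : ℕ) {f g : (ℕ → ℝ) → ENNReal} (h : ∀ z, f z ≤ g z) :
    iterInt m f ≤ iterInt m g := lmarginal_mono h 0

lemma iterInt_congr (m : ℕ) {f g : (ℕ → ℝ) → ENNReal} (h : ∀ z, f z = g z) :
    iterInt m f = iterInt m g := by rw [funext h]

lemma iterInt_add (m : ℕ) {f : (ℕ → ℝ) → ENNReal} (hf : Measurable f) (g : (ℕ → ℝ) → ENNReal) :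
    iterInt m (fun z => f z + g z) = iterInt m f + iterInt m g := by
  unfold iterInt lmarginal
  exact lintegral_add_left (hf.comp measurable_updateFinset) _

lemma iterInt_const_mul (m : ℕ) {f : (ℕ → ℝ) → ENNReal} (hf : Measurable f) (c : ENNReal) :
    iterInt m (fun z => c * f z) = c * iterInt m f := by
  unfold iterInt lmarginal
  exact lintegral_const_mul _ (hf.comp measurable_updateFinset)

lemma iterInt_sum (m : ℕ) {ι : Type*} (s : Finset ι) {f : ι → (ℕ → ℝ) → ENNReal}
    (hf : ∀ i, Measurable (f i)) :
    iterInt m (fun z => ∑ i ∈ s, f i z) = ∑ i ∈ s, iterInt m (f i) := by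
  unfold iterInt lmarginal
  exact lintegral_finsetSum _ fun i _ => (hf i).comp measurable_updateFinset

/-- A family of admissible matrices, the `m`-th one depending only on the first `m` coordinates,
with small increments. -/
structure AdaptedFamily (Λ₀ Λ₁ Γ L : ℝ) (G : ℕ → (ℕ → ℝ) → ℕ → ℕ → ℝ) : Prop where
  meas : ∀ m i j, Measurable fun z => G m z i j
  indep : ∀ (m : ℕ) (z : ℕ → ℝ) (r : ℝ), G m (Function.update z m r) = G m z
  adm : ∀ m z, Admissible Λ₀ Λ₁ Γ (G m z)
  -- With `M = m + 1` and `|z|² ≤ M^{3/2}`, hence `|z m| ≤ M^{3/4}`, this is of order `M^{-15/4}`.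
  -- The quadratic form loses `M · |z|² ≤ M^{5/2}` and the determinant `M²`, which leaves the
  -- summable orders `M^{-5/4}` and `M^{-7/4}`. This is the origin of the exponent `9/2`.
  step : ∀ (m : ℕ) (z : ℕ → ℝ) (i j : ℕ),
    |G m z i j - G (m + 1) z i j| ≤ L * ((m : ℝ) + 1) ^ (-(9 / 2) : ℝ) * (1 + |z m|)

section Measurability

variable {H : (ℕ → ℝ) → ℕ → ℕ → ℝ}

lemma measurable_blockInv (hH : ∀ i j, Measurable fun z => H z i j) (m : ℕ) :
    ∀ i j, Measurable fun z => blockInv (H z) m i j := by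
  induction m with
  | zero => intro i j; exact measurable_const
  | succ m ih =>
    have hr : ∀ i, Measurable fun z => residual (H z) m i := fun i => by
      simp only [residual, residualOf]
      split_ifs
      · fun_prop
      · exact measurable_const
      · exact measurable_const
    have hp : Measurable fun z => pivot (H z) m := by
      simp only [pivot_eq]; fun_prop
    intro i j
    simp only [blockInv_succ]
    exact (ih i j).add (((hr i).mul (hr j)).div hp)

lemma measurable_residual (hH : ∀ i j, Measurable fun z => H z i j) (m i : ℕ) :
    Measurable fun z => residual (H z) m i := by
  have := measurable_blockInv hH m
  simp only [residual, residualOf]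
  split_ifs
  · fun_prop
  · exact measurable_const
  · exact measurable_const

lemma measurable_pivot (hH : ∀ i j, Measurable fun z => H z i j) (m : ℕ) :
    Measurable fun z => pivot (H z) m := by
  have := measurable_residual hH m
  simp only [pivot_eq]; fun_prop

lemma measurable_solve (hH : ∀ i j, Measurable fun z => H z i j) (m i : ℕ) :
    Measurable fun z => solve (H z) m z i := by
  have := measurable_blockInv hH m
  simp only [solve]; fun_prop

lemma measurable_density (hH : ∀ i j, Measurable fun z => H z i j) (m : ℕ) :
    Measurable fun z => density (H z) m z := by
  have h1 := measurable_pivot hH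
  have h2 := measurable_solve hH m
  simp only [density, invQuad]
  refine Measurable.mul ?_ ?_
  · refine Measurable.inv (Finset.measurable_fun_prod _ fun k _ => ?_)
    exact ((h1 k).const_mul _).sqrt
  · fun_prop

lemma measurable_bandForm (hH : ∀ i j, Measurable fun z => H z i j) (N n : ℕ) (b : ℕ → ℝ) (m : ℕ) :
    Measurable fun z => bandForm N n b (H z) m z := by
  have h1 := measurable_blockInv hH m
  have h2 := measurable_solve hH m
  simp only [bandForm]; fun_prop

end Measurability

lemma measurable_sqSum (m : ℕ) : Measurable (sqSum m) := by
  unfold sqSum; fun_prop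

/-- Gaussian integral over `m` coordinates. -/
lemma iterInt_gauss {s : ℝ} (hs : 0 < s) (m : ℕ) :
    iterInt m (fun z => ENNReal.ofReal (Real.exp (-sqSum m z / (2 * s)))) =
      ENNReal.ofReal (√(2 * Real.pi * s) ^ m) := by
  induction m with
  | zero => simp [iterInt_zero, sqSum]
  | succ m ih =>
    have hm : ∀ k, Measurable fun z => ENNReal.ofReal (Real.exp (-sqSum k z / (2 * s))) := fun k => by
      have := measurable_sqSum k
      fun_prop
    rw [iterInt_succ m (hm _), pow_succ, ENNReal.ofReal_mul (by positivity), ← ih,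
      mul_comm (iterInt m _),
      ← iterInt_const_mul m (hm m)]
    refine iterInt_congr m fun z => ?_
    have e : ∀ r, ENNReal.ofReal (Real.exp (-sqSum (m + 1) (Function.update z m r) / (2 * s))) =
        ENNReal.ofReal (Real.exp (-sqSum m z / (2 * s))) *
          ENNReal.ofReal (Real.exp (-r ^ 2 / (2 * s))) := fun r => by
      rw [← ENNReal.ofReal_mul (Real.exp_pos _).le, ← Real.exp_add, sqSum, sum_range_succ,
        Function.update_self]
      congr 2
      rw [sqSum, sum_congr rfl fun j hj => by rw [Function.update_of_ne (mem_range.1 hj).ne]]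
      ring
    simp only [e]
    rw [lintegral_const_mul' _ _ ENNReal.ofReal_ne_top, mul_comm]
    congr 1
    have hi : Integrable fun x : ℝ => Real.exp (-x ^ 2 / (2 * s)) := by
      simpa using integrable_pow_mul_gauss hs 0
    rw [← ofReal_integral_eq_lintegral_ofReal hi
      (Filter.Eventually.of_forall fun _ => (Real.exp_pos _).le), integral_gauss hs]

/-- A discrete Grönwall inequality. -/
lemma gronwall {F : ℕ → ENNReal} {a B : ℕ → ℝ} (ha : ∀ m, 0 ≤ a m) (hB : ∀ m, 0 ≤ B m)
    (h : ∀ m, F (m + 1) ≤ ENNReal.ofReal (1 + a m) * F m + ENNReal.ofReal (B m)) (m : ℕ) :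
    F m ≤ ENNReal.ofReal (Real.exp (∑ k ∈ range m, a k)) *
      (F 0 + ENNReal.ofReal (∑ k ∈ range m, B k)) := by
  induction m with
  | zero => simp
  | succ m ih =>
    set E := Real.exp (∑ k ∈ range m, a k) with hE
    have hsum : 0 ≤ ∑ k ∈ range m, B k := sum_nonneg fun k _ => hB k
    have h1 : ENNReal.ofReal (1 + a m) * ENNReal.ofReal E ≤
        ENNReal.ofReal (Real.exp (∑ k ∈ range (m + 1), a k)) := by
      rw [← ENNReal.ofReal_mul (by linarith [ha m])]
      apply ENNReal.ofReal_le_ofReal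
      rw [sum_range_succ, Real.exp_add, mul_comm]
      gcongr
      linarith [Real.add_one_le_exp (a m)]
    have h2 : (1 : ENNReal) ≤ ENNReal.ofReal (Real.exp (∑ k ∈ range (m + 1), a k)) := by
      rw [← ENNReal.ofReal_one]
      exact ENNReal.ofReal_le_ofReal (Real.one_le_exp (sum_nonneg fun k _ => ha k))
    set E' := ENNReal.ofReal (Real.exp (∑ k ∈ range (m + 1), a k))
    calc F (m + 1) ≤ ENNReal.ofReal (1 + a m) * (ENNReal.ofReal E *
          (F 0 + ENNReal.ofReal (∑ k ∈ range m, B k))) + ENNReal.ofReal (B m) :=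
          (h m).trans (by gcongr)
      _ = ENNReal.ofReal (1 + a m) * ENNReal.ofReal E *
          (F 0 + ENNReal.ofReal (∑ k ∈ range m, B k)) + 1 * ENNReal.ofReal (B m) := by ring
      _ ≤ E' * (F 0 + ENNReal.ofReal (∑ k ∈ range m, B k)) + E' * ENNReal.ofReal (B m) := by
          gcongr
      _ = E' * (F 0 + ENNReal.ofReal (∑ k ∈ range (m + 1), B k)) := by
          rw [sum_range_succ, ENNReal.ofReal_add hsum (hB m)]; ring

/-- The summable sequence `(m + 1) ^ (-5 / 4)`. -/
def rate (m : ℕ) : ℝ := ((m : ℝ) + 1) ^ (-(5 / 4) : ℝ)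

lemma rate_pos (m : ℕ) : 0 < rate m := Real.rpow_pos_of_pos (by positivity) _

lemma summable_rate : Summable rate := by
  have h := (Real.summable_nat_rpow (p := -(5 / 4))).2 (by norm_num)
  have := (summable_nat_add_iff 1).2 h
  refine this.congr fun m => ?_
  simp [rate]

/-- With `q = (m + 1)^{1/4}` all the fractional exponents become integers, and the bookkeeping
reduces to algebra. -/
lemma exists_quarter (m : ℕ) : ∃ q : ℝ, 1 ≤ q ∧ q ^ 4 = (m : ℝ) + 1 ∧ rate m = (q ^ 5)⁻¹ ∧
    ((m : ℝ) + 1) ^ (-(9 / 2) : ℝ) = (q ^ 18)⁻¹ ∧ ((m : ℝ) + 1) ^ (3 / 2 : ℝ) = q ^ 6 := by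
  have hm : (1 : ℝ) ≤ (m : ℝ) + 1 := by have : (0 : ℝ) ≤ m := m.cast_nonneg
                                        linarith
  have hm0 : (0 : ℝ) ≤ (m : ℝ) + 1 := by linarith
  refine ⟨((m : ℝ) + 1) ^ (1 / 4 : ℝ), Real.one_le_rpow hm (by norm_num), ?_, ?_, ?_, ?_⟩
  · rw [← Real.rpow_natCast, ← Real.rpow_mul hm0]; norm_num
  · rw [rate, Real.rpow_neg hm0, ← Real.rpow_natCast, ← Real.rpow_mul hm0]; norm_num
  · rw [Real.rpow_neg hm0, ← Real.rpow_natCast, ← Real.rpow_mul hm0]; norm_num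
  · rw [← Real.rpow_natCast, ← Real.rpow_mul hm0]; norm_num

end TriGauss

end

/-! ### Cost of replacing one matrix of an adapted family by the next -/

noncomputable section

namespace TriGauss

open Finset

variable {Λ₀ Λ₁ Γ L : ℝ}

/-- With `q⁴ = m + 1`: the Gaussian gain `exp (-b (m + 1)^{3/2})` beats the geometric growth of the
normalising constants and still leaves the summable rate `q⁻⁵`. -/
lemma exists_exp_quartic_le {a b : ℝ} (ha : 0 ≤ a) (hb : 0 < b) :
    ∃ C : ℝ, 0 ≤ C ∧ ∀ q : ℝ, 1 ≤ q → Real.exp (a * q ^ 4 - b * q ^ 6) ≤ C * (q ^ 5)⁻¹ := by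
  refine ⟨2 / b * Real.exp (a * (2 * a / b) ^ 2), by positivity, fun q hq => ?_⟩
  have hq0 : 0 < q := by linarith
  have h1 : a * q ^ 4 ≤ b / 2 * q ^ 6 + a * (2 * a / b) ^ 2 := by
    rcases le_total (q ^ 2) (2 * a / b) with h | h
    · have : q ^ 4 ≤ (2 * a / b) ^ 2 := by
        calc q ^ 4 = (q ^ 2) ^ 2 := by ring
          _ ≤ _ := by gcongr
      have := mul_le_mul_of_nonneg_left this ha
      have : 0 ≤ b / 2 * q ^ 6 := by positivity
      linarith
    · have h' : a ≤ b / 2 * q ^ 2 := by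
        rw [div_le_iff₀ hb] at h; linarith
      have : a * q ^ 4 ≤ b / 2 * q ^ 2 * q ^ 4 := by gcongr
      have : 0 ≤ a * (2 * a / b) ^ 2 := by positivity
      nlinarith
  have h2 : q ^ 5 ≤ 2 / b * Real.exp (b / 2 * q ^ 6) := by
    have e1 : q ^ 5 ≤ q ^ 6 := pow_le_pow_right₀ hq (by norm_num)
    have e2 := Real.add_one_le_exp (b / 2 * q ^ 6)
    calc q ^ 5 ≤ 2 / b * (b / 2 * q ^ 6) := by
          rw [← mul_assoc, show 2 / b * (b / 2) = 1 by field_simp, one_mul]; exact e1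
      _ ≤ _ := by gcongr; linarith
  rw [← div_eq_mul_inv, le_div_iff₀ (by positivity)]
  calc Real.exp (a * q ^ 4 - b * q ^ 6) * q ^ 5
      ≤ Real.exp (a * q ^ 4 - b * q ^ 6) * (2 / b * Real.exp (b / 2 * q ^ 6)) := by gcongr
    _ = 2 / b * Real.exp (a * q ^ 4 - b * q ^ 6 + b / 2 * q ^ 6) := by rw [Real.exp_add]; ring
    _ ≤ _ := by gcongr; linarith

/-- Weight of the Gaussian remainder on the event that the first `m + 1` coordinates are large. -/
def tail (Λ₀ Λ₁ : ℝ) (m : ℕ) : ℝ :=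
  (√(2 * Real.pi * Λ₀))⁻¹ ^ (m + 1) * Real.exp (-((m : ℝ) + 1) ^ (3 / 2 : ℝ) / (8 * Λ₁))

lemma tail_nonneg (Λ₀ Λ₁ : ℝ) (m : ℕ) : 0 ≤ tail Λ₀ Λ₁ m := by unfold tail; positivity

lemma exists_tail_le (h0 : 0 < Λ₀) (h01 : Λ₀ ≤ Λ₁) :
    ∃ C : ℝ, 0 ≤ C ∧ ∀ m, tail Λ₀ Λ₁ m * √(2 * Real.pi * (2 * Λ₁)) ^ (m + 1) ≤ C * rate m := by
  have h1 : 0 < Λ₁ := h0.trans_le h01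
  set ρ := √(2 * Real.pi * (2 * Λ₁)) / √(2 * Real.pi * Λ₀) with hρ
  have hs : 0 < √(2 * Real.pi * Λ₀) := Real.sqrt_pos.2 (by positivity)
  have hρ1 : 1 ≤ ρ := by
    rw [hρ, one_le_div hs]
    apply Real.sqrt_le_sqrt
    have := Real.pi_pos
    nlinarith
  obtain ⟨C, hC, h⟩ := exists_exp_quartic_le (Real.log_nonneg hρ1)
    (show 0 < (8 * Λ₁)⁻¹ by positivity)
  refine ⟨C, hC, fun m => ?_⟩
  obtain ⟨q, hq, hq4, hr, -, h32⟩ := exists_quarter m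
  rw [hr]
  refine le_trans (le_of_eq ?_) (h q hq)
  have : ρ ^ (m + 1) = Real.exp (Real.log ρ * q ^ 4) := by
    rw [hq4, mul_comm, ← Nat.cast_succ, Real.exp_nat_mul, Real.exp_log (by linarith)]
  rw [tail, h32, sub_eq_add_neg, Real.exp_add, ← this, hρ, div_pow, inv_pow]
  rw [show -q ^ 6 / (8 * Λ₁) = -((8 * Λ₁)⁻¹ * q ^ 6) by field_simp]
  ring

lemma AdaptedFamily.nonneg {G : ℕ → (ℕ → ℝ) → ℕ → ℕ → ℝ} (hG : AdaptedFamily Λ₀ Λ₁ Γ L G) :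
    0 ≤ L := by
  have := (abs_nonneg _).trans (hG.step 0 0 0 0)
  simpa using this

/-- The step on the event `|z|² ≤ (m + 1)^{3/2}`, with `X = |z|²`, `y = |z m|` and `ε` the rate. The
density changes by a factor `1 + O(ε)` and the functional by `O(β ε)`. -/
lemma good_step {b ε q L Λ₀ X y β c S₁ S₂ Q₁ Q₂ : ℝ} (h0 : 0 < Λ₀) (hL : 0 ≤ L) (hq : 1 ≤ q)
    (hX0 : 0 ≤ X) (hX : X ≤ q ^ 6) (hy0 : 0 ≤ y) (hy : y ^ 2 ≤ X) (hε : ε = (q ^ 5)⁻¹) (hβ : 0 ≤ β)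
    (hQ₁ : 0 ≤ Q₁) (hb : b = L * (q ^ 18)⁻¹ * (1 + y))
    (hS : |S₂ - S₁| ≤ β * (2 * b * q ^ 4 * Λ₀⁻¹ ^ 3 * X + b * (q ^ 4) ^ 2 * Λ₀⁻¹ ^ 2))
    (hQ : Q₂ ≤ Q₁ * Real.exp (b * (q ^ 4) ^ 2 / (2 * Λ₀) + b * q ^ 4 * Λ₀⁻¹ ^ 2 * X / 2)) :
    (c + S₂) ^ 2 * Q₂ ≤
      (1 + (1 + 2 * ((L * Λ₀⁻¹ + L * Λ₀⁻¹ ^ 2) * Real.exp (L * Λ₀⁻¹ + L * Λ₀⁻¹ ^ 2))) * ε) *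
        ((c + S₁) ^ 2 * Q₁) +
      2 * (4 * L * Λ₀⁻¹ ^ 3 + 2 * L * Λ₀⁻¹ ^ 2) ^ 2 *
        (1 + (L * Λ₀⁻¹ + L * Λ₀⁻¹ ^ 2) * Real.exp (L * Λ₀⁻¹ + L * Λ₀⁻¹ ^ 2)) * β ^ 2 * ε * Q₁ := by
  have hq0 : 0 < q := by linarith
  have hyq : y ≤ q ^ 3 := by
    have : y ^ 2 ≤ (q ^ 3) ^ 2 := by rw [← pow_mul]; exact hy.trans hX
    exact le_of_sq_le_sq this (by positivity)
  have hb0 : 0 ≤ b := by rw [hb]; positivity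
  have hq3 : 1 ≤ q ^ 3 := one_le_pow₀ hq
  have hb1 : b ≤ 2 * L * (q ^ 15)⁻¹ := by
    calc b ≤ L * (q ^ 18)⁻¹ * (q ^ 3 + q ^ 3) := by rw [hb]; gcongr
      _ = _ := by field_simp; ring
  have hε0 : 0 < ε := by rw [hε]; positivity
  have hε1 : ε ≤ 1 := by rw [hε]; exact inv_le_one_of_one_le₀ (one_le_pow₀ hq)
  have hbX : b * q ^ 4 * X ≤ 2 * L * ε := by
    calc _ ≤ 2 * L * (q ^ 15)⁻¹ * q ^ 4 * q ^ 6 := by gcongr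
      _ = _ := by rw [hε]; field_simp
  have hb8 : b * (q ^ 4) ^ 2 ≤ 2 * L * ε := by
    calc _ ≤ 2 * L * (q ^ 15)⁻¹ * (q ^ 4) ^ 2 := by gcongr
      _ = 2 * L * ((q ^ 7)⁻¹) := by field_simp
      _ ≤ _ := by
        rw [hε]
        have : (q ^ 7)⁻¹ ≤ (q ^ 5)⁻¹ :=
          inv_anti₀ (by positivity) (pow_le_pow_right₀ hq (by norm_num))
        gcongr
  set κ := L * Λ₀⁻¹ + L * Λ₀⁻¹ ^ 2 with hκ
  have hκ0 : 0 ≤ κ := by positivity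
  have hexp : Real.exp (b * (q ^ 4) ^ 2 / (2 * Λ₀) + b * q ^ 4 * Λ₀⁻¹ ^ 2 * X / 2) ≤
      1 + κ * Real.exp κ * ε := by
    have e1 : b * (q ^ 4) ^ 2 / (2 * Λ₀) + b * q ^ 4 * Λ₀⁻¹ ^ 2 * X / 2 ≤ κ * ε := by
      calc _ = b * (q ^ 4) ^ 2 * (Λ₀⁻¹ / 2) + b * q ^ 4 * X * (Λ₀⁻¹ ^ 2 / 2) := by
            field_simp
        _ ≤ 2 * L * ε * (Λ₀⁻¹ / 2) + 2 * L * ε * (Λ₀⁻¹ ^ 2 / 2) := by gcongr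
        _ = _ := by rw [hκ]; ring
    refine (Real.exp_le_exp.2 e1).trans ?_
    have e2 := Real.add_one_le_exp (-(κ * ε))
    have e3 : Real.exp (κ * ε) * (1 - κ * ε) ≤ 1 := by
      calc _ ≤ Real.exp (κ * ε) * Real.exp (-(κ * ε)) := by gcongr; linarith
        _ = 1 := by rw [← Real.exp_add]; simp
    have e4 : Real.exp (κ * ε) ≤ Real.exp κ := Real.exp_le_exp.2 (mul_le_of_le_one_right hκ0 hε1)
    have : κ * ε * Real.exp (κ * ε) ≤ κ * ε * Real.exp κ := by gcongr
    linarith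
  set κ₂ := κ * Real.exp κ
  have hκ₂ : 0 ≤ κ₂ := by positivity
  set κ₃ := 4 * L * Λ₀⁻¹ ^ 3 + 2 * L * Λ₀⁻¹ ^ 2 with hκ₃
  have hS' : |S₂ - S₁| ≤ β * (κ₃ * ε) := by
    refine hS.trans (mul_le_mul_of_nonneg_left ?_ hβ)
    calc _ = 2 * Λ₀⁻¹ ^ 3 * (b * q ^ 4 * X) + Λ₀⁻¹ ^ 2 * (b * (q ^ 4) ^ 2) := by ring
      _ ≤ 2 * Λ₀⁻¹ ^ 3 * (2 * L * ε) + Λ₀⁻¹ ^ 2 * (2 * L * ε) := by gcongr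
      _ = _ := by rw [hκ₃]; ring
  have hsq : (S₂ - S₁) ^ 2 ≤ (β * (κ₃ * ε)) ^ 2 := by
    rw [← sq_abs]; gcongr
  have hmain : (c + S₂) ^ 2 ≤ (1 + ε) * (c + S₁) ^ 2 + 2 * κ₃ ^ 2 * β ^ 2 * ε := by
    -- Young's inequality with parameter `ε`: since `S₂ - S₁ = O(β ε)`, the loss `ε⁻¹` still leaves
    -- an error of order `β² ε`.
    have h1 : (c + S₂) ^ 2 ≤ (1 + ε) * (c + S₁) ^ 2 + (1 + ε⁻¹) * (S₂ - S₁) ^ 2 := by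
      have h2 : 2 * (c + S₁) * (S₂ - S₁) ≤ ε * (c + S₁) ^ 2 + ε⁻¹ * (S₂ - S₁) ^ 2 := by
        have := mul_nonneg (inv_pos.2 hε0).le (sq_nonneg (ε * (c + S₁) - (S₂ - S₁)))
        have e : ε⁻¹ * (ε * (c + S₁) - (S₂ - S₁)) ^ 2 =
          ε * (c + S₁) ^ 2 + ε⁻¹ * (S₂ - S₁) ^ 2 - 2 * (c + S₁) * (S₂ - S₁) := by
          field_simp; ring
        linarith
      have h2' : (c + S₂) ^ 2 = (c + S₁) ^ 2 + 2 * (c + S₁) * (S₂ - S₁) + (S₂ - S₁) ^ 2 := by ring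
      rw [h2', add_mul, add_mul, one_mul, one_mul]
      linarith
    have h3 : (1 + ε⁻¹) * (S₂ - S₁) ^ 2 ≤ (1 + ε⁻¹) * (β * (κ₃ * ε)) ^ 2 := by gcongr
    have h4 : (1 + ε⁻¹) * (β * (κ₃ * ε)) ^ 2 = (ε + 1) * (κ₃ ^ 2 * β ^ 2 * ε) := by
      field_simp
    have h5 : (ε + 1) * (κ₃ ^ 2 * β ^ 2 * ε) ≤ 2 * (κ₃ ^ 2 * β ^ 2 * ε) := by gcongr; linarith
    linarith
  calc (c + S₂) ^ 2 * Q₂ ≤ (c + S₂) ^ 2 * (Q₁ * (1 + κ₂ * ε)) := by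
        gcongr
        exact hQ.trans (by gcongr)
    _ ≤ ((1 + ε) * (c + S₁) ^ 2 + 2 * κ₃ ^ 2 * β ^ 2 * ε) * (Q₁ * (1 + κ₂ * ε)) := by gcongr
    _ = ((1 + ε) * (1 + κ₂ * ε)) * ((c + S₁) ^ 2 * Q₁) +
        2 * κ₃ ^ 2 * β ^ 2 * ε * Q₁ * (1 + κ₂ * ε) := by ring
    _ ≤ (1 + (1 + 2 * κ₂) * ε) * ((c + S₁) ^ 2 * Q₁) +
        2 * κ₃ ^ 2 * β ^ 2 * ε * Q₁ * (1 + κ₂) := by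
        have h6 : (1 + ε) * (1 + κ₂ * ε) ≤ 1 + (1 + 2 * κ₂) * ε := by
          have : κ₂ * ε * ε ≤ κ₂ * ε * 1 := by gcongr
          linarith
        have h7 : κ₂ * ε ≤ κ₂ := mul_le_of_le_one_right hκ₂ hε1
        gcongr
    _ = _ := by ring

/-- On the complementary event no comparison is attempted. The exponent `X / (2 Λ₁)` is split into
three: `X / (8 Λ₁)` absorbs the polynomial factor, another `X / (8 Λ₁)` gives the small constant,
and `X / (4 Λ₁)` remains to be integrated. -/
lemma bad_step {q M Λ₀ Λ₁ X β c S₂ Q₂ D : ℝ} (h0 : 0 < Λ₀) (h1 : 0 < Λ₁) (hq : 1 ≤ q)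
    (hM : q ^ 4 = M) (hX : q ^ 6 ≤ X) (hβ : 0 ≤ β) (hD : 0 ≤ D) (hQ₂ : 0 ≤ Q₂)
    (hS : |S₂| ≤ β * (Λ₀⁻¹ ^ 2 * X + M * Λ₀⁻¹)) (hQ : Q₂ ≤ D * Real.exp (-X / (2 * Λ₁))) :
    (c + S₂) ^ 2 * Q₂ ≤ (2 + 2 * (Λ₀⁻¹ ^ 2 + Λ₀⁻¹) ^ 2) * (128 * Λ₁ ^ 2) * (c ^ 2 + β ^ 2) *
      (D * Real.exp (-q ^ 6 / (8 * Λ₁))) * Real.exp (-X / (2 * (2 * Λ₁))) := by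
  have hq0 : 0 < q := by linarith
  have hq6 : 1 ≤ q ^ 6 := one_le_pow₀ hq
  have hMX : M ≤ X := hM ▸ (pow_le_pow_right₀ hq (by norm_num)).trans hX
  have hX1 : 1 ≤ X := hq6.trans hX
  set κ := Λ₀⁻¹ ^ 2 + Λ₀⁻¹ with hκ
  have hS' : |S₂| ≤ β * (κ * X) := by
    refine hS.trans (mul_le_mul_of_nonneg_left ?_ hβ)
    calc _ ≤ Λ₀⁻¹ ^ 2 * X + X * Λ₀⁻¹ := by gcongr
      _ = _ := by rw [hκ]; ring
  have hS2 : S₂ ^ 2 ≤ (β * (κ * X)) ^ 2 := by rw [← sq_abs]; gcongr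
  have hX2 : X ^ 2 ≤ 128 * Λ₁ ^ 2 * Real.exp (X / (8 * Λ₁)) := by
    have := Real.quadratic_le_exp_of_nonneg (x := X / (8 * Λ₁)) (by positivity)
    have h2 : (X / (8 * Λ₁)) ^ 2 / 2 ≤ Real.exp (X / (8 * Λ₁)) := by
      have : 0 ≤ X / (8 * Λ₁) := by positivity
      linarith
    calc X ^ 2 = 128 * Λ₁ ^ 2 * ((X / (8 * Λ₁)) ^ 2 / 2) := by field_simp; ring
      _ ≤ _ := by gcongr
  have hpoly : (c + S₂) ^ 2 ≤ (2 + 2 * κ ^ 2) * (c ^ 2 + β ^ 2) * X ^ 2 := by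
    have hXX : 1 ≤ X ^ 2 := one_le_pow₀ hX1
    have e1 : (c + S₂) ^ 2 ≤ 2 * c ^ 2 + 2 * S₂ ^ 2 := by nlinarith [sq_nonneg (c - S₂)]
    have e2 : c ^ 2 ≤ c ^ 2 * X ^ 2 := le_mul_of_one_le_right (sq_nonneg _) hXX
    have e3 : 0 ≤ β ^ 2 * X ^ 2 := by positivity
    have e4 : 0 ≤ κ ^ 2 * c ^ 2 * X ^ 2 := by positivity
    nlinarith
  calc (c + S₂) ^ 2 * Q₂
      ≤ ((2 + 2 * κ ^ 2) * (c ^ 2 + β ^ 2) * (128 * Λ₁ ^ 2 * Real.exp (X / (8 * Λ₁)))) *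
        (D * Real.exp (-X / (2 * Λ₁))) := by
        gcongr
        exact hpoly.trans (by gcongr)
    _ = (2 + 2 * κ ^ 2) * (128 * Λ₁ ^ 2) * (c ^ 2 + β ^ 2) * D *
        Real.exp (-X / (8 * Λ₁) + -X / (2 * (2 * Λ₁))) := by
        rw [show -X / (8 * Λ₁) + -X / (2 * (2 * Λ₁)) = X / (8 * Λ₁) + -X / (2 * Λ₁) by
          field_simp; ring, Real.exp_add]
        ring
    _ ≤ (2 + 2 * κ ^ 2) * (128 * Λ₁ ^ 2) * (c ^ 2 + β ^ 2) * D *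
        Real.exp (-q ^ 6 / (8 * Λ₁) + -X / (2 * (2 * Λ₁))) := by
        gcongr
    _ = _ := by rw [Real.exp_add]; ring

/-- One-step comparison of the integrands with consecutive matrices of an adapted family. -/
lemma exists_step_pointwise (h0 : 0 < Λ₀) (h01 : Λ₀ ≤ Λ₁) (Γ L : ℝ) :
    ∃ C : ℝ, 0 ≤ C ∧ ∀ G, AdaptedFamily Λ₀ Λ₁ Γ L G → ∀ (N n : ℕ) (b : ℕ → ℝ) (β c : ℝ),
      0 ≤ β → (∀ i ∈ range N, |b i| ≤ β) → ∀ (m : ℕ) (z : ℕ → ℝ),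
      (c + bandForm N n b (G (m + 1) z) (m + 1) z) ^ 2 * density (G (m + 1) z) (m + 1) z ≤
        (1 + C * rate m) *
          ((c + bandForm N n b (G m z) (m + 1) z) ^ 2 * density (G m z) (m + 1) z) +
        C * β ^ 2 * rate m * density (G m z) (m + 1) z +
        C * (c ^ 2 + β ^ 2) * tail Λ₀ Λ₁ m *
          Real.exp (-sqSum (m + 1) z / (2 * (2 * Λ₁))) := by
  have h1 : 0 < Λ₁ := h0.trans_le h01
  rcases lt_or_ge L 0 with hL | hL
  · exact ⟨0, le_rfl, fun G hG => absurd hG.nonneg (by linarith)⟩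
  set κ₂ := (L * Λ₀⁻¹ + L * Λ₀⁻¹ ^ 2) * Real.exp (L * Λ₀⁻¹ + L * Λ₀⁻¹ ^ 2)
  have hκ₂ : 0 ≤ κ₂ := by positivity
  set C₁ := 1 + 2 * κ₂
  set C₂ := 2 * (4 * L * Λ₀⁻¹ ^ 3 + 2 * L * Λ₀⁻¹ ^ 2) ^ 2 * (1 + κ₂)
  set C₃ := (2 + 2 * (Λ₀⁻¹ ^ 2 + Λ₀⁻¹) ^ 2) * (128 * Λ₁ ^ 2)
  have hC₁ : 0 ≤ C₁ := by positivity
  have hC₂ : 0 ≤ C₂ := by positivity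
  have hC₃ : 0 ≤ C₃ := by positivity
  refine ⟨C₁ + C₂ + C₃, by positivity, fun G hG N n b β c hβ hb m z => ?_⟩
  obtain ⟨q, hq, hq4, hr, h92, h32⟩ := exists_quarter m
  have hq4' : ((m + 1 : ℕ) : ℝ) = q ^ 4 := by rw [hq4]; push_cast; ring
  have hQ₁ := (density_pos h0 (hG.adm m z) (m + 1) z).le
  have hQ₂ := (density_pos h0 (hG.adm (m + 1) z) (m + 1) z).le
  have hr0 := (rate_pos m).le
  have ht0 := tail_nonneg Λ₀ Λ₁ m
  have hδ : 0 ≤ L * (q ^ 18)⁻¹ * (1 + |z m|) := by positivity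
  have hstep : ∀ i < m + 1, ∀ j < m + 1, |G m z i j - G (m + 1) z i j| ≤
      L * (q ^ 18)⁻¹ * (1 + |z m|) := fun i _ j _ => by
    have := hG.step m z i j
    rwa [h92] at this
  have t1 : 0 ≤ (c + bandForm N n b (G m z) (m + 1) z) ^ 2 * density (G m z) (m + 1) z := by
    positivity
  have t2 : 0 ≤ β ^ 2 * rate m * density (G m z) (m + 1) z := by positivity
  have t3 : 0 ≤ (c ^ 2 + β ^ 2) * tail Λ₀ Λ₁ m * Real.exp (-sqSum (m + 1) z / (2 * (2 * Λ₁))) := by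
    positivity
  have t4 : 0 ≤ rate m * ((c + bandForm N n b (G m z) (m + 1) z) ^ 2 *
      density (G m z) (m + 1) z) := by positivity
  -- The threshold `(m + 1)^{3/2}` is low enough for the perturbation bounds and high enough for the
  -- Gaussian tail to defeat `C^m`.
  rcases le_total (sqSum (m + 1) z) (q ^ 6) with hX | hX
  · have hS := abs_bandForm_sub_le h0 (hG.adm m z) (hG.adm (m + 1) z) N n (m + 1) b z hb hβ hδ hstep
    have hQ := density_le_density_mul h0 (hG.adm m z) (hG.adm (m + 1) z) (m + 1) hδ hstep z
    rw [hq4'] at hS hQ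
    have hy : |z m| ^ 2 ≤ sqSum (m + 1) z := by
      rw [sq_abs]; exact sq_le_sqSum (Nat.lt_succ_self m) z
    have := good_step (c := c) h0 hL hq (sqSum_nonneg _ _) hX (abs_nonneg (z m)) hy hr hβ hQ₁ rfl
      hS hQ
    have hC₂' := mul_nonneg hC₂ t3
    have hC₁' := mul_nonneg hC₁ t3
    have hC₃' := mul_nonneg hC₃ t3
    have hC₁'' := mul_nonneg hC₁ t2
    have hC₃'' := mul_nonneg hC₃ t2
    have hC₂₄ := mul_nonneg hC₂ t4
    have hC₃₄ := mul_nonneg hC₃ t4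
    refine this.trans ?_
    linarith
  · have hS := abs_bandForm_le h0 (hG.adm (m + 1) z) N n (m + 1) b z hb hβ
    have hQ := density_le h0 (hG.adm (m + 1) z) (m + 1) z
    rw [hq4'] at hS
    have := bad_step (c := c) h0 h1 hq rfl hX hβ (by positivity) hQ₂ hS hQ
    rw [← h32] at this
    have e : (√(2 * Real.pi * Λ₀))⁻¹ ^ (m + 1) *
      Real.exp (-((m : ℝ) + 1) ^ (3 / 2 : ℝ) / (8 * Λ₁)) = tail Λ₀ Λ₁ m := rfl
    rw [e] at this
    have hC₂' := mul_nonneg hC₂ t3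
    have hC₁' := mul_nonneg hC₁ t3
    have hC₁'' := mul_nonneg hC₁ t2
    have hC₂'' := mul_nonneg hC₂ t2
    have hC₃'' := mul_nonneg hC₃ t2
    have hC₁₄ := mul_nonneg hC₁ t4
    have hC₂₄ := mul_nonneg hC₂ t4
    have hC₃₄ := mul_nonneg hC₃ t4
    refine this.trans ?_
    linarith

end TriGauss

end

/-! ### Uniform second moment bounds -/

noncomputable section

namespace TriGauss

open Finset

variable {Λ₀ Λ₁ Γ L : ℝ}

/-- Telescoping comparison. It serves both for the decay weights and, with `s` of order `√t`, for
the damping factors. -/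
lemma sum_inv_sq_le {s : ℝ} (hs : 0 < s) (M : ℕ) :
    ∑ l ∈ range M, ((1 + s * ((l : ℝ) + 1)) ^ 2)⁻¹ ≤ 1 / s := by
  have key : ∑ l ∈ range M, ((1 + s * ((l : ℝ) + 1)) ^ 2)⁻¹ ≤ 1 / s * (1 - (1 + s * M)⁻¹) := by
    induction M with
    | zero => simp
    | succ M ih =>
      rw [sum_range_succ]
      have hM : (0 : ℝ) ≤ M := M.cast_nonneg
      have h1 : 0 < 1 + s * (M : ℝ) := by positivity
      have h2 : 0 < 1 + s * ((M : ℝ) + 1) := by positivity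
      have h3 : ((1 + s * ((M : ℝ) + 1)) ^ 2)⁻¹ ≤
          1 / s * ((1 + s * (M : ℝ))⁻¹ - (1 + s * ((M : ℝ) + 1))⁻¹) := by
        have e : 1 / s * ((1 + s * (M : ℝ))⁻¹ - (1 + s * ((M : ℝ) + 1))⁻¹) =
            ((1 + s * (M : ℝ)) * (1 + s * ((M : ℝ) + 1)))⁻¹ := by
          field_simp; ring
        rw [e, sq]
        apply inv_anti₀ (by positivity)
        gcongr
        linarith
      push_cast
      linarith
  refine key.trans ?_
  have : 0 ≤ (1 + s * (M : ℝ))⁻¹ := by positivity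
  have : 0 < 1 / s := by positivity
  nlinarith

/-- Polynomial weight measuring the decay of the residual coefficients. -/
def decayWt (δ : ℝ) (m i : ℕ) : ℝ := if i ≤ m then (1 + δ * ((m : ℝ) - i))⁻¹ else 0

/-- The sum runs over the number `m` of integrated coordinates with the index `i` fixed: a given
coordinate is affected only boundedly often, in the square-summable sense, by the arrival of later
ones. -/
lemma sum_decayWt_sq_le {δ : ℝ} (hδ : 0 < δ) (M i : ℕ) :
    ∑ m ∈ range M, decayWt δ m i ^ 2 ≤ 1 + 1 / δ := by
  calc ∑ m ∈ range M, decayWt δ m i ^ 2 ≤ ∑ m ∈ range (i + (M + 1)), decayWt δ m i ^ 2 :=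
        sum_le_sum_of_subset_of_nonneg (range_mono (by omega)) fun _ _ _ => sq_nonneg _
    _ = ∑ l ∈ range (M + 1), ((1 + δ * (l : ℝ)) ^ 2)⁻¹ := by
        rw [sum_range_add, sum_eq_zero, zero_add]
        · refine sum_congr rfl fun l _ => ?_
          rw [decayWt, if_pos (by omega), inv_pow]; push_cast; congr 3; ring
        · intro m hm
          rw [decayWt, if_neg (by have := mem_range.1 hm; omega)]; simp
    _ ≤ 1 + 1 / δ := by
        rw [sum_range_succ']
        have := sum_inv_sq_le hδ M
        push_cast
        simp only [mul_zero, add_zero, one_pow, inv_one]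
        linarith

lemma sum_shift_le {f : ℕ → ℝ} (hf : ∀ i, 0 ≤ f i) {m : ℕ} (h : ∀ i, m ≤ i → f i = 0) (N n : ℕ) :
    ∑ i ∈ range N, f (i + n) ≤ ∑ i ∈ range m, f i := by
  calc ∑ i ∈ range N, f (i + n) ≤ ∑ i ∈ range (n + N), f i := by
        rw [sum_range_add]
        have : 0 ≤ ∑ i ∈ range n, f i := sum_nonneg fun i _ => hf i
        simp only [Nat.add_comm n]
        linarith
    _ ≤ ∑ i ∈ range (max m (n + N)), f i :=
        sum_le_sum_of_subset_of_nonneg (range_mono (le_max_right _ _)) fun _ _ _ => hf _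
    _ = ∑ i ∈ range m, f i := (sum_subset (range_mono (le_max_left _ _)) fun i _ hi =>
        h i (by simpa using hi)).symm

/-- Cauchy–Schwarz after inserting the weight `1 + δ (m - i)` and its inverse, so that
`weighted_residual_le` bounds one of the two factors. -/
lemma sq_sum_residual_le {G : ℕ → ℕ → ℝ} (h0 : 0 < Λ₀) (hG : Admissible Λ₀ Λ₁ Γ G) (m : ℕ) {δ : ℝ}
    (hδ : 0 ≤ δ) (hδΓ : δ * Γ ≤ Λ₀ / 2) (N n : ℕ) (x : ℕ → ℝ) :
    (∑ i ∈ range N, residual G m (i + n) * x i) ^ 2 ≤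
      2 * Λ₁ / Λ₀ * ∑ i ∈ range N, decayWt δ m (i + n) ^ 2 * x i ^ 2 := by
  set g := residual G m
  set φ : ℕ → ℝ := fun i => 1 + δ * ((m : ℝ) - i) with hφ
  have e : ∀ j y, g j * y = (φ j * g j) * (decayWt δ m j * y) := fun j y => by
    unfold decayWt
    split_ifs with h
    · have : (j : ℝ) ≤ m := by exact_mod_cast h
      have h1 : 0 < φ j := by simp only [hφ]; nlinarith
      rw [show 1 + δ * ((m : ℝ) - j) = φ j from rfl]
      field_simp
    · rw [show g j = 0 from residual_of_gt G (by omega)]; simp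
  calc _ = (∑ i ∈ range N, (φ (i + n) * g (i + n)) * (decayWt δ m (i + n) * x i)) ^ 2 := by
        congr 1; exact sum_congr rfl fun i _ => e _ _
    _ ≤ (∑ i ∈ range N, (φ (i + n) * g (i + n)) ^ 2) *
        ∑ i ∈ range N, (decayWt δ m (i + n) * x i) ^ 2 := sum_mul_sq_le_sq_mul_sq _ _ _
    _ ≤ 2 * Λ₁ / Λ₀ * ∑ i ∈ range N, (decayWt δ m (i + n) * x i) ^ 2 := by
        gcongr
        refine (sum_shift_le (f := fun j => (φ j * g j) ^ 2) (fun _ => sq_nonneg _) (m := m + 1)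
          (fun i hi => ?_) N n).trans ?_
        · rw [show g i = 0 from residual_of_gt G hi]; simp
        · refine le_trans (le_of_eq ?_) (weighted_residual_le h0 hG m hδ hδΓ)
          exact sum_congr rfl fun i _ => mul_pow _ _ _
    _ = _ := by simp only [mul_pow]

lemma residual_sq_le {G : ℕ → ℕ → ℝ} (h0 : 0 < Λ₀) (hG : Admissible Λ₀ Λ₁ Γ G) (m i : ℕ) :
    residual G m i ^ 2 ≤ Λ₁ / Λ₀ := by
  have h1 : 0 < Λ₁ := h0.trans_le ((le_pivot h0 hG 0).trans (pivot_le h0 hG 0))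
  rcases lt_or_ge m i with h | h
  · rw [residual_of_gt G h, zero_pow two_ne_zero]; positivity
  · have e1 := sq_le_sqSum (Nat.lt_succ_of_le h) (residual G m)
    have e2 := sqSum_residual_le h0 hG m
    have e3 := pivot_le h0 hG m
    rw [le_div_iff₀ h0]
    nlinarith

/-- Each coefficient enters only as `b i ^ 2`, localised by the weights; summation over `m` can then
give `∑ b_i²`. The term quadratic in the residual loses one factor to the pointwise bound
`residual_sq_le`. -/
lemma bandIncr_le {G : ℕ → ℕ → ℝ} (h0 : 0 < Λ₀) (hG : Admissible Λ₀ Λ₁ Γ G) (m : ℕ) {δ : ℝ}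
    (hδ : 0 ≤ δ) (hδΓ : δ * Γ ≤ Λ₀ / 2) (N n : ℕ) (b z : ℕ → ℝ) :
    bandIncr N n b G m z ≤ (4 * Λ₁ / Λ₀ ^ 2 + 4 * Λ₁ ^ 2 / Λ₀ ^ 4) *
      ∑ i ∈ range N, b i ^ 2 * (decayWt δ m i ^ 2 * (1 + solve G m z (i + n) ^ 2) +
        decayWt δ m (i + n) ^ 2 * (1 + solve G m z i ^ 2)) := by
  have h1 : 0 < Λ₁ := h0.trans_le ((le_pivot h0 hG 0).trans (pivot_le h0 hG 0))
  set g := residual G m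
  set v := solve G m z
  set ψ := decayWt δ m
  have a1 : bandBilin N n b g v ^ 2 ≤ 2 * Λ₁ / Λ₀ *
      ∑ i ∈ range N, b i ^ 2 * (ψ i ^ 2 * v (i + n) ^ 2) := by
    have := sq_sum_residual_le h0 hG m hδ hδΓ N 0 (fun i => b i * v (i + n))
    refine le_trans (le_of_eq ?_) (this.trans (le_of_eq ?_))
    · unfold bandBilin; congr 1; exact sum_congr rfl fun i _ => by simp only [add_zero]; ring
    · congr 1; exact sum_congr rfl fun i _ => by simp only [add_zero]; ring
  have a2 : bandBilin N n b v g ^ 2 ≤ 2 * Λ₁ / Λ₀ *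
      ∑ i ∈ range N, b i ^ 2 * (ψ (i + n) ^ 2 * v i ^ 2) := by
    have := sq_sum_residual_le h0 hG m hδ hδΓ N n (fun i => b i * v i)
    refine le_trans (le_of_eq ?_) (this.trans (le_of_eq ?_))
    · unfold bandBilin; congr 1; exact sum_congr rfl fun i _ => by ring
    · congr 1; exact sum_congr rfl fun i _ => by ring
  have a3 : bandBilin N n b g g ^ 2 ≤ 2 * Λ₁ / Λ₀ * (Λ₁ / Λ₀) *
      ∑ i ∈ range N, b i ^ 2 * ψ i ^ 2 := by
    have := sq_sum_residual_le h0 hG m hδ hδΓ N 0 (fun i => b i * g (i + n))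
    calc _ = (∑ i ∈ range N, g (i + 0) * (b i * g (i + n))) ^ 2 := by
          unfold bandBilin; congr 1; exact sum_congr rfl fun i _ => by simp only [add_zero]; ring
      _ ≤ _ := this
      _ ≤ 2 * Λ₁ / Λ₀ * ∑ i ∈ range N, Λ₁ / Λ₀ * (b i ^ 2 * ψ i ^ 2) := by
          refine mul_le_mul_of_nonneg_left (sum_le_sum fun i _ => ?_) (by positivity)
          simp only [add_zero]
          calc _ = ψ i ^ 2 * b i ^ 2 * g (i + n) ^ 2 := by rw [mul_pow]; ring
            _ ≤ ψ i ^ 2 * b i ^ 2 * (Λ₁ / Λ₀) := by gcongr; exact residual_sq_le h0 hG m _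
            _ = _ := by ring
      _ = _ := by rw [← mul_sum, mul_assoc]
  have hp := le_pivot h0 hG m
  set T1 := bandBilin N n b g v
  set T2 := bandBilin N n b v g
  set T3 := bandBilin N n b g g
  set X1 := ∑ i ∈ range N, b i ^ 2 * (ψ i ^ 2 * v (i + n) ^ 2)
  set X2 := ∑ i ∈ range N, b i ^ 2 * (ψ (i + n) ^ 2 * v i ^ 2)
  set X3 := ∑ i ∈ range N, b i ^ 2 * ψ i ^ 2
  have hX1 : 0 ≤ X1 := sum_nonneg fun i _ => by positivity
  have hX2 : 0 ≤ X2 := sum_nonneg fun i _ => by positivity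
  have hX3 : 0 ≤ X3 := sum_nonneg fun i _ => by positivity
  have e : bandIncr N n b G m z ≤ 2 * (T1 ^ 2 + T2 ^ 2) / Λ₀ + 2 * T3 ^ 2 / Λ₀ ^ 2 := by
    unfold bandIncr
    gcongr
    nlinarith [sq_nonneg (T1 - T2)]
  have hsum : X1 + X2 + X3 ≤ ∑ i ∈ range N, b i ^ 2 * (ψ i ^ 2 * (1 + v (i + n) ^ 2) +
        ψ (i + n) ^ 2 * (1 + v i ^ 2)) := by
    simp only [X1, X2, X3, ← sum_add_distrib]
    refine sum_le_sum fun i _ => ?_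
    have : 0 ≤ b i ^ 2 * ψ (i + n) ^ 2 := by positivity
    linarith
  calc bandIncr N n b G m z
      ≤ 2 * (2 * Λ₁ / Λ₀ * X1 + 2 * Λ₁ / Λ₀ * X2) / Λ₀ +
        2 * (2 * Λ₁ / Λ₀ * (Λ₁ / Λ₀) * X3) / Λ₀ ^ 2 := e.trans (by gcongr)
    _ = 4 * Λ₁ / Λ₀ ^ 2 * (X1 + X2) + 4 * Λ₁ ^ 2 / Λ₀ ^ 4 * X3 := by field_simp; ring
    _ ≤ (4 * Λ₁ / Λ₀ ^ 2 + 4 * Λ₁ ^ 2 / Λ₀ ^ 4) * (X1 + X2 + X3) := by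
        have : 0 ≤ 4 * Λ₁ / Λ₀ ^ 2 * X3 := by positivity
        have : 0 ≤ 4 * Λ₁ ^ 2 / Λ₀ ^ 4 * (X1 + X2) := by positivity
        linarith
    _ ≤ _ := by gcongr

/-- The second moment of `c + bandForm` under the adapted Gaussian-like density. -/
def energy (G : ℕ → (ℕ → ℝ) → ℕ → ℕ → ℝ) (N n : ℕ) (b : ℕ → ℝ) (c : ℝ) (m : ℕ) : ENNReal :=
  iterInt m fun z => ENNReal.ofReal
    ((c + bandForm N n b (G m z) m z) ^ 2 * density (G m z) m z)

/-- The total mass of the adapted Gaussian-like density. -/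
def mass (G : ℕ → (ℕ → ℝ) → ℕ → ℕ → ℝ) (m : ℕ) : ENNReal :=
  iterInt m fun z => ENNReal.ofReal (density (G m z) m z)

lemma energy_zero (G : ℕ → (ℕ → ℝ) → ℕ → ℕ → ℝ) (N n : ℕ) (b : ℕ → ℝ) (c : ℝ) :
    energy G N n b c 0 = ENNReal.ofReal (c ^ 2) := by
  simp [energy, iterInt_zero, bandForm, density, invQuad, solve, blockInv]

lemma bandIncr_nonneg {G : ℕ → ℕ → ℝ} (h0 : 0 < Λ₀) (hG : Admissible Λ₀ Λ₁ Γ G) (N n : ℕ)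
    (b : ℕ → ℝ) (m : ℕ) (z : ℕ → ℝ) : 0 ≤ bandIncr N n b G m z := by
  have := pivot_pos h0 hG m
  unfold bandIncr; positivity

/-- Exact, because `G m` ignores coordinate `m`: while that coordinate is integrated the covariance
is constant and the Gaussian computation applies. -/
lemma iterInt_bandForm_succ {G : ℕ → (ℕ → ℝ) → ℕ → ℕ → ℝ} (h0 : 0 < Λ₀)
    (hG : AdaptedFamily Λ₀ Λ₁ Γ L G) (N n : ℕ) (b : ℕ → ℝ) (c : ℝ) (m : ℕ) :
    iterInt (m + 1) (fun z => ENNReal.ofReal ((c + bandForm N n b (G m z) (m + 1) z) ^ 2 *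
      density (G m z) (m + 1) z)) = energy G N n b c m +
      iterInt m fun z => ENNReal.ofReal (bandIncr N n b (G m z) m z * density (G m z) m z) := by
  have mS := fun k => measurable_bandForm (hG.meas m) N n b k
  have mQ := fun k => measurable_density (hG.meas m) k
  rw [iterInt_succ m (by have := mS (m + 1); have := mQ (m + 1); fun_prop), energy,
    ← iterInt_add m (by have := mS m; have := mQ m; fun_prop)]
  refine iterInt_congr m fun z => ?_
  simp only [hG.indep]
  have hq := (density_pos h0 (hG.adm m z) m z).le
  have hi := bandIncr_nonneg h0 (hG.adm m z) N n b m z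
  rw [lintegral_bandForm_succ h0 (hG.adm m z), ← ENNReal.ofReal_add (by positivity) (by positivity)]
  congr 1; ring

lemma iterInt_density_succ {G : ℕ → (ℕ → ℝ) → ℕ → ℕ → ℝ} (h0 : 0 < Λ₀)
    (hG : AdaptedFamily Λ₀ Λ₁ Γ L G) (m : ℕ) :
    iterInt (m + 1) (fun z => ENNReal.ofReal (density (G m z) (m + 1) z)) = mass G m := by
  -- An empty band with `c = 1` turns the energy into the mass.
  have := iterInt_bandForm_succ h0 hG 0 0 0 1 m
  simp only [bandForm, range_zero, sum_empty, add_zero, one_pow, one_mul, energy, bandIncr,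
    bandBilin] at this
  rw [this, mass]
  have : iterInt m (fun z => ENNReal.ofReal
      ((0 ^ 2 / pivot (G m z) m + 2 * 0 ^ 2 / pivot (G m z) m ^ 2) * density (G m z) m z)) = 0 := by
    simp [iterInt, lmarginal]
  rw [this, add_zero]

/-- One step of the recursion for the energy. -/
lemma exists_energy_succ_le (h0 : 0 < Λ₀) (h01 : Λ₀ ≤ Λ₁) (Γ L : ℝ) :
    ∃ C : ℝ, 0 ≤ C ∧ ∀ G, AdaptedFamily Λ₀ Λ₁ Γ L G → ∀ (N n : ℕ) (b : ℕ → ℝ) (β c : ℝ),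
      0 ≤ β → (∀ i ∈ range N, |b i| ≤ β) → ∀ m : ℕ,
      energy G N n b c (m + 1) ≤ ENNReal.ofReal (1 + C * rate m) * (energy G N n b c m +
        iterInt m fun z => ENNReal.ofReal (bandIncr N n b (G m z) m z * density (G m z) m z)) +
        ENNReal.ofReal (C * β ^ 2 * rate m) * mass G m +
        ENNReal.ofReal (C * (c ^ 2 + β ^ 2) * rate m) := by
  obtain ⟨C, hC, h⟩ := exists_step_pointwise h0 h01 Γ L
  obtain ⟨C', hC', h'⟩ := exists_tail_le h0 h01
  have h1 : 0 < Λ₁ := h0.trans_le h01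
  refine ⟨C + C * C', by positivity, fun G hG N n b β c hβ hb m => ?_⟩
  have hr := (rate_pos m).le
  have ht := tail_nonneg Λ₀ Λ₁ m
  have mS := measurable_bandForm (hG.meas m) N n b (m + 1)
  have mQ := measurable_density (hG.meas m) (m + 1)
  have mX := measurable_sqSum (m + 1)
  set f₁ : (ℕ → ℝ) → ENNReal := fun z => ENNReal.ofReal
    ((c + bandForm N n b (G m z) (m + 1) z) ^ 2 * density (G m z) (m + 1) z) with hf₁
  set f₂ : (ℕ → ℝ) → ENNReal := fun z => ENNReal.ofReal (density (G m z) (m + 1) z) with hf₂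
  set f₃ : (ℕ → ℝ) → ENNReal := fun z => ENNReal.ofReal
    (Real.exp (-sqSum (m + 1) z / (2 * (2 * Λ₁)))) with hf₃
  have m₁ : Measurable f₁ := by fun_prop
  have m₂ : Measurable f₂ := by fun_prop
  have m₃ : Measurable f₃ := by fun_prop
  have hpt : ∀ z, ENNReal.ofReal ((c + bandForm N n b (G (m + 1) z) (m + 1) z) ^ 2 *
      density (G (m + 1) z) (m + 1) z) ≤
      (ENNReal.ofReal (1 + C * rate m) * f₁ z + ENNReal.ofReal (C * β ^ 2 * rate m) * f₂ z) +
        ENNReal.ofReal (C * (c ^ 2 + β ^ 2) * tail Λ₀ Λ₁ m) * f₃ z := fun z => by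
    have hq := (density_pos h0 (hG.adm m z) (m + 1) z).le
    simp only [hf₁, hf₂, hf₃]
    rw [← ENNReal.ofReal_mul (by positivity), ← ENNReal.ofReal_mul (by positivity),
      ← ENNReal.ofReal_mul (by positivity), ← ENNReal.ofReal_add (by positivity) (by positivity),
      ← ENNReal.ofReal_add (by positivity) (by positivity)]
    exact ENNReal.ofReal_le_ofReal (h G hG N n b β c hβ hb m z)
  have hle := iterInt_mono (m + 1) hpt
  rw [iterInt_add _ (by fun_prop), iterInt_add _ (by fun_prop), iterInt_const_mul _ m₁,
    iterInt_const_mul _ m₂, iterInt_const_mul _ m₃, iterInt_bandForm_succ h0 hG,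
    iterInt_density_succ h0 hG, iterInt_gauss (by positivity), ← ENNReal.ofReal_mul (by positivity)]
    at hle
  refine hle.trans ?_
  gcongr ?_ * _ + ?_ * _ + ?_
  · apply ENNReal.ofReal_le_ofReal
    have : 0 ≤ C * C' * rate m := by positivity
    linarith
  · apply ENNReal.ofReal_le_ofReal
    have : 0 ≤ C * C' * β ^ 2 * rate m := by positivity
    linarith
  · apply ENNReal.ofReal_le_ofReal
    calc _ = C * (c ^ 2 + β ^ 2) * (tail Λ₀ Λ₁ m * √(2 * Real.pi * (2 * Λ₁)) ^ (m + 1)) := by ring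
      _ ≤ C * (c ^ 2 + β ^ 2) * (C' * rate m) :=
        mul_le_mul_of_nonneg_left (h' m) (by positivity)
      _ ≤ _ := by
        have : 0 ≤ C * (c ^ 2 + β ^ 2) * rate m := by positivity
        linarith

lemma rate_le_one (m : ℕ) : rate m ≤ 1 := by
  obtain ⟨q, hq, -, hr, -⟩ := exists_quarter m
  rw [hr]; exact inv_le_one_of_one_le₀ (one_le_pow₀ hq)

lemma sum_rate_le (m : ℕ) : ∑ k ∈ range m, rate k ≤ ∑' k, rate k :=
  summable_rate.sum_le_tsum _ fun k _ => (rate_pos k).le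

lemma exists_decay (h0 : 0 < Λ₀) (Γ : ℝ) : ∃ δ : ℝ, 0 < δ ∧ δ * Γ ≤ Λ₀ / 2 := by
  refine ⟨Λ₀ / (2 * (|Γ| + 1)), by positivity, ?_⟩
  have h1 : Γ ≤ |Γ| + 1 := (le_abs_self Γ).trans (by linarith)
  calc Λ₀ / (2 * (|Γ| + 1)) * Γ ≤ Λ₀ / (2 * (|Γ| + 1)) * (|Γ| + 1) := by gcongr
    _ = Λ₀ / 2 := by field_simp

/-- Uniform bound for the mass and for the second moments of `solve`. -/
theorem exists_moment_bound (h0 : 0 < Λ₀) (h01 : Λ₀ ≤ Λ₁) (Γ L : ℝ) :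
    ∃ V : ℝ, 0 ≤ V ∧ ∀ G, AdaptedFamily Λ₀ Λ₁ Γ L G → ∀ m j : ℕ,
      iterInt m (fun z => ENNReal.ofReal ((1 + solve (G m z) m z j ^ 2) * density (G m z) m z)) ≤
        ENNReal.ofReal V := by
  obtain ⟨C, hC, h⟩ := exists_energy_succ_le h0 h01 Γ L
  obtain ⟨δ, hδ, hδΓ⟩ := exists_decay h0 Γ
  have h1 : 0 < Λ₁ := h0.trans_le h01
  set κ := 4 * Λ₁ / Λ₀ ^ 2 + 4 * Λ₁ ^ 2 / Λ₀ ^ 4 with hκ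
  have hκ0 : 0 ≤ κ := by positivity
  -- With the band reduced to the single entry `(j, j)`, this shift compensates the subtracted `A_jj
  -- ≤ Λ₀⁻¹`, so `c + S ≥ 1 + v_j² ≥ 1`. The energy then dominates the mass and the moment of `v_j`
  -- at once.
  set c := Λ₀⁻¹ + 1 with hc
  set R := ∑' k, rate k
  have hR : 0 ≤ R := tsum_nonneg fun k => (rate_pos k).le
  set A := 2 * C * R + 2 * κ * (1 + C) * (1 + 1 / δ)
  set B := C * (c ^ 2 + 1 ^ 2) * R
  refine ⟨Real.exp A * (c ^ 2 + B), by positivity, fun G hG m j => ?_⟩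
  set b : ℕ → ℝ := fun i => if i = j then 1 else 0 with hb
  have hbF : ∀ k z, bandForm (j + 1) 0 b (G k z) k z =
      solve (G k z) k z j ^ 2 - blockInv (G k z) k j j := fun k z => by
    simp [bandForm, hb, sq]
  have hsq : ∀ k z, 1 + solve (G k z) k z j ^ 2 ≤ (c + bandForm (j + 1) 0 b (G k z) k z) ^ 2 := by
    intro k z
    rw [hbF]
    have := (le_abs_self _).trans (abs_blockInv_le h0 (hG.adm k z) k j j)
    have h2 : 1 + solve (G k z) k z j ^ 2 ≤
        c + (solve (G k z) k z j ^ 2 - blockInv (G k z) k j j) := by rw [hc]; linarith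
    nlinarith [sq_nonneg (solve (G k z) k z j)]
  have hb1 : ∀ i ∈ range (j + 1), |b i| ≤ 1 := fun i _ => by simp only [hb]; split_ifs <;> simp
  set F := energy G (j + 1) 0 b c with hF
  have hD : ∀ k, mass G k ≤ F k := fun k => by
    refine iterInt_mono k fun z => ENNReal.ofReal_le_ofReal ?_
    have := (density_pos h0 (hG.adm k z) k z).le
    have h3 : 1 ≤ (c + bandForm (j + 1) 0 b (G k z) k z) ^ 2 := by
      nlinarith [hsq k z, sq_nonneg (solve (G k z) k z j)]
    exact le_mul_of_one_le_left this h3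
  -- The increment is bounded by the energy itself times a weight summable in `k`, so the Grönwall
  -- recursion closes without prior moment bounds.
  have hE : ∀ k, iterInt k (fun z => ENNReal.ofReal
      (bandIncr (j + 1) 0 b (G k z) k z * density (G k z) k z)) ≤
      ENNReal.ofReal (2 * κ * decayWt δ k j ^ 2) * F k := fun k => by
    have mS := measurable_bandForm (hG.meas k) (j + 1) 0 b k
    have mQ := measurable_density (hG.meas k) k
    rw [hF, energy, ← iterInt_const_mul k (by fun_prop)]
    refine iterInt_mono k fun z => ?_
    rw [← ENNReal.ofReal_mul (by positivity), ← mul_assoc]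
    apply ENNReal.ofReal_le_ofReal
    have := (density_pos h0 (hG.adm k z) k z).le
    gcongr
    have h4 := bandIncr_le h0 (hG.adm k z) k hδ.le hδΓ (j + 1) 0 b z
    simp only [add_zero] at h4
    rw [sum_eq_single j (fun i _ hi => by simp [hb, hi]) (fun hj => by simp at hj)] at h4
    simp only [hb, if_true, one_pow, one_mul, ← two_mul] at h4
    calc _ ≤ _ := h4
      _ = 2 * κ * decayWt δ k j ^ 2 * (1 + solve (G k z) k z j ^ 2) := by rw [hκ]; ring
      _ ≤ _ := by gcongr; exact hsq k z
  have hrec : ∀ k, F (k + 1) ≤ ENNReal.ofReal (1 + (2 * C * rate k +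
      2 * κ * (1 + C) * decayWt δ k j ^ 2)) * F k +
      ENNReal.ofReal (C * (c ^ 2 + 1 ^ 2) * rate k) := fun k => by
    have hr := (rate_pos k).le
    refine (h G hG (j + 1) 0 b 1 c zero_le_one hb1 k).trans ?_
    gcongr
    calc _ ≤ ENNReal.ofReal (1 + C * rate k) * (F k +
          ENNReal.ofReal (2 * κ * decayWt δ k j ^ 2) * F k) +
          ENNReal.ofReal (C * 1 ^ 2 * rate k) * F k := by
          gcongr
          · exact hE k
          · exact hD k
      _ = (ENNReal.ofReal (1 + C * rate k) * (ENNReal.ofReal 1 +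
          ENNReal.ofReal (2 * κ * decayWt δ k j ^ 2)) +
          ENNReal.ofReal (C * 1 ^ 2 * rate k)) * F k := by rw [ENNReal.ofReal_one]; ring
      _ ≤ _ := by
          rw [← ENNReal.ofReal_add (by positivity) (by positivity),
            ← ENNReal.ofReal_mul (by positivity),
            ← ENNReal.ofReal_add (by positivity) (by positivity)]
          refine mul_le_mul_left (ENNReal.ofReal_le_ofReal ?_) _
          have : C * rate k * (2 * κ * decayWt δ k j ^ 2) ≤
              C * 1 * (2 * κ * decayWt δ k j ^ 2) := by gcongr; exact rate_le_one k
          linarith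
  have hg := gronwall (F := F) (a := fun k => 2 * C * rate k +
      2 * κ * (1 + C) * decayWt δ k j ^ 2) (B := fun k => C * (c ^ 2 + 1 ^ 2) * rate k)
    (fun k => by have := (rate_pos k).le; positivity)
    (fun k => by have := (rate_pos k).le; positivity) hrec m
  have hfin : iterInt m (fun z => ENNReal.ofReal
      ((1 + solve (G m z) m z j ^ 2) * density (G m z) m z)) ≤ F m := by
    refine iterInt_mono m fun z => ENNReal.ofReal_le_ofReal ?_
    have := (density_pos h0 (hG.adm m z) m z).le
    gcongr
    exact hsq m z
  refine hfin.trans (hg.trans ?_)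
  rw [hF, energy_zero, ← ENNReal.ofReal_add (by positivity)
    (sum_nonneg fun k _ => by have := (rate_pos k).le; positivity),
    ← ENNReal.ofReal_mul (Real.exp_pos _).le]
  apply ENNReal.ofReal_le_ofReal
  rw [← mul_sum, sum_add_distrib, ← mul_sum, ← mul_sum]
  have s1 := sum_rate_le m
  have s2 := sum_decayWt_sq_le hδ m j
  have s3 : 0 ≤ ∑ k ∈ range m, rate k := sum_nonneg fun k _ => (rate_pos k).le
  have hA : 2 * C * ∑ k ∈ range m, rate k + 2 * κ * (1 + C) * ∑ k ∈ range m, decayWt δ k j ^ 2 ≤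
      A := add_le_add (by gcongr) (by gcongr)
  have hB : C * (c ^ 2 + 1 ^ 2) * ∑ k ∈ range m, rate k ≤ B :=
    mul_le_mul_of_nonneg_left s1 (by positivity)
  gcongr

/-- Uniform second moment bound for banded functionals. -/
theorem exists_band_bound (h0 : 0 < Λ₀) (h01 : Λ₀ ≤ Λ₁) (Γ L : ℝ) :
    ∃ C : ℝ, 0 ≤ C ∧ ∀ G, AdaptedFamily Λ₀ Λ₁ Γ L G → ∀ (N n : ℕ) (b : ℕ → ℝ) (m : ℕ),
      iterInt m (fun z => ENNReal.ofReal (bandForm N n b (G m z) m z ^ 2 * density (G m z) m z)) ≤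
        ENNReal.ofReal (C * ∑ i ∈ range N, b i ^ 2) := by
  obtain ⟨C, hC, h⟩ := exists_energy_succ_le h0 h01 Γ L
  obtain ⟨V, hV, hmom⟩ := exists_moment_bound h0 h01 Γ L
  obtain ⟨δ, hδ, hδΓ⟩ := exists_decay h0 Γ
  have h1 : 0 < Λ₁ := h0.trans_le h01
  set κ := 4 * Λ₁ / Λ₀ ^ 2 + 4 * Λ₁ ^ 2 / Λ₀ ^ 4 with hκ
  have hκ0 : 0 ≤ κ := by positivity
  set R := ∑' k, rate k
  have hR : 0 ≤ R := tsum_nonneg fun k => (rate_pos k).le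
  refine ⟨Real.exp (C * R) * ((1 + C) * κ * V * (2 * (1 + 1 / δ)) + C * (V + 1) * R),
    by positivity, fun G hG N n b m => ?_⟩
  set S := ∑ i ∈ range N, b i ^ 2 with hS
  have hS0 : 0 ≤ S := sum_nonneg fun i _ => sq_nonneg _
  -- Bounding the sup norm of `b` by its `ℓ²` norm makes the perturbation errors, of order `β²`,
  -- proportional to `∑ b_i²` as well.
  have hb1 : ∀ i ∈ range N, |b i| ≤ √S := fun i hi =>
    Real.abs_le_sqrt (single_le_sum (f := fun i => b i ^ 2) (fun _ _ => sq_nonneg _) hi)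
  have hSS : √S ^ 2 = S := Real.sq_sqrt hS0
  -- With `c = 0` the energy starts from zero, so the final bound consists only of accumulated
  -- increments.
  set F := energy G N n b 0 with hF
  have hD : ∀ k, mass G k ≤ ENNReal.ofReal V := fun k => by
    refine le_trans (iterInt_mono k fun z => ENNReal.ofReal_le_ofReal ?_) (hmom G hG k 0)
    have := (density_pos h0 (hG.adm k z) k z).le
    exact le_mul_of_one_le_left this (by nlinarith [sq_nonneg (solve (G k z) k z 0)])
  set w : ℕ → ℝ := fun k => ∑ i ∈ range N, b i ^ 2 * (decayWt δ k i ^ 2 + decayWt δ k (i + n) ^ 2)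
    with hw
  have hw0 : ∀ k, 0 ≤ w k := fun k => sum_nonneg fun i _ => by positivity
  have hE : ∀ k, iterInt k (fun z => ENNReal.ofReal
      (bandIncr N n b (G k z) k z * density (G k z) k z)) ≤
      ENNReal.ofReal (κ * V * w k) := fun k => by
    have mQ := measurable_density (hG.meas k) k
    have mv := measurable_solve (hG.meas k) k
    set f : ℕ → (ℕ → ℝ) → ENNReal := fun j z => ENNReal.ofReal
      ((1 + solve (G k z) k z j ^ 2) * density (G k z) k z) with hf
    have mf : ∀ j, Measurable (f j) := fun j => by have := mv j; fun_prop
    have hpt : ∀ z, ENNReal.ofReal (bandIncr N n b (G k z) k z * density (G k z) k z) ≤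
        ∑ i ∈ range N, (ENNReal.ofReal (κ * (b i ^ 2 * decayWt δ k i ^ 2)) * f (i + n) z +
          ENNReal.ofReal (κ * (b i ^ 2 * decayWt δ k (i + n) ^ 2)) * f i z) := fun z => by
      have hq := (density_pos h0 (hG.adm k z) k z).le
      simp only [hf]
      have e : ∀ i ∈ range N, (ENNReal.ofReal (κ * (b i ^ 2 * decayWt δ k i ^ 2)) *
          ENNReal.ofReal ((1 + solve (G k z) k z (i + n) ^ 2) * density (G k z) k z) +
          ENNReal.ofReal (κ * (b i ^ 2 * decayWt δ k (i + n) ^ 2)) *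
          ENNReal.ofReal ((1 + solve (G k z) k z i ^ 2) * density (G k z) k z)) =
          ENNReal.ofReal (κ * (b i ^ 2 * (decayWt δ k i ^ 2 * (1 + solve (G k z) k z (i + n) ^ 2) +
            decayWt δ k (i + n) ^ 2 * (1 + solve (G k z) k z i ^ 2))) * density (G k z) k z) := by
        intro i _
        rw [← ENNReal.ofReal_mul (by positivity), ← ENNReal.ofReal_mul (by positivity),
          ← ENNReal.ofReal_add (by positivity) (by positivity)]
        congr 1; ring
      rw [sum_congr rfl e, ← ENNReal.ofReal_sum_of_nonneg fun i _ => by positivity]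
      apply ENNReal.ofReal_le_ofReal
      rw [← sum_mul, ← mul_sum]
      gcongr
      exact bandIncr_le h0 (hG.adm k z) k hδ.le hδΓ N n b z
    refine (iterInt_mono k hpt).trans ?_
    rw [iterInt_sum k _ fun i => by have := mf i; have := mf (i + n); fun_prop]
    calc _ ≤ ∑ i ∈ range N, ENNReal.ofReal (κ * V * (b i ^ 2 *
          (decayWt δ k i ^ 2 + decayWt δ k (i + n) ^ 2))) := by
          refine sum_le_sum fun i _ => ?_
          rw [iterInt_add k (by have := mf (i + n); fun_prop), iterInt_const_mul k (mf _),
            iterInt_const_mul k (mf _)]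
          calc _ ≤ ENNReal.ofReal (κ * (b i ^ 2 * decayWt δ k i ^ 2)) * ENNReal.ofReal V +
              ENNReal.ofReal (κ * (b i ^ 2 * decayWt δ k (i + n) ^ 2)) * ENNReal.ofReal V := by
                gcongr
                · exact hmom G hG k (i + n)
                · exact hmom G hG k i
            _ = _ := by
                rw [← ENNReal.ofReal_mul (by positivity), ← ENNReal.ofReal_mul (by positivity),
                  ← ENNReal.ofReal_add (by positivity) (by positivity)]
                congr 1; ring
      _ = _ := by
          rw [← ENNReal.ofReal_sum_of_nonneg fun i _ => by positivity, ← mul_sum]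
  have hrec : ∀ k, F (k + 1) ≤ ENNReal.ofReal (1 + C * rate k) * F k +
      ENNReal.ofReal ((1 + C) * (κ * V) * w k + C * (V + 1) * S * rate k) := fun k => by
    have hr := (rate_pos k).le
    have hwk := hw0 k
    refine (h G hG N n b (√S) 0 (Real.sqrt_nonneg _) hb1 k).trans ?_
    rw [hSS]
    calc _ ≤ ENNReal.ofReal (1 + C * rate k) * (F k + ENNReal.ofReal (κ * V * w k)) +
          ENNReal.ofReal (C * S * rate k) * ENNReal.ofReal V +
          ENNReal.ofReal (C * (0 ^ 2 + S) * rate k) := by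
          gcongr
          · exact hE k
          · exact hD k
      _ = ENNReal.ofReal (1 + C * rate k) * F k +
          (ENNReal.ofReal ((1 + C * rate k) * (κ * V * w k)) +
          ENNReal.ofReal (C * S * rate k * V) + ENNReal.ofReal (C * (0 ^ 2 + S) * rate k)) := by
          rw [ENNReal.ofReal_mul (p := 1 + C * rate k) (by positivity),
            ENNReal.ofReal_mul (p := C * S * rate k) (by positivity)]
          ring
      _ ≤ _ := by
          rw [← ENNReal.ofReal_add (by positivity) (by positivity),
            ← ENNReal.ofReal_add (by positivity) (by positivity)]
          refine add_le_add_right (ENNReal.ofReal_le_ofReal ?_) _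
          have : C * rate k * (κ * V * w k) ≤ C * 1 * (κ * V * w k) := by
            gcongr; exact rate_le_one k
          linarith
  have hg := gronwall (F := F) (a := fun k => C * rate k)
    (B := fun k => (1 + C) * (κ * V) * w k + C * (V + 1) * S * rate k)
    (fun k => by have := (rate_pos k).le; positivity)
    (fun k => by have := (rate_pos k).le; have := hw0 k; positivity) hrec m
  have hFm : iterInt m (fun z => ENNReal.ofReal
      (bandForm N n b (G m z) m z ^ 2 * density (G m z) m z)) = F m := by
    simp [hF, energy]
  rw [hFm]
  refine hg.trans ?_
  rw [hF, energy_zero, zero_pow two_ne_zero, ENNReal.ofReal_zero, zero_add,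
    ← ENNReal.ofReal_mul (Real.exp_pos _).le]
  apply ENNReal.ofReal_le_ofReal
  -- Exchanging the sums lets the decay weights be summed over `k` for each fixed `i`, which removes
  -- the dependence on the dimension.
  have hsw : ∑ k ∈ range m, w k ≤ 2 * (1 + 1 / δ) * S := by
    simp only [hw]
    rw [sum_comm, hS, mul_sum]
    refine sum_le_sum fun i _ => ?_
    rw [← mul_sum, sum_add_distrib, mul_comm]
    gcongr
    linarith [sum_decayWt_sq_le hδ m i, sum_decayWt_sq_le hδ m (i + n)]
  have s1 := sum_rate_le m
  rw [sum_add_distrib, ← mul_sum, ← mul_sum, ← mul_sum]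
  calc _ ≤ Real.exp (C * R) * ((1 + C) * (κ * V) * (2 * (1 + 1 / δ) * S) +
        C * (V + 1) * S * R) := by
        have s3 : 0 ≤ ∑ k ∈ range m, rate k := sum_nonneg fun k _ => (rate_pos k).le
        have s4 : 0 ≤ ∑ k ∈ range m, w k := sum_nonneg fun k _ => hw0 k
        gcongr
    _ = _ := by ring

end TriGauss

end

/-! ### Coordinates of `ℓ²` and off-diagonal sums -/

noncomputable section

namespace OUKernel

open Finset

/-! ### Coordinates of `ℓ²` -/

lemma single_eq_smul (k : ℕ) (r : ℝ) : (lp.single 2 k r : EllTwo) = r • unitVec k := by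
  have := lp.single_smul (E := fun _ : ℕ => ℝ) (p := 2) (𝕜 := ℝ) k r 1
  rw [unitVec, ← this, smul_eq_mul, mul_one]

lemma unitVec_apply (k i : ℕ) : (unitVec k : EllTwo) i = if i = k then 1 else 0 := by
  simp only [unitVec]
  split_ifs with h
  · subst h; simp
  · exact lp.single_apply_ne 2 k _ h

lemma inner_unitVec (i j : ℕ) : inner ℝ (unitVec i) (unitVec j) = if i = j then (1 : ℝ) else 0 := by
  rw [unitVec, lp.inner_single_left, unitVec_apply]
  split_ifs <;> simp

lemma embed_eq_sum (K : ℕ) (y : Fin K → ℝ) : embed K y = ∑ i : Fin K, y i • unitVec (i : ℕ) := by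
  simp only [embed, single_eq_smul]

lemma coe_sum_apply {ι : Type*} (s : Finset ι) (f : ι → EllTwo) (i : ℕ) :
    (∑ j ∈ s, f j : EllTwo) i = ∑ j ∈ s, (f j) i := by
  classical
  induction s using Finset.induction with
  | empty => simp
  | insert a s ha ih => rw [sum_insert ha, sum_insert ha, ← ih]; rfl

lemma embed_apply (K : ℕ) (y : Fin K → ℝ) (i : Fin K) : embed K y (i : ℕ) = y i := by
  rw [embed_eq_sum, coe_sum_apply]
  have : ∀ j : Fin K, (y j • unitVec (j : ℕ) : EllTwo) (i : ℕ) = if j = i then y j else 0 := by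
    intro j
    have e : (y j • unitVec (j : ℕ) : EllTwo) (i : ℕ) = y j * (unitVec (j : ℕ) : EllTwo) i := rfl
    rw [e, unitVec_apply]
    by_cases h : j = i
    · simp [h]
    · have h' : ¬ (i : ℕ) = j := fun h' => h (Fin.ext h'.symm)
      simp [h, h']
  simp only [this]
  simp

lemma proj_embed (K : ℕ) (y : Fin K → ℝ) : proj K (embed K y) = embed K y := by
  unfold proj
  congr 1
  ext i
  exact embed_apply K y i

lemma abs_apply_le_supNorm (x : EllTwo) (k : ℕ) : |x k| ≤ supNorm x := by
  refine le_ciSup (f := fun n => |x n|) ⟨‖x‖, ?_⟩ k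
  rintro _ ⟨n, rfl⟩
  have := lp.norm_apply_le_norm (p := 2) (by norm_num) x n
  simpa using this

lemma supNorm_nonneg (x : EllTwo) : 0 ≤ supNorm x :=
  (abs_nonneg _).trans (abs_apply_le_supNorm x 0)

variable {a : EllTwo → EllTwo →L[ℝ] EllTwo}

lemma entry_symm (ha : ∀ x, IsSelfAdjoint (a x)) (x : EllTwo) (i j : ℕ) :
    entry a x i j = entry a x j i := by
  unfold entry
  have h : ContinuousLinearMap.adjoint (a x) = a x := ha x
  rw [← ContinuousLinearMap.adjoint_inner_left, h, real_inner_comm]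

lemma inner_sum_unitVec (x : EllTwo) (w : ℕ → ℝ) (M : ℕ) :
    inner ℝ (a x (∑ i ∈ range M, w i • unitVec i)) (∑ i ∈ range M, w i • unitVec i) =
      ∑ i ∈ range M, ∑ j ∈ range M, entry a x i j * w i * w j := by
  simp only [map_sum, map_smul, sum_inner, inner_sum, real_inner_smul_left, real_inner_smul_right]
  refine sum_congr rfl fun i _ => sum_congr rfl fun j _ => ?_
  rw [entry, real_inner_comm]; ring

lemma norm_sq_sum_unitVec (w : ℕ → ℝ) (M : ℕ) :
    ‖∑ i ∈ range M, w i • unitVec i‖ ^ 2 = ∑ i ∈ range M, w i ^ 2 := by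
  rw [← real_inner_self_eq_norm_sq]
  simp only [sum_inner, inner_sum, real_inner_smul_left, real_inner_smul_right, inner_unitVec]
  refine sum_congr rfl fun i hi => ?_
  rw [sum_eq_single i (fun j _ hj => by simp [hj]) (fun h => absurd hi h)]
  simp [sq]

/-- Coordinatewise Hölder continuity summed over finitely many coordinates. -/
lemma abs_entry_add_sum_sub_le {α β κ : ℝ} (hH : CoordHolder α β κ a) {ι : Type*}
    (s : Finset ι) (k : ι → ℕ) (h : ι → ℝ) (x : EllTwo) (i j : ℕ) :
    |entry a (x + ∑ l ∈ s, h l • unitVec (k l)) i j - entry a x i j| ≤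
      ∑ l ∈ s, κ * |h l| ^ α * ((k l : ℝ) + 1) ^ (-β) := by
  classical
  induction s using Finset.induction with
  | empty => simp
  | insert b s hb ih =>
    rw [sum_insert hb, sum_insert hb]
    have := hH (x + ∑ l ∈ s, h l • unitVec (k l)) (h b) i j (k b)
    rw [add_assoc, add_comm (∑ l ∈ s, h l • unitVec (k l))] at this
    calc _ ≤ _ := abs_sub_le _ (entry a (x + ∑ l ∈ s, h l • unitVec (k l)) i j) _
      _ ≤ _ := add_le_add this ih

lemma abs_entry_embed_sub_le {α β κ : ℝ} (hH : CoordHolder α β κ a) (K : ℕ) (y y' : Fin K → ℝ)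
    (i j : ℕ) : |entry a (embed K y') i j - entry a (embed K y) i j| ≤
      ∑ l : Fin K, κ * |y' l - y l| ^ α * ((l : ℝ) + 1) ^ (-β) := by
  have := abs_entry_add_sum_sub_le hH univ (fun l : Fin K => (l : ℕ)) (fun l => y' l - y l)
    (embed K y) i j
  have e : embed K y + ∑ l : Fin K, (y' l - y l) • unitVec (l : ℕ) = embed K y' := by
    simp only [embed_eq_sum, sub_smul, sum_sub_distrib]; abel
  rwa [e] at this

/-- No measurability of `a` is assumed; on `ℝ^K` the coordinatewise Hölder bounds add up to
continuity of the entries. -/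
lemma measurable_entry_embed {α β κ : ℝ} (hα : 0 < α) (hH : CoordHolder α β κ a) (K : ℕ)
    (i j : ℕ) : Measurable fun y : Fin K → ℝ => entry a (embed K y) i j := by
  refine Continuous.measurable (continuous_iff_continuousAt.2 fun y => ?_)
  have h0 : Filter.Tendsto (fun y' : Fin K → ℝ =>
      ∑ l : Fin K, κ * |y' l - y l| ^ α * ((l : ℝ) + 1) ^ (-β)) (nhds y) (nhds 0) := by
    have hc : Continuous fun y' : Fin K → ℝ =>
        ∑ l : Fin K, κ * |y' l - y l| ^ α * ((l : ℝ) + 1) ^ (-β) := by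
      refine continuous_finsetSum _ fun l _ => ?_
      refine Continuous.mul (Continuous.mul continuous_const ?_) continuous_const
      exact Continuous.rpow_const (by fun_prop) fun _ => Or.inr hα.le
    have := hc.tendsto y
    simpa [Real.zero_rpow hα.ne'] using this
  rw [ContinuousAt, tendsto_iff_dist_tendsto_zero]
  exact squeeze_zero (fun _ => dist_nonneg) (fun y' => abs_entry_embed_sub_le hH K y y' i j) h0

/-! ### Sums over off-diagonals -/

/-- The distance of two indices. -/
def idxDist (i j : ℕ) : ℕ := (i - j) + (j - i)

lemma cast_idxDist (i j : ℕ) : ((idxDist i j : ℕ) : ℝ) = |(i : ℝ) - j| := by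
  unfold idxDist
  rcases le_total i j with h | h
  · have : (i : ℝ) ≤ j := by exact_mod_cast h
    rw [Nat.sub_eq_zero_of_le h, zero_add, Nat.cast_sub h, abs_sub_comm, abs_of_nonneg (by linarith)]
  · have : (j : ℝ) ≤ i := by exact_mod_cast h
    rw [Nat.sub_eq_zero_of_le h, add_zero, Nat.cast_sub h, abs_of_nonneg (by linarith)]

lemma sum_idxDist_le {f : ℕ → ℝ} (hf : ∀ n, 0 ≤ f n) (hs : Summable f) (i m : ℕ) :
    ∑ j ∈ range m, f (idxDist i j) ≤ 2 * ∑' n, f n := by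
  calc ∑ j ∈ range m, f (idxDist i j) ≤ ∑ j ∈ range (i + m), f (idxDist i j) :=
        sum_le_sum_of_subset_of_nonneg (range_mono (by omega)) fun _ _ _ => hf _
    _ = ∑ j ∈ range i, f (j + 1) + ∑ l ∈ range m, f l := by
        rw [sum_range_add]
        congr 1
        · rw [← sum_range_reflect (fun k => f (k + 1)) i]
          refine sum_congr rfl fun j hj => ?_
          have := mem_range.1 hj
          congr 1; unfold idxDist; omega
        · refine sum_congr rfl fun l _ => ?_
          congr 1; unfold idxDist; omega
    _ ≤ ∑' n, f n + ∑' n, f n := by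
        gcongr
        · calc ∑ j ∈ range i, f (j + 1) ≤ ∑ j ∈ range (i + 1), f j := by
                rw [sum_range_succ']; linarith [hf 0]
            _ ≤ _ := hs.sum_le_tsum _ fun n _ => hf n
        · exact hs.sum_le_tsum _ fun n _ => hf n
    _ = _ := by ring

lemma summable_inv_one_add_rpow {γ s : ℝ} (hs : 0 < s) (h : 1 < γ * s) :
    Summable fun n : ℕ => (1 / (1 + (n : ℝ) ^ γ)) ^ s := by
  rw [← summable_nat_add_iff 1]
  have h1 := (summable_nat_add_iff 1).2 (Real.summable_nat_rpow (p := -(γ * s)).2 (by linarith))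
  refine Summable.of_nonneg_of_le (fun n => by positivity) (fun n => ?_) h1
  have hn : (0 : ℝ) < ((n + 1 : ℕ) : ℝ) := by positivity
  rw [Real.rpow_neg hn.le, Real.rpow_mul hn.le, ← Real.inv_rpow (by positivity), one_div]
  apply Real.rpow_le_rpow (by positivity) _ hs.le
  apply inv_anti₀ (by positivity)
  linarith

lemma summable_mul_inv_one_add_rpow {γ : ℝ} (hγ : 2 < γ) :
    Summable fun n : ℕ => (n : ℝ) * (1 / (1 + (n : ℝ) ^ γ)) := by
  rw [← summable_nat_add_iff 1]
  have h1 := (summable_nat_add_iff 1).2 (Real.summable_nat_rpow (p := -(γ - 1)).2 (by linarith))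
  refine Summable.of_nonneg_of_le (fun n => by positivity) (fun n => ?_) h1
  have hn : (0 : ℝ) < ((n + 1 : ℕ) : ℝ) := by positivity
  rw [neg_sub, Real.rpow_sub hn, Real.rpow_one, mul_one_div]
  apply div_le_div_of_nonneg_left hn.le (by positivity)
  linarith

end OUKernel

end

/-! ### Rescaled covariance and its membership in an adapted family -/

noncomputable section

namespace OUKernel

open Finset TriGauss

/-- `∫₀ᵗ exp (-(λ_i + λ_j) s) ds`. -/
def intExp (lam : ℕ → ℝ) (t : ℝ) (i j : ℕ) : ℝ :=
  ∫ s in (0 : ℝ)..t, Real.exp (-(lam i + lam j) * s)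

/-- The natural scale of the `i`-th coordinate at time `t`. -/
def scale (lam : ℕ → ℝ) (t : ℝ) (i : ℕ) : ℝ := √(intExp lam t i i)

/-- The correlation factor. -/
def corr (lam : ℕ → ℝ) (t : ℝ) (i j : ℕ) : ℝ := intExp lam t i j / (scale lam t i * scale lam t j)

/-- The point with rescaled coordinates `z` (cut off at `m`) centred at `exp (-λ t) x`. -/
def point (lam : ℕ → ℝ) (K : ℕ) (x : EllTwo) (t : ℝ) (m : ℕ) (z : ℕ → ℝ) : EllTwo :=
  embed K fun i => Real.exp (-lam i * t) * x i + if (i : ℕ) < m then scale lam t i * z i else 0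

/-- The rescaled covariance at the point with rescaled coordinates `z`. -/
def gram (lam : ℕ → ℝ) (a : EllTwo → EllTwo →L[ℝ] EllTwo) (K : ℕ) (x : EllTwo) (t : ℝ) (m : ℕ)
    (z : ℕ → ℝ) (i j : ℕ) : ℝ := entry a (point lam K x t m z) i j * corr lam t i j

variable {lam : ℕ → ℝ} {a : EllTwo → EllTwo →L[ℝ] EllTwo} {t κ : ℝ}

lemma QuadraticGrowth.pos (hκ : 0 < κ) (h : QuadraticGrowth κ lam) (i : ℕ) : 0 < lam i :=
  lt_of_lt_of_le (by positivity) (h i).1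

lemma intExp_symm (i j : ℕ) : intExp lam t i j = intExp lam t j i := by
  unfold intExp; rw [add_comm]

lemma intExp_pos (ht : 0 < t) (i j : ℕ) : 0 < intExp lam t i j :=
  intervalIntegral.intervalIntegral_pos_of_pos
    (Continuous.intervalIntegrable (by fun_prop) _ _) (fun _ => Real.exp_pos _) ht

lemma scale_pos (ht : 0 < t) (i : ℕ) : 0 < scale lam t i := Real.sqrt_pos.2 (intExp_pos ht i i)

lemma scale_sq (ht : 0 < t) (i : ℕ) : scale lam t i ^ 2 = intExp lam t i i :=
  Real.sq_sqrt (intExp_pos ht i i).le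

lemma intExp_self {i : ℕ} (hl : lam i ≠ 0) :
    intExp lam t i i = (1 - Real.exp (-(2 * (lam i * t)))) / (2 * lam i) := by
  unfold intExp
  have hne : -(lam i + lam i) ≠ 0 := by
    intro h; apply hl; linarith
  rw [intervalIntegral.integral_comp_mul_left (fun s => Real.exp s) hne, integral_exp, smul_eq_mul,
    mul_zero, Real.exp_zero, show -(lam i + lam i) * t = -(2 * (lam i * t)) by ring]
  field_simp
  ring

lemma scale_sq_le (ht : 0 < t) {i : ℕ} (hl : 0 < lam i) : scale lam t i ^ 2 ≤ t := by
  rw [scale_sq ht, intExp_self hl.ne', div_le_iff₀ (by positivity)]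
  have := Real.add_one_le_exp (-(2 * (lam i * t)))
  linarith

lemma scale_sq_le' (ht : 0 < t) {i : ℕ} (hl : 0 < lam i) :
    scale lam t i ^ 2 ≤ 1 / (2 * lam i) := by
  rw [scale_sq ht, intExp_self hl.ne']
  gcongr
  linarith [Real.exp_pos (-(2 * (lam i * t)))]

/-- The left side equals `λ e^{-λt} / sinh (λt)`, and `sinh s ≥ s`. Keeping the exponential is what
later makes the sum over `i` converge. -/
lemma exp_div_scale_sq_le (ht : 0 < t) {i : ℕ} (hl : 0 < lam i) :
    (Real.exp (-lam i * t) / scale lam t i) ^ 2 ≤ t⁻¹ * Real.exp (-(lam i * t)) := by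
  have hX : 0 < lam i * t := by positivity
  have hs := Real.self_le_sinh_iff.2 hX.le
  rw [Real.sinh_eq] at hs
  have hE := Real.exp_pos (-(lam i * t))
  have e1 : Real.exp (lam i * t) * Real.exp (-(lam i * t)) = 1 := by rw [← Real.exp_add]; simp
  have e2 : Real.exp (-(2 * (lam i * t))) = Real.exp (-(lam i * t)) ^ 2 := by
    rw [← Real.exp_nat_mul]; push_cast; congr 1; ring
  have h1 : Real.exp (-(2 * (lam i * t))) < 1 := by
    rw [← Real.exp_zero]; exact Real.exp_lt_exp.2 (by linarith)
  rw [div_pow, scale_sq ht, intExp_self hl.ne', neg_mul, div_div_eq_mul_div,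
    div_le_iff₀ (by linarith), e2]
  set E := Real.exp (-(lam i * t))
  have h2 : 2 * (lam i * t) * E ≤ 1 - E ^ 2 := by
    have := mul_le_mul_of_nonneg_right hs hE.le
    nlinarith
  calc E ^ 2 * (2 * lam i) = t⁻¹ * E * (2 * (lam i * t) * E) := by field_simp
    _ ≤ _ := by gcongr

lemma corr_symm (i j : ℕ) : corr lam t i j = corr lam t j i := by
  unfold corr; rw [intExp_symm, mul_comm]

lemma corr_nonneg (ht : 0 < t) (i j : ℕ) : 0 ≤ corr lam t i j :=
  div_nonneg (intExp_pos ht i j).le (mul_nonneg (Real.sqrt_nonneg _) (Real.sqrt_nonneg _))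

lemma corr_self (ht : 0 < t) (i : ℕ) : corr lam t i i = 1 := by
  unfold corr
  rw [← sq, scale_sq ht, div_self (intExp_pos ht i i).ne']

/-- The rescaled quadratic form as a time integral. -/
lemma sum_corr_eq_integral (E : ℕ → ℕ → ℝ) (w : ℕ → ℝ) (M : ℕ) :
    ∑ i ∈ range M, ∑ j ∈ range M, E i j * corr lam t i j * w i * w j =
      ∫ s in (0 : ℝ)..t, ∑ i ∈ range M, ∑ j ∈ range M,
        E i j * (w i / scale lam t i * Real.exp (-lam i * s)) *
          (w j / scale lam t j * Real.exp (-lam j * s)) := by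
  rw [intervalIntegral.integral_finsetSum fun i _ =>
    Continuous.intervalIntegrable (by fun_prop) _ _]
  refine sum_congr rfl fun i _ => ?_
  rw [intervalIntegral.integral_finsetSum fun j _ =>
    Continuous.intervalIntegrable (by fun_prop) _ _]
  refine sum_congr rfl fun j _ => ?_
  have e : ∀ s, E i j * (w i / scale lam t i * Real.exp (-lam i * s)) *
      (w j / scale lam t j * Real.exp (-lam j * s)) =
      E i j * (w i / scale lam t i) * (w j / scale lam t j) *
        Real.exp (-(lam i + lam j) * s) := fun s => by
    rw [show -(lam i + lam j) * s = -lam i * s + -lam j * s by ring, Real.exp_add]; ring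
  simp only [e]
  rw [intervalIntegral.integral_const_mul, corr, intExp]
  ring

lemma sum_sq_eq_integral (ht : 0 < t) (w : ℕ → ℝ) (M : ℕ) :
    sqSum M w = ∫ s in (0 : ℝ)..t, ∑ i ∈ range M,
      (w i / scale lam t i * Real.exp (-lam i * s)) ^ 2 := by
  have := sum_corr_eq_integral (lam := lam) (t := t) (fun i j => if i = j then 1 else 0) w M
  simp only [ite_mul, one_mul, zero_mul] at this
  have h1 : ∑ i ∈ range M, ∑ j ∈ range M, (if i = j then corr lam t i j * w i * w j else 0) =
      sqSum M w := by
    refine sum_congr rfl fun i hi => ?_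
    rw [sum_ite_eq, if_pos hi, corr_self ht]; ring
  rw [h1] at this
  rw [this]
  congr 1
  ext s
  refine sum_congr rfl fun i hi => ?_
  rw [sum_ite_eq, if_pos hi]; ring

lemma CoordHolder.nonneg {α β κ : ℝ} (h : CoordHolder α β κ a) : 0 ≤ κ := by
  have := (abs_nonneg _).trans (h 0 1 0 0 0)
  simpa using this

lemma OffDiagonalDecay.nonneg {γ κ : ℝ} (hγ : 0 < γ) (h : OffDiagonalDecay γ κ a) : 0 ≤ κ := by
  have := (abs_nonneg _).trans (h 0 0 0)
  simpa [Real.zero_rpow hγ.ne'] using this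

/-- The correlation is the `L²(0, t)` inner product of two normalised exponentials; apply `2 f g ≤
f² + g²` under the integral. -/
lemma corr_le_one (ht : 0 < t) (i j : ℕ) : corr lam t i j ≤ 1 := by
  have h := sum_corr_eq_integral (lam := lam) (t := t)
    (fun k l => if k = i ∧ l = j then 1 else 0) (fun _ => 1) (i + j + 1)
  have hw1 := sum_sq_eq_integral (lam := lam) ht (fun k => if k = i then 1 else 0) (i + j + 1)
  have hw2 := sum_sq_eq_integral (lam := lam) ht (fun k => if k = j then 1 else 0) (i + j + 1)
  rw [sqSum_single (by omega)] at hw1 hw2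
  have s1 : ∑ k ∈ range (i + j + 1), ∑ l ∈ range (i + j + 1),
      (if k = i ∧ l = j then (1 : ℝ) else 0) * corr lam t k l * 1 * 1 = corr lam t i j := by
    rw [sum_eq_single_of_mem i (mem_range.2 (by omega)) fun k _ hk => by simp [hk],
      sum_eq_single_of_mem j (mem_range.2 (by omega)) fun l _ hl => by simp [hl]]
    simp
  rw [s1] at h
  have hsum : ∀ s : ℝ, ∑ k ∈ range (i + j + 1), ∑ l ∈ range (i + j + 1),
      (if k = i ∧ l = j then (1 : ℝ) else 0) * (1 / scale lam t k * Real.exp (-lam k * s)) *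
        (1 / scale lam t l * Real.exp (-lam l * s)) =
      (1 / scale lam t i * Real.exp (-lam i * s)) * (1 / scale lam t j * Real.exp (-lam j * s)) := by
    intro s
    rw [sum_eq_single_of_mem i (mem_range.2 (by omega)) fun k _ hk => by simp [hk],
      sum_eq_single_of_mem j (mem_range.2 (by omega)) fun l _ hl => by simp [hl]]
    simp
  have hone : ∀ (p : ℕ) (s : ℝ), p < i + j + 1 → ∑ k ∈ range (i + j + 1),
      ((if k = p then 1 else 0) / scale lam t k * Real.exp (-lam k * s)) ^ 2 =
      (1 / scale lam t p * Real.exp (-lam p * s)) ^ 2 := by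
    intro p s hp
    rw [sum_eq_single_of_mem p (mem_range.2 hp) fun k _ hk => by simp [hk]]
    simp
  simp only [hsum] at h
  simp only [hone i _ (by omega)] at hw1
  simp only [hone j _ (by omega)] at hw2
  have hadd : ∫ s in (0 : ℝ)..t, ((1 / scale lam t i * Real.exp (-lam i * s)) ^ 2 / 2 +
      (1 / scale lam t j * Real.exp (-lam j * s)) ^ 2 / 2) = 1 := by
    rw [intervalIntegral.integral_add (Continuous.intervalIntegrable (by fun_prop) _ _)
      (Continuous.intervalIntegrable (by fun_prop) _ _), intervalIntegral.integral_div,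
      intervalIntegral.integral_div, ← hw1, ← hw2]
    norm_num
  rw [h]
  refine le_trans (intervalIntegral.integral_mono_on ht.le
    (Continuous.intervalIntegrable (by fun_prop) _ _)
    (Continuous.intervalIntegrable (by fun_prop) _ _) fun s _ => ?_) hadd.le
  nlinarith [sq_nonneg (1 / scale lam t i * Real.exp (-lam i * s) -
    1 / scale lam t j * Real.exp (-lam j * s))]

/-- Bound of the first off-diagonal moment. -/
def momentBound (γ κ : ℝ) : ℝ :=
  2 * ∑' n : ℕ, κ * ((n : ℝ) * (1 / (1 + (n : ℝ) ^ γ)))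

/-- The rescaled form is the time integral of the form of `a` at the vectors `w_i e^{-λ_i s} / σ_i`,
whose squared norms integrate to `|w|²`. Ellipticity thus passes with the same constants, while `γ >
2` makes the first off-diagonal moment summable. -/
lemma admissible_gram {γ κγ Λ₀ Λ₁ : ℝ} (ht : 0 < t) (hγ : 2 < γ)
    (ha : ∀ x, IsSelfAdjoint (a x)) (hell : UniformlyElliptic Λ₀ Λ₁ a)
    (hoff : OffDiagonalDecay γ κγ a) (K : ℕ) (x : EllTwo) (m : ℕ) (z : ℕ → ℝ) :
    Admissible Λ₀ Λ₁ (momentBound γ κγ) (gram lam a K x t m z) where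
  symm i j := by rw [gram, gram, entry_symm ha, corr_symm]
  lower w M := by
    simp only [gram]
    rw [sum_corr_eq_integral, sum_sq_eq_integral (lam := lam) ht, ← intervalIntegral.integral_const_mul]
    refine intervalIntegral.integral_mono_on ht.le (Continuous.intervalIntegrable (by fun_prop) _ _)
      (Continuous.intervalIntegrable (by fun_prop) _ _) fun s _ => ?_
    have := (hell (point lam K x t m z)
      (∑ i ∈ range M, (w i / scale lam t i * Real.exp (-lam i * s)) • unitVec i)).1
    rwa [inner_sum_unitVec, norm_sq_sum_unitVec] at this
  upper w M := by
    simp only [gram]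
    rw [sum_corr_eq_integral, sum_sq_eq_integral (lam := lam) ht, ← intervalIntegral.integral_const_mul]
    refine intervalIntegral.integral_mono_on ht.le (Continuous.intervalIntegrable (by fun_prop) _ _)
      (Continuous.intervalIntegrable (by fun_prop) _ _) fun s _ => ?_
    have := (hell (point lam K x t m z)
      (∑ i ∈ range M, (w i / scale lam t i * Real.exp (-lam i * s)) • unitVec i)).2
    rwa [inner_sum_unitVec, norm_sq_sum_unitVec] at this
  moment i M := by
    have hκ := hoff.nonneg (by linarith)
    refine le_trans (sum_le_sum fun j _ => ?_) (sum_idxDist_le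
      (f := fun n => κγ * ((n : ℝ) * (1 / (1 + (n : ℝ) ^ γ)))) (fun n => by positivity)
      ((summable_mul_inv_one_add_rpow hγ).mul_left κγ) i M)
    rw [cast_idxDist, gram, abs_mul, abs_of_nonneg (corr_nonneg ht i j)]
    have h1 := hoff (point lam K x t m z) i j
    have h2 := corr_le_one (lam := lam) ht i j
    have h3 := corr_nonneg (lam := lam) ht i j
    calc _ ≤ |(i : ℝ) - j| * (κγ / (1 + |(i : ℝ) - j| ^ γ) * 1) := by gcongr
      _ = _ := by ring

/-- Increment constant of the rescaled covariance. -/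
def incrBound (α κlam κβ : ℝ) : ℝ := κβ * √(1 / (2 * κlam)) ^ α

lemma scale_le {κlam : ℝ} (hκ : 0 < κlam) (hlam : QuadraticGrowth κlam lam) (ht : 0 < t) (i : ℕ) :
    scale lam t i ≤ √(1 / (2 * κlam)) * ((i : ℝ) + 1)⁻¹ := by
  have h1 := scale_sq_le' ht (hlam.pos hκ i)
  have h2 := (hlam i).1
  apply le_of_sq_le_sq _ (by positivity)
  rw [mul_pow, Real.sq_sqrt (by positivity)]
  refine h1.trans ?_
  rw [inv_pow, ← one_div, div_mul_div_comm, one_mul]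
  apply one_div_le_one_div_of_le (by positivity)
  linarith

lemma rpow_le_one_add {α r : ℝ} (hα : 0 ≤ α) (hα' : α ≤ 1) (hr : 0 ≤ r) : r ^ α ≤ 1 + r := by
  rcases le_total r 1 with h | h
  · linarith [Real.rpow_le_one hr h hα]
  · calc r ^ α ≤ r ^ (1 : ℝ) := Real.rpow_le_rpow_of_exponent_le h hα'
      _ ≤ 1 + r := by rw [Real.rpow_one]; linarith

/-- Unfreezing coordinate `m` moves the point by `σ_m z_m` with `σ_m = O(1 / (m + 1))`. The Hölder
bound then gives `(m + 1)^{-α-β}`, and `α + β > 9/2`. The constants do not depend on `t`, `x` or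
`K`. -/
lemma adaptedFamily_gram {α β γ κlam κβ κγ Λ₀ Λ₁ : ℝ} (ht : 0 < t) (hγ : 2 < γ) (hα : 0 < α)
    (hα' : α ≤ 1) (hβ : 9 / 2 - α < β) (hκ : 0 < κlam) (hlam : QuadraticGrowth κlam lam)
    (ha : ∀ x, IsSelfAdjoint (a x)) (hell : UniformlyElliptic Λ₀ Λ₁ a)
    (hoff : OffDiagonalDecay γ κγ a) (hH : CoordHolder α β κβ a) (K : ℕ) (x : EllTwo) :
    AdaptedFamily Λ₀ Λ₁ (momentBound γ κγ) (incrBound α κlam κβ) (gram lam a K x t) where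
  meas m i j := by
    have h := measurable_entry_embed hα hH K i j
    have hm : Measurable fun z : ℕ → ℝ => fun i : Fin K => Real.exp (-lam i * t) * x i +
        if (i : ℕ) < m then scale lam t i * z i else 0 := by
      refine measurable_pi_lambda _ fun i => ?_
      split_ifs <;> fun_prop
    exact (h.comp hm).mul_const _
  indep m z r := by
    have : point lam K x t m (Function.update z m r) = point lam K x t m z := by
      unfold point
      congr 1
      ext i
      split_ifs with h
      · rw [Function.update_of_ne h.ne]
      · rfl
    unfold gram
    rw [this]
  adm m z := admissible_gram ht hγ ha hell hoff K x m z
  step m z i j := by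
    have hκβ := hH.nonneg
    have hσ := scale_pos (lam := lam) ht m
    have hm : (0 : ℝ) < (m : ℝ) + 1 := by positivity
    have hm1 : (1 : ℝ) ≤ (m : ℝ) + 1 := by have : (0 : ℝ) ≤ m := m.cast_nonneg
                                           linarith
    set X := κβ * |scale lam t m * z m| ^ α * ((m : ℝ) + 1) ^ (-β) with hX
    have hX0 : 0 ≤ X := by positivity
    have h1 : |entry a (point lam K x t m z) i j - entry a (point lam K x t (m + 1) z) i j| ≤ X := by
      rw [abs_sub_comm]
      refine (abs_entry_embed_sub_le hH K _ _ i j).trans ?_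
      have hterm : ∀ l : Fin K, κβ * |(Real.exp (-lam l * t) * x l +
          if (l : ℕ) < m + 1 then scale lam t l * z l else 0) - (Real.exp (-lam l * t) * x l +
          if (l : ℕ) < m then scale lam t l * z l else 0)| ^ α * ((l : ℝ) + 1) ^ (-β) =
          if (l : ℕ) = m then X else 0 := fun l => by
        rw [add_sub_add_left_eq_sub]
        rcases lt_trichotomy (l : ℕ) m with h | h | h
        · rw [if_pos (by omega), if_pos h, sub_self, abs_zero, Real.zero_rpow hα.ne',
            if_neg h.ne]; simp
        · rw [if_pos (by omega), if_neg (by omega), if_pos h, sub_zero, h]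
        · rw [if_neg (by omega), if_neg (by omega), sub_self, abs_zero, Real.zero_rpow hα.ne',
            if_neg h.ne']; simp
      rw [sum_congr rfl fun l _ => hterm l]
      by_cases hmK : m < K
      · rw [sum_eq_single_of_mem ⟨m, hmK⟩ (mem_univ _) fun l _ hl => by
          rw [if_neg]; exact fun h => hl (Fin.ext h)]
        simp
      · rw [sum_eq_zero fun l _ => by rw [if_neg (by have := l.2; omega)]]
        exact hX0
    have h2 : X ≤ incrBound α κlam κβ * ((m : ℝ) + 1) ^ (-(9 / 2) : ℝ) * (1 + |z m|) := by
      have e1 : |scale lam t m * z m| ^ α ≤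
          √(1 / (2 * κlam)) ^ α * ((m : ℝ) + 1) ^ (-α) * (1 + |z m|) := by
        rw [abs_mul, abs_of_pos hσ, Real.mul_rpow hσ.le (abs_nonneg _)]
        have f1 : scale lam t m ^ α ≤ (√(1 / (2 * κlam)) * ((m : ℝ) + 1)⁻¹) ^ α :=
          Real.rpow_le_rpow hσ.le (scale_le hκ hlam ht m) hα.le
        rw [Real.mul_rpow (by positivity) (by positivity), Real.inv_rpow hm.le,
          ← Real.rpow_neg hm.le] at f1
        exact mul_le_mul f1 (rpow_le_one_add hα.le hα' (abs_nonneg _)) (by positivity)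
          (by positivity)
      calc X ≤ κβ * (√(1 / (2 * κlam)) ^ α * ((m : ℝ) + 1) ^ (-α) * (1 + |z m|)) *
            ((m : ℝ) + 1) ^ (-β) := by rw [hX]; gcongr
        _ = incrBound α κlam κβ * (((m : ℝ) + 1) ^ (-α) * ((m : ℝ) + 1) ^ (-β)) * (1 + |z m|) := by
            rw [incrBound]; ring
        _ ≤ _ := by
            rw [← Real.rpow_add hm]
            have : ((m : ℝ) + 1) ^ (-α + -β) ≤ ((m : ℝ) + 1) ^ (-(9 / 2) : ℝ) :=
              Real.rpow_le_rpow_of_exponent_le hm1 (by linarith)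
            have : 0 ≤ incrBound α κlam κβ := by unfold incrBound; positivity
            gcongr
    have hc0 := corr_nonneg (lam := lam) ht i j
    have hc1 := corr_le_one (lam := lam) ht i j
    rw [gram, gram, ← sub_mul, abs_mul, abs_of_nonneg hc0]
    calc _ ≤ X * 1 := by gcongr
      _ ≤ _ := by rw [mul_one]; exact h2

end OUKernel

end

/-! ### Second derivatives of the kernel -/

noncomputable section

namespace OUKernel

open Finset TriGauss

variable {lam : ℕ → ℝ} {a : EllTwo → EllTwo →L[ℝ] EllTwo} {t : ℝ} {K : ℕ}

/-! ### Derivatives of the kernel -/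

lemma add_smul_unitVec_apply (x : EllTwo) (h : ℝ) (i k : ℕ) :
    (x + h • unitVec i : EllTwo) k = x k + if k = i then h else 0 := by
  have e : (x + h • unitVec i : EllTwo) k = x k + h * (unitVec i : EllTwo) k := rfl
  rw [e, unitVec_apply]
  split_ifs <;> simp

lemma kernelN_add_of_le {i : ℕ} (hi : K ≤ i) (h : ℝ) (x y : EllTwo) :
    kernelN lam a K t (x + h • unitVec i) y = kernelN lam a K t x y := by
  unfold kernelN
  congr 1
  ext k
  rw [add_smul_unitVec_apply, if_neg (by have := k.2; omega), add_zero]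

/-- The difference `y - exp (-λ t) x` in the first `K` coordinates. -/
def drift (lam : ℕ → ℝ) (K : ℕ) (t : ℝ) (x y : EllTwo) (i : Fin K) : ℝ :=
  y i - Real.exp (-lam i * t) * x i

lemma drift_add (x y : EllTwo) (h : ℝ) (i : Fin K) :
    drift lam K t (x + h • unitVec i) y =
      drift lam K t x y - (h * Real.exp (-lam i * t)) • Pi.single i 1 := by
  ext k
  simp only [drift, add_smul_unitVec_apply, Pi.sub_apply, Pi.smul_apply, Pi.single_apply,
    smul_eq_mul, Fin.val_inj]
  split_ifs with hk
  · subst hk; ring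
  · ring

lemma mulVec_drift_add (P : Matrix (Fin K) (Fin K) ℝ) (x y : EllTwo) (h : ℝ) (i k : Fin K) :
    P.mulVec (drift lam K t (x + h • unitVec i) y) k =
      P.mulVec (drift lam K t x y) k - h * (Real.exp (-lam i * t) * P k i) := by
  rw [drift_add, Matrix.mulVec_sub, Matrix.mulVec_smul, Matrix.mulVec_single_one]
  simp [mul_assoc]

lemma dotProduct_drift_add {P : Matrix (Fin K) (Fin K) ℝ} (hP : P.IsSymm) (x y : EllTwo) (h : ℝ)
    (i : Fin K) :
    drift lam K t (x + h • unitVec i) y ⬝ᵥ P.mulVec (drift lam K t (x + h • unitVec i) y) =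
      drift lam K t x y ⬝ᵥ P.mulVec (drift lam K t x y) -
        2 * h * (Real.exp (-lam i * t) * P.mulVec (drift lam K t x y) i) +
        h ^ 2 * (Real.exp (-lam i * t) ^ 2 * P i i) := by
  have hc : drift lam K t x y ⬝ᵥ P.col i = P.mulVec (drift lam K t x y) i := by
    rw [Matrix.mulVec, dotProduct_comm]
    congr 1
    ext k
    exact hP.apply i k
  rw [drift_add, Matrix.mulVec_sub, Matrix.mulVec_smul, Matrix.mulVec_single_one,
    sub_dotProduct, dotProduct_sub, dotProduct_sub, smul_dotProduct, smul_dotProduct,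
    dotProduct_smul, dotProduct_smul, single_one_dotProduct, single_one_dotProduct, hc]
  simp only [smul_eq_mul, Matrix.col_apply]
  ring

lemma hasDerivAt_kernelN {P : Matrix (Fin K) (Fin K) ℝ} {y : EllTwo}
    (hC : (covMatrix lam a K y t)⁻¹ = P) (hP : P.IsSymm) (x : EllTwo) (i : Fin K) :
    HasDerivAt (fun h : ℝ => kernelN lam a K t (x + h • unitVec i) y)
      (Real.exp (-lam i * t) * P.mulVec (drift lam K t x y) i * kernelN lam a K t x y) 0 := by
  have e : (fun h : ℝ => kernelN lam a K t (x + h • unitVec i) y) = fun h =>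
      (2 * Real.pi) ^ (-(K : ℝ) / 2) * Real.sqrt P.det * Real.exp (-(drift lam K t x y ⬝ᵥ
        P.mulVec (drift lam K t x y) -
        2 * h * (Real.exp (-lam i * t) * P.mulVec (drift lam K t x y) i) +
        h ^ 2 * (Real.exp (-lam i * t) ^ 2 * P i i)) / 2) := by
    ext h
    rw [← dotProduct_drift_add hP, ← hC]
    rfl
  have e0 : kernelN lam a K t x y = (2 * Real.pi) ^ (-(K : ℝ) / 2) * Real.sqrt P.det *
      Real.exp (-(drift lam K t x y ⬝ᵥ P.mulVec (drift lam K t x y)) / 2) := by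
    rw [← hC]; rfl
  rw [e, e0]
  set A := drift lam K t x y ⬝ᵥ P.mulVec (drift lam K t x y)
  set B := Real.exp (-lam i * t) * P.mulVec (drift lam K t x y) i
  set C := Real.exp (-lam i * t) ^ 2 * P i i
  have h1 : HasDerivAt (fun h : ℝ => -(A - 2 * h * B + h ^ 2 * C) / 2) B 0 := by
    have h2 : HasDerivAt (fun h : ℝ => h) 1 0 := hasDerivAt_id 0
    have h3 := (((((h2.const_mul 2).mul_const B).const_sub A).add
      ((h2.pow 2).mul_const C)).neg).div_const 2
    refine h3.congr_deriv ?_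
    simp
  refine (h1.exp.const_mul ((2 * Real.pi) ^ (-(K : ℝ) / 2) * Real.sqrt P.det)).congr_deriv ?_
  simp
  ring

lemma partialD_kernelN {P : Matrix (Fin K) (Fin K) ℝ} {y : EllTwo}
    (hC : (covMatrix lam a K y t)⁻¹ = P) (hP : P.IsSymm) (x : EllTwo) (i : Fin K) :
    partialD i (fun z => kernelN lam a K t z y) x =
      Real.exp (-lam i * t) * P.mulVec (drift lam K t x y) i * kernelN lam a K t x y :=
  (hasDerivAt_kernelN hC hP x i).deriv

lemma partialD_partialD_kernelN {P : Matrix (Fin K) (Fin K) ℝ} {y : EllTwo}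
    (hC : (covMatrix lam a K y t)⁻¹ = P) (hP : P.IsSymm) (x : EllTwo) (i j : Fin K) :
    partialD i (partialD j (fun z => kernelN lam a K t z y)) x =
      Real.exp (-lam i * t) * Real.exp (-lam j * t) * (P.mulVec (drift lam K t x y) i *
        P.mulVec (drift lam K t x y) j - P i j) * kernelN lam a K t x y := by
  have e : partialD j (fun z => kernelN lam a K t z y) = fun z =>
      Real.exp (-lam j * t) * P.mulVec (drift lam K t z y) j * kernelN lam a K t z y :=
    funext fun z => partialD_kernelN hC hP z j
  rw [e, partialD]
  simp only [mulVec_drift_add]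
  have h1 : HasDerivAt (fun h : ℝ => Real.exp (-lam j * t) *
      (P.mulVec (drift lam K t x y) j - h * (Real.exp (-lam i * t) * P j i)))
      (Real.exp (-lam j * t) * (-(1 * (Real.exp (-lam i * t) * P j i)))) 0 :=
    (((hasDerivAt_id (0 : ℝ)).mul_const _).const_sub _).const_mul _
  have h2 := (h1.mul (hasDerivAt_kernelN hC hP x i)).deriv
  refine h2.trans ?_
  rw [hP.apply i j]
  simp
  ring

lemma partialD_kernelN_of_le {j : ℕ} (hj : K ≤ j) (x y : EllTwo) :
    partialD j (fun z => kernelN lam a K t z y) x = 0 := by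
  simp [partialD, kernelN_add_of_le hj]

lemma partialD_partialD_kernelN_of_le {i j : ℕ} (h : K ≤ i ∨ K ≤ j) (x y : EllTwo) :
    partialD i (partialD j (fun z => kernelN lam a K t z y)) x = 0 := by
  by_cases hj : K ≤ j
  · have e : partialD j (fun z => kernelN lam a K t z y) = fun _ => 0 :=
      funext fun z => partialD_kernelN_of_le hj z y
    rw [e]; simp [partialD]
  · have hi : K ≤ i := h.resolve_right hj
    have e : ∀ h' : ℝ, partialD j (fun z => kernelN lam a K t z y) (x + h' • unitVec i) =
        partialD j (fun z => kernelN lam a K t z y) x := fun h' => by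
      simp only [partialD]
      congr 1
      ext h
      rw [add_right_comm, kernelN_add_of_le hi]
    rw [partialD]
    simp only [e, deriv_const]

lemma perturbation_eq_sum {P : Matrix (Fin K) (Fin K) ℝ} {y : EllTwo}
    (hC : (covMatrix lam a K y t)⁻¹ = P) (hP : P.IsSymm) (x : EllTwo) :
    perturbation lam a K t x y = ∑ i : Fin K, ∑ j : Fin K,
      (entryK a K x i j - entryK a K y i j) * (Real.exp (-lam i * t) * Real.exp (-lam j * t) *
        (P.mulVec (drift lam K t x y) i * P.mulVec (drift lam K t x y) j - P i j) *
        kernelN lam a K t x y) := by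
  rw [perturbation, tsum_eq_sum (s := range K ×ˢ range K), sum_product, ← Fin.sum_univ_eq_sum_range
    (fun i => ∑ j ∈ range K, (entryK a K x i j - entryK a K y i j) *
      partialD i (partialD j (fun z => kernelN lam a K t z y)) x) K]
  · refine sum_congr rfl fun i _ => ?_
    rw [← Fin.sum_univ_eq_sum_range (fun j => (entryK a K x i j - entryK a K y i j) *
      partialD i (partialD j (fun z => kernelN lam a K t z y)) x) K]
    exact sum_congr rfl fun j _ => by rw [partialD_partialD_kernelN hC hP]
  · intro p hp
    rw [partialD_partialD_kernelN_of_le, mul_zero]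
    simp only [mem_product, mem_range] at hp
    omega

end OUKernel

end

/-! ### The kernel in rescaled coordinates and the sum over diagonals -/

noncomputable section

namespace OUKernel

open Finset TriGauss

variable {lam : ℕ → ℝ} {a : EllTwo → EllTwo →L[ℝ] EllTwo} {t : ℝ} {K : ℕ}

/-! ### The kernel in rescaled coordinates -/

lemma blockInv_eq_sum (G : ℕ → ℕ → ℝ) (m i j : ℕ) :
    blockInv G m i j = ∑ k ∈ range m, residual G k i * (pivot G k)⁻¹ * residual G k j := by
  induction m with
  | zero => rfl
  | succ m ih => rw [blockInv_succ, sum_range_succ, ih]; ring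

/-- The inverse covariance at the point with rescaled coordinates `z`. -/
def precision (σ : ℕ → ℝ) (K : ℕ) (G : ℕ → ℕ → ℝ) : Matrix (Fin K) (Fin K) ℝ :=
  Matrix.of fun i j => blockInv G K i j / (σ i * σ j)

lemma precision_isSymm (σ : ℕ → ℝ) (G : ℕ → ℕ → ℝ) : (precision σ K G).IsSymm := by
  ext i j
  simp [precision, blockInv_symm G K i j, mul_comm]

/-- The recursion for `blockInv` is a factorisation `U D Uᵀ`, with `U` upper triangular because the
`k`-th residual vanishes beyond index `k`, and with diagonal entries `1 / σ_k`. -/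
lemma det_precision (σ : ℕ → ℝ) (G : ℕ → ℕ → ℝ) :
    (precision σ K G).det = ∏ k ∈ range K, ((σ k)⁻¹ ^ 2 * (pivot G k)⁻¹) := by
  set U : Matrix (Fin K) (Fin K) ℝ := Matrix.of fun i k => residual G k i / σ i with hU
  have e : precision σ K G = U * Matrix.diagonal (fun k : Fin K => (pivot G k)⁻¹) * U.transpose := by
    ext i j
    rw [Matrix.mul_apply]
    simp only [Matrix.mul_diagonal, Matrix.transpose_apply, precision, hU, Matrix.of_apply]
    rw [blockInv_eq_sum, ← Fin.sum_univ_eq_sum_range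
      (fun k => residual G k i * (pivot G k)⁻¹ * residual G k j), sum_div]
    refine sum_congr rfl fun k _ => ?_
    rw [← div_mul_div_comm]
    ring
  have hdU : U.det = ∏ k : Fin K, (σ k)⁻¹ := by
    rw [Matrix.det_of_isUpperTriangular]
    · simp [hU, residual_self]
    · intro i j hij
      simp only [hU, Matrix.of_apply]
      rw [residual_of_gt G (by simpa using hij), zero_div]
  rw [e, Matrix.det_mul, Matrix.det_mul, Matrix.det_transpose, Matrix.det_diagonal, hdU,
    ← prod_mul_distrib, ← prod_mul_distrib,
    ← Fin.prod_univ_eq_prod_range (fun k => (σ k)⁻¹ ^ 2 * (pivot G k)⁻¹)]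
  exact prod_congr rfl fun k _ => by ring

lemma precision_mulVec {σ : ℕ → ℝ} (hσ : ∀ i, 0 < σ i) (G : ℕ → ℕ → ℝ) (z : ℕ → ℝ) (i : Fin K) :
    (precision σ K G).mulVec (fun k : Fin K => σ k * z k) i = solve G K z i / σ i := by
  rw [Matrix.mulVec, dotProduct, solve, sum_div,
    ← Fin.sum_univ_eq_sum_range (fun j => blockInv G K i j * z j / σ i)]
  refine sum_congr rfl fun j _ => ?_
  have := hσ i; have := hσ j
  simp only [precision, Matrix.of_apply]
  field_simp

lemma gaussQ_precision {Λ₀ Λ₁ Γ : ℝ} {G : ℕ → ℕ → ℝ} {σ : ℕ → ℝ} (h0 : 0 < Λ₀)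
    (hG : Admissible Λ₀ Λ₁ Γ G) (hσ : ∀ i, 0 < σ i) (z : ℕ → ℝ) :
    gaussQ K (fun k : Fin K => σ k * z k) (precision σ K G) =
      (∏ k ∈ range K, σ k)⁻¹ * density G K z := by
  have hq : (fun k : Fin K => σ k * z k) ⬝ᵥ
      (precision σ K G).mulVec (fun k : Fin K => σ k * z k) = invQuad G K z := by
    rw [invQuad, ← Fin.sum_univ_eq_sum_range (fun i => z i * solve G K z i), dotProduct]
    refine sum_congr rfl fun i _ => ?_
    rw [precision_mulVec hσ]
    have := hσ i
    field_simp
  have hd : √(precision σ K G).det = ∏ k ∈ range K, ((σ k)⁻¹ * √((pivot G k)⁻¹)) := by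
    have : ∀ k ∈ range K, 0 ≤ (σ k)⁻¹ * √((pivot G k)⁻¹) := fun k _ =>
      mul_nonneg (inv_nonneg.2 (hσ k).le) (Real.sqrt_nonneg _)
    rw [det_precision, Real.sqrt_eq_iff_mul_self_eq (prod_nonneg fun k _ =>
      mul_nonneg (sq_nonneg _) (inv_nonneg.2 (pivot_pos h0 hG k).le)) (prod_nonneg this),
      ← prod_mul_distrib]
    refine prod_congr rfl fun k _ => ?_
    rw [mul_mul_mul_comm, Real.mul_self_sqrt (inv_nonneg.2 (pivot_pos h0 hG k).le), sq]
  have hpi : (2 * Real.pi) ^ (-(K : ℝ) / 2) = ∏ _k ∈ range K, (√(2 * Real.pi))⁻¹ := by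
    rw [prod_const, card_range, Real.sqrt_eq_rpow, ← Real.rpow_neg (by positivity),
      ← Real.rpow_natCast, ← Real.rpow_mul (by positivity)]
    congr 1; ring
  rw [gaussQ, hq, hd, hpi, density, ← mul_assoc, ← prod_mul_distrib, ← prod_inv_distrib,
    ← prod_inv_distrib, ← prod_mul_distrib]
  congr 1
  refine prod_congr rfl fun k _ => ?_
  rw [Real.sqrt_mul (by positivity : 0 ≤ 2 * Real.pi), Real.sqrt_inv, mul_inv]
  ring

lemma point_apply (x : EllTwo) (z : ℕ → ℝ) (i : Fin K) :
    point lam K x t K z i = Real.exp (-lam i * t) * x i + scale lam t i * z i := by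
  rw [point, embed_apply, if_pos i.2]

lemma drift_point (x : EllTwo) (z : ℕ → ℝ) :
    drift lam K t x (point lam K x t K z) = fun i : Fin K => scale lam t i * z i := by
  ext i
  rw [drift, point_apply]; ring

lemma entryK_point (x : EllTwo) (z : ℕ → ℝ) (m i j : ℕ) :
    entryK a K (point lam K x t m z) i j = entry a (point lam K x t m z) i j := by
  rw [entryK, point, proj_embed]

lemma covMatrix_point (ht : 0 < t) (x : EllTwo) (z : ℕ → ℝ) (i j : Fin K) :
    covMatrix lam a K (point lam K x t K z) t i j =
      gram lam a K x t K z i j * (scale lam t i * scale lam t j) := by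
  have h1 := scale_pos (lam := lam) ht i
  have h2 := scale_pos (lam := lam) ht j
  rw [covMatrix, Matrix.of_apply, entryK_point, gram, corr, ← intExp]
  field_simp

lemma inv_covMatrix_point {Λ₀ Λ₁ Γ : ℝ} (h0 : 0 < Λ₀) (ht : 0 < t) (x : EllTwo) (z : ℕ → ℝ)
    (hG : Admissible Λ₀ Λ₁ Γ (gram lam a K x t K z)) :
    (covMatrix lam a K (point lam K x t K z) t)⁻¹ =
      precision (scale lam t) K (gram lam a K x t K z) := by
  refine Matrix.inv_eq_right_inv ?_
  ext i j
  have hi := scale_pos (lam := lam) ht i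
  have hj := scale_pos (lam := lam) ht j
  have h := sum_mul_blockInv h0 hG K i i.2 j j.2
  rw [← Fin.sum_univ_eq_sum_range (fun l => gram lam a K x t K z i l *
    blockInv (gram lam a K x t K z) K l j)] at h
  rw [Matrix.mul_apply, Matrix.one_apply]
  calc _ = (∑ l : Fin K, gram lam a K x t K z i l * blockInv (gram lam a K x t K z) K l j) *
        (scale lam t i / scale lam t j) := by
        rw [sum_mul]
        refine sum_congr rfl fun l _ => ?_
        have hl := scale_pos (lam := lam) ht l
        rw [covMatrix_point ht, precision, Matrix.of_apply]
        field_simp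
    _ = _ := by
        rw [h]
        by_cases hij : i = j
        · subst hij
          simp [hi.ne']
        · rw [if_neg fun h => hij (Fin.ext h), if_neg hij, zero_mul]

/-- The damping factor of the `i`-th coordinate. -/
def damp (lam : ℕ → ℝ) (t : ℝ) (i : ℕ) : ℝ := Real.exp (-lam i * t) / scale lam t i

/-- Each derivative in `x_i` contributes `e^{-λ_i t}` and each component of the precision `1 / σ_i`;
together they form `damp`. The prefactor cancels the Jacobian of the change of variables. -/
lemma perturbation_point {Λ₀ Λ₁ Γ : ℝ} (h0 : 0 < Λ₀) (ht : 0 < t) (x : EllTwo) (z : ℕ → ℝ)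
    (hG : Admissible Λ₀ Λ₁ Γ (gram lam a K x t K z)) :
    perturbation lam a K t x (point lam K x t K z) =
      (∏ k ∈ range K, scale lam t k)⁻¹ * (density (gram lam a K x t K z) K z *
        ∑ i ∈ range K, ∑ j ∈ range K, (entryK a K x i j - entry a (point lam K x t K z) i j) *
          (damp lam t i * damp lam t j * (solve (gram lam a K x t K z) K z i *
            solve (gram lam a K x t K z) K z j - blockInv (gram lam a K x t K z) K i j))) := by
  have hC := inv_covMatrix_point h0 ht x z hG
  have hN : kernelN lam a K t x (point lam K x t K z) =
      (∏ k ∈ range K, scale lam t k)⁻¹ * density (gram lam a K x t K z) K z := by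
    rw [← gaussQ_precision h0 hG (fun i => scale_pos ht i), ← hC, ← drift_point]; rfl
  rw [perturbation_eq_sum hC (precision_isSymm _ _), ← mul_assoc, mul_sum, ←
    Fin.sum_univ_eq_sum_range (fun i => (∏ k ∈ range K, scale lam t k)⁻¹ *
      density (gram lam a K x t K z) K z * ∑ j ∈ range K,
        (entryK a K x i j - entry a (point lam K x t K z) i j) *
          (damp lam t i * damp lam t j * (solve (gram lam a K x t K z) K z i *
            solve (gram lam a K x t K z) K z j - blockInv (gram lam a K x t K z) K i j)))]
  refine sum_congr rfl fun i _ => ?_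
  rw [mul_sum, ← Fin.sum_univ_eq_sum_range (fun j : ℕ => (∏ k ∈ range K, scale lam t k)⁻¹ *
      density (gram lam a K x t K z) K z * (
        (entryK a K x i j - entry a (point lam K x t K z) i j) *
          (damp lam t i * damp lam t j * (solve (gram lam a K x t K z) K z i *
            solve (gram lam a K x t K z) K z j - blockInv (gram lam a K x t K z) K i j))))]
  refine sum_congr rfl fun j _ => ?_
  have hi := scale_pos (lam := lam) ht i
  have hj := scale_pos (lam := lam) ht j
  rw [drift_point, precision_mulVec (fun i => scale_pos ht i),
    precision_mulVec (fun i => scale_pos ht i), hN, entryK_point, precision, Matrix.of_apply,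
    damp, damp]
  field_simp

/-! ### Toeplitz regrouping -/

/-- A symmetric double sum, sorted by diagonals. -/
lemma sum_sum_eq_sum_diag {K : ℕ} {f : ℕ → ℕ → ℝ} (hf : ∀ i j, f i j = f j i)
    (h0 : ∀ i j, K ≤ j → f i j = 0) :
    ∑ i ∈ range K, ∑ j ∈ range K, f i j =
      ∑ n ∈ range K, (if n = 0 then 1 else 2) * ∑ i ∈ range K, f i (i + n) := by
  have h1 : ∀ i < K, ∑ n ∈ range K, f i (i + n) = ∑ j ∈ range K, if i ≤ j then f i j else 0 := by
    intro i hi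
    have e1 : ∑ n ∈ range K, f i (i + n) = ∑ n ∈ range (K - i), f i (i + n) := by
      refine (sum_subset (range_mono (by omega)) fun n _ hn => ?_).symm
      exact h0 _ _ (by simp at hn; omega)
    rw [e1, ← sum_filter, ← sum_Ico_eq_sum_range]
    refine sum_congr ?_ fun _ _ => rfl
    ext j; simp; omega
  have h2 : ∑ i ∈ range K, ∑ j ∈ range K, (if i ≤ j then f i j else 0) =
      ∑ i ∈ range K, ∑ j ∈ range K, (if j ≤ i then f i j else 0) := by
    rw [sum_comm]
    refine sum_congr rfl fun i _ => sum_congr rfl fun j _ => ?_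
    rw [hf]
  have h3 : ∑ i ∈ range K, ∑ j ∈ range K, f i j =
      ∑ i ∈ range K, ∑ j ∈ range K, (if i ≤ j then f i j else 0) +
      ∑ i ∈ range K, ∑ j ∈ range K, (if j ≤ i then f i j else 0) - ∑ i ∈ range K, f i i := by
    rw [← sum_add_distrib, ← sum_sub_distrib]
    refine sum_congr rfl fun i hi => ?_
    have : f i i = ∑ j ∈ range K, if j = i then f i j else 0 := by
      rw [sum_ite_eq' (range K) i (f i), if_pos hi]
    rw [this, ← sum_add_distrib, ← sum_sub_distrib]
    refine sum_congr rfl fun j _ => ?_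
    rcases lt_trichotomy i j with h | h | h
    · rw [if_pos h.le, if_neg h.not_ge, if_neg h.ne']; ring
    · subst h; simp
    · rw [if_neg h.not_ge, if_pos h.le, if_neg h.ne]; ring
  have h4 : ∑ n ∈ range K, ∑ i ∈ range K, f i (i + n) =
      ∑ i ∈ range K, ∑ j ∈ range K, (if i ≤ j then f i j else 0) := by
    rw [sum_comm]
    exact sum_congr rfl fun i hi => h1 i (mem_range.1 hi)
  have h5 : ∑ n ∈ range K, (if n = 0 then (1 : ℝ) else 2) * ∑ i ∈ range K, f i (i + n) =
      2 * ∑ n ∈ range K, ∑ i ∈ range K, f i (i + n) - ∑ i ∈ range K, f i i := by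
    rcases K with _ | K
    · simp
    · rw [sum_range_succ', sum_range_succ' (fun n => ∑ i ∈ range (K + 1), f i (i + n))]
      simp only [Nat.add_eq_zero_iff, one_ne_zero, and_false, if_false, if_true, add_zero]
      rw [← mul_sum]
      ring
  rw [h3, ← h2, h5, h4]
  ring

/-- The entry difference along the `n`-th diagonal. -/
def diagDiff (lam : ℕ → ℝ) (a : EllTwo → EllTwo →L[ℝ] EllTwo) (K : ℕ) (x : EllTwo) (t : ℝ)
    (z : ℕ → ℝ) (n : ℕ) : ℝ := entryK a K x n 0 - entry a (point lam K x t K z) n 0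

/-- The Toeplitz property is used here: the random factor `diagDiff` leaves the sum along each
diagonal, and what remains has deterministic coefficients, as the martingale argument requires. -/
lemma sum_diff_eq (ha : ∀ x, IsSelfAdjoint (a x)) (hT : IsToeplitz a) (x : EllTwo) (z : ℕ → ℝ)
    (G : ℕ → ℕ → ℝ) :
    ∑ i ∈ range K, ∑ j ∈ range K, (entryK a K x i j - entry a (point lam K x t K z) i j) *
          (damp lam t i * damp lam t j * (solve G K z i * solve G K z j - blockInv G K i j)) =
      ∑ n ∈ range K, (if n = 0 then 1 else 2) * (diagDiff lam a K x t z n *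
        bandForm K n (fun i => damp lam t i * damp lam t (i + n)) G K z) := by
  rw [sum_sum_eq_sum_diag (f := fun i j => (entryK a K x i j - entry a (point lam K x t K z) i j) *
    (damp lam t i * damp lam t j * (solve G K z i * solve G K z j - blockInv G K i j)))]
  · refine sum_congr rfl fun n _ => ?_
    congr 1
    rw [bandForm, mul_sum]
    refine sum_congr rfl fun i _ => ?_
    have h1 : ∀ y, entry a y i (i + n) = entry a y n 0 := fun y => by
      rw [entry_symm ha]
      exact hT y _ _ _ _ (by push_cast; ring)
    rw [entryK, h1, h1, diagDiff, entryK]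
  · intro i j
    rw [entryK, entry_symm ha, entry_symm ha _ i j, blockInv_symm, entryK]
    ring
  · intro i j hj
    rw [solve_eq_zero G hj, blockInv_eq_zero' G hj]
    ring

/-- The triangle inequality is applied only across diagonals; the cancellation inside each
`bandForm` is preserved. -/
lemma abs_perturbation_point_le {Λ₀ Λ₁ Γ : ℝ} (h0 : 0 < Λ₀) (ht : 0 < t)
    (ha : ∀ x, IsSelfAdjoint (a x)) (hT : IsToeplitz a) (x : EllTwo) (z : ℕ → ℝ)
    (hG : Admissible Λ₀ Λ₁ Γ (gram lam a K x t K z)) :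
    |perturbation lam a K t x (point lam K x t K z)| ≤ (∏ k ∈ range K, scale lam t k)⁻¹ *
      (2 * ∑ n ∈ range K, |diagDiff lam a K x t z n| *
        |bandForm K n (fun i => damp lam t i * damp lam t (i + n)) (gram lam a K x t K z) K z| *
        density (gram lam a K x t K z) K z) := by
  have hσ : 0 ≤ (∏ k ∈ range K, scale lam t k)⁻¹ :=
    inv_nonneg.2 (prod_nonneg fun i _ => (scale_pos ht i).le)
  have hd := (density_pos h0 hG K z).le
  rw [perturbation_point h0 ht x z hG, sum_diff_eq ha hT, abs_mul, abs_mul, abs_of_nonneg hσ,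
    abs_of_nonneg hd, mul_comm (density _ _ _), ← sum_mul, ← mul_assoc 2]
  gcongr
  rw [mul_sum]
  refine (abs_sum_le_sum_abs _ _).trans (sum_le_sum fun n _ => ?_)
  rw [abs_mul, abs_mul]
  gcongr
  split_ifs <;> simp

end OUKernel

end

/-! ### Change of variables and measurability -/

noncomputable section

namespace OUKernel

open Finset TriGauss

variable {lam : ℕ → ℝ} {a : EllTwo → EllTwo →L[ℝ] EllTwo} {t : ℝ} {K : ℕ}

/-! ### Change of variables -/

lemma lintegral_affine {σ : Fin K → ℝ} (hσ : ∀ i, 0 < σ i) (c : Fin K → ℝ)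
    {Φ : (Fin K → ℝ) → ENNReal} (hΦ : Measurable Φ) :
    ∫⁻ y, Φ y = ENNReal.ofReal (∏ i, σ i) * ∫⁻ z : Fin K → ℝ, Φ fun i => c i + σ i * z i := by
  have hp : 0 < ∏ i, σ i := prod_pos fun i _ => hσ i
  have hdet : (Matrix.diagonal σ).det = ∏ i, σ i := Matrix.det_diagonal
  have h1 := Real.map_matrix_volume_pi_eq_smul_volume_pi (M := Matrix.diagonal σ)
    (by rw [hdet]; exact hp.ne')
  have hm : Measurable fun y => Φ (c + y) := hΦ.comp (measurable_const_add c)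
  have hL : Measurable (Matrix.toLin' (Matrix.diagonal σ)) :=
    (LinearMap.continuous_on_pi _).measurable
  have h2 : ∫⁻ z, Φ (c + Matrix.toLin' (Matrix.diagonal σ) z) =
      ENNReal.ofReal |(∏ i, σ i)⁻¹| * ∫⁻ y, Φ y := by
    rw [← lintegral_map (f := fun y => Φ (c + y)) hm hL, h1, lintegral_smul_measure, hdet,
      lintegral_add_left_eq_self, smul_eq_mul]
  have h3 : ∀ z, c + Matrix.toLin' (Matrix.diagonal σ) z = fun i => c i + σ i * z i := fun z => by
    ext i
    simp [Matrix.mulVec_diagonal]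
  simp only [h3] at h2
  rw [h2, ← mul_assoc, ← ENNReal.ofReal_mul hp.le, abs_of_pos (inv_pos.2 hp),
    mul_inv_cancel₀ hp.ne', ENNReal.ofReal_one, one_mul]

lemma lintegral_eq_iterInt {f : (Fin K → ℝ) → ENNReal} (hf : Measurable f) :
    ∫⁻ z, f z = iterInt K fun z => f fun i => z i := by
  have h := lmarginal_image (μ := fun _ : ℕ => (volume : Measure ℝ)) (e := (Fin.val : Fin K → ℕ))
    Fin.val_injective univ hf 0
  have hr : (univ : Finset (Fin K)).image Fin.val = range K := by
    ext k
    simp only [mem_image, mem_univ, true_and, mem_range]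
    exact ⟨fun ⟨i, hi⟩ => hi ▸ i.2, fun h => ⟨⟨k, h⟩, rfl⟩⟩
  rw [hr, lmarginal_univ] at h
  exact h.symm

lemma embed_affine (x : EllTwo) (z : ℕ → ℝ) :
    embed K (fun i : Fin K => Real.exp (-lam i * t) * x i + scale lam t i * z i) =
      point lam K x t K z := by
  unfold point
  congr 1
  ext i
  rw [if_pos i.2]

/-- The inverse substitution, which carries measurability from rescaled coordinates back to `y`. -/
lemma exists_coords (ht : 0 < t) (x : EllTwo) : ∃ S : (Fin K → ℝ) → ℕ → ℝ, Measurable S ∧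
    ∀ y, embed K y = point lam K x t K (S y) := by
  refine ⟨fun y k => if h : k < K then (y ⟨k, h⟩ - Real.exp (-lam k * t) * x k) / scale lam t k
    else 0, measurable_pi_lambda _ fun k => ?_, fun y => ?_⟩
  · split_ifs <;> fun_prop
  · rw [← embed_affine]
    congr 1
    ext i
    have := scale_pos (lam := lam) ht i
    simp only [i.2, dif_pos]
    field_simp
    ring

lemma measurable_point_entry {α β κβ : ℝ} (hα : 0 < α) (hH : CoordHolder α β κβ a) (x : EllTwo)
    (i j : ℕ) : Measurable fun z => entry a (point lam K x t K z) i j := by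
  have h := measurable_entry_embed hα hH K i j
  simp only [← embed_affine]
  exact h.comp (measurable_pi_lambda _ fun i => by fun_prop)

lemma measurable_perturbation {Λ₀ Λ₁ Γ L α β κβ : ℝ} (h0 : 0 < Λ₀) (ht : 0 < t) (hα : 0 < α)
    (hH : CoordHolder α β κβ a) (x : EllTwo)
    (hG : AdaptedFamily Λ₀ Λ₁ Γ L (gram lam a K x t)) :
    Measurable fun y : Fin K → ℝ => perturbation lam a K t x (embed K y) := by
  obtain ⟨S, hS, hy⟩ := exists_coords (K := K) (lam := lam) ht x
  have h1 : Measurable fun z => perturbation lam a K t x (point lam K x t K z) := by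
    simp only [fun z => perturbation_point h0 ht x z (hG.adm K z)]
    have e1 := measurable_density (hG.meas K) K
    have e2 := measurable_solve (hG.meas K) K
    have e3 := measurable_blockInv (hG.meas K) K
    have e4 := measurable_point_entry (lam := lam) (K := K) (t := t) hα hH x
    refine (e1.mul ?_).const_mul _
    refine Finset.measurable_fun_sum _ fun i _ => Finset.measurable_fun_sum _ fun j _ => ?_
    exact ((e4 i j).const_sub _).mul ((((e2 i).mul (e2 j)).sub (e3 i j)).const_mul _)
  simp only [hy]
  exact h1.comp hS

lemma lintegral_perturbation {Λ₀ Λ₁ Γ L α β κβ : ℝ} (h0 : 0 < Λ₀) (ht : 0 < t) (hα : 0 < α)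
    (hH : CoordHolder α β κβ a) (x : EllTwo)
    (hG : AdaptedFamily Λ₀ Λ₁ Γ L (gram lam a K x t)) :
    ∫⁻ y : Fin K → ℝ, ENNReal.ofReal |perturbation lam a K t x (embed K y)| =
      ENNReal.ofReal (∏ i ∈ range K, scale lam t i) *
        iterInt K fun z => ENNReal.ofReal |perturbation lam a K t x (point lam K x t K z)| := by
  have hm := (measurable_perturbation h0 ht hα hH x hG).abs.ennreal_ofReal
  have h1 := lintegral_affine (fun i : Fin K => scale_pos (lam := lam) ht i)
    (fun i => Real.exp (-lam i * t) * x i) hm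
  have h2 := lintegral_eq_iterInt (K := K) (f := fun z => ENNReal.ofReal |perturbation lam a K t x
    (embed K fun i => Real.exp (-lam i * t) * x i + scale lam t i * z i)|)
    (hm.comp (measurable_pi_lambda _ fun i => by fun_prop))
  rw [h2, Fin.prod_univ_eq_prod_range] at h1
  simp only [embed_affine] at h1
  exact h1

lemma lintegral_perturbation_le {Λ₀ Λ₁ Γ L α β κβ : ℝ} (h0 : 0 < Λ₀) (ht : 0 < t) (hα : 0 < α)
    (ha : ∀ x, IsSelfAdjoint (a x)) (hT : IsToeplitz a) (hH : CoordHolder α β κβ a) (x : EllTwo)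
    (hG : AdaptedFamily Λ₀ Λ₁ Γ L (gram lam a K x t)) :
    ∫⁻ y : Fin K → ℝ, ENNReal.ofReal |perturbation lam a K t x (embed K y)| ≤
      2 * ∑ n ∈ range K, iterInt K fun z => ENNReal.ofReal (|diagDiff lam a K x t z n| *
        |bandForm K n (fun i => damp lam t i * damp lam t (i + n)) (gram lam a K x t K z) K z| *
        density (gram lam a K x t K z) K z) := by
  have hp : 0 < ∏ i ∈ range K, scale lam t i := prod_pos fun i _ => scale_pos ht i
  have hm : ∀ n, Measurable fun z => ENNReal.ofReal (|diagDiff lam a K x t z n| *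
        |bandForm K n (fun i => damp lam t i * damp lam t (i + n)) (gram lam a K x t K z) K z| *
        density (gram lam a K x t K z) K z) := fun n => by
    have e1 := measurable_density (hG.meas K) K
    have e2 := measurable_bandForm (hG.meas K) K n (fun i => damp lam t i * damp lam t (i + n)) K
    have e3 : Measurable fun z => diagDiff lam a K x t z n :=
      (measurable_point_entry (lam := lam) (K := K) (t := t) hα hH x n 0).const_sub _
    exact ((e3.abs.mul e2.abs).mul e1).ennreal_ofReal
  rw [lintegral_perturbation h0 ht hα hH x hG, ← iterInt_sum K _ hm, ← iterInt_const_mul K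
    (Finset.measurable_fun_sum _ fun n _ => hm n), ← iterInt_const_mul K ?_]
  · refine iterInt_mono K fun z => ?_
    have hd := (density_pos h0 (hG.adm K z) K z).le
    rw [← ENNReal.ofReal_sum_of_nonneg fun n _ => by positivity, ← ENNReal.ofReal_ofNat 2,
      ← ENNReal.ofReal_mul hp.le, ← ENNReal.ofReal_mul (by norm_num)]
    refine ENNReal.ofReal_le_ofReal ?_
    have h := mul_le_mul_of_nonneg_left
      (abs_perturbation_point_le h0 ht ha hT x z (hG.adm K z)) hp.le
    rwa [mul_inv_cancel_left₀ hp.ne'] at h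
  · have h := (measurable_perturbation h0 ht hα hH x hG).abs.ennreal_ofReal
    simp only [← embed_affine]
    exact h.comp (measurable_pi_lambda _ fun i => by fun_prop)

end OUKernel

end

/-! ### Entry differences, damping factors and moments of the coordinates -/

noncomputable section

namespace OUKernel

open Finset TriGauss

variable {lam : ℕ → ℝ} {a : EllTwo → EllTwo →L[ℝ] EllTwo} {t : ℝ} {K : ℕ}

/-! ### Bounds on the entry differences -/

/-- The weighted sum of the rescaled coordinates. -/
def weightedAbs (K : ℕ) (z : ℕ → ℝ) : ℝ := ∑ k ∈ range K, (((k : ℝ) + 1) ^ 2)⁻¹ * |z k|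

/-- `∑ 1 / k²`. -/
def invSqSum : ℝ := ∑' k : ℕ, (((k : ℝ) + 1) ^ 2)⁻¹

lemma weightedAbs_nonneg (K : ℕ) (z : ℕ → ℝ) : 0 ≤ weightedAbs K z :=
  sum_nonneg fun _ _ => by positivity

lemma summable_inv_sq : Summable fun k : ℕ => (((k : ℝ) + 1) ^ 2)⁻¹ := by
  have := (summable_nat_add_iff 1).2 (Real.summable_nat_pow_inv (p := 2).2 (by norm_num))
  simpa using this

lemma invSqSum_nonneg : 0 ≤ invSqSum := tsum_nonneg fun _ => by positivity

lemma sum_inv_sq_le_invSqSum (K : ℕ) : ∑ k ∈ range K, (((k : ℝ) + 1) ^ 2)⁻¹ ≤ invSqSum :=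
  summable_inv_sq.sum_le_tsum _ fun _ _ => by positivity

lemma abs_diagDiff_le_decay {γ κγ : ℝ} (hoff : OffDiagonalDecay γ κγ a) (x : EllTwo) (z : ℕ → ℝ)
    (n : ℕ) : |diagDiff lam a K x t z n| ≤ 2 * κγ * (1 / (1 + (n : ℝ) ^ γ)) := by
  have h1 := hoff (proj K x) n 0
  have h2 := hoff (point lam K x t K z) n 0
  simp only [Nat.cast_zero, sub_zero, Nat.abs_cast] at h1 h2
  refine (abs_sub _ _).trans ((add_le_add h1 h2).trans_eq ?_)
  ring

lemma one_sub_exp_neg_le_sqrt {s : ℝ} (hs : 0 ≤ s) : 1 - Real.exp (-s) ≤ √s := by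
  rcases le_total s 1 with h | h
  · have h1 := Real.add_one_le_exp (-s)
    have h2 : s ≤ √s := Real.le_sqrt_of_sq_le (by nlinarith)
    linarith
  · have h1 := Real.exp_pos (-s)
    have h2 := Real.one_le_sqrt.2 h
    linarith

/-- Constant in the Hölder bound of the entry differences. -/
def holderConst (α κβ κlam : ℝ) : ℝ := κβ * (√κlam⁻¹ ^ α * invSqSum + invSqSum + 1)

/-- The drift is handled by `1 - e^{-λ_k t} ≤ √(λ_k t)`, which yields `√t` at the price of a factor
`k + 1`; the noise is handled by `σ_k ≤ √t`. -/
lemma abs_displacement_rpow_le {α κlam : ℝ} (ht : 0 < t) (hα : 0 < α) (hα' : α ≤ 1)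
    (hκ : 0 < κlam) (hlam : QuadraticGrowth κlam lam) (x : EllTwo) (r : ℝ) (k : ℕ) :
    |x k - (Real.exp (-lam k * t) * x k + scale lam t k * r)| ^ α ≤
      √t ^ α * (√κlam⁻¹ ^ α * ((k : ℝ) + 1) ^ α * supNorm x ^ α + (1 + |r|)) := by
  have hl := hlam.pos hκ k
  have hσ := scale_pos (lam := lam) ht k
  have hX := supNorm_nonneg x
  have hst : scale lam t k ≤ √t := Real.le_sqrt_of_sq_le (scale_sq_le ht hl)
  have he : 1 - Real.exp (-lam k * t) ≤ √t * (√κlam⁻¹ * ((k : ℝ) + 1)) := by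
    have h1 := one_sub_exp_neg_le_sqrt (s := lam k * t) (by positivity)
    rw [neg_mul]
    refine h1.trans ?_
    have h2 : √t * (√κlam⁻¹ * ((k : ℝ) + 1)) = √(κlam⁻¹ * ((k : ℝ) + 1) ^ 2 * t) := by
      rw [Real.sqrt_mul (by positivity), Real.sqrt_mul (by positivity),
        Real.sqrt_sq (by positivity)]
      ring
    rw [h2]
    exact Real.sqrt_le_sqrt (mul_le_mul_of_nonneg_right (hlam k).2 ht.le)
  have he0 : 0 ≤ 1 - Real.exp (-lam k * t) := by
    have : Real.exp (-lam k * t) ≤ 1 := Real.exp_le_one_iff.2 (by nlinarith)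
    linarith
  have h1 : |x k - (Real.exp (-lam k * t) * x k + scale lam t k * r)| ≤
      √t * (√κlam⁻¹ * ((k : ℝ) + 1)) * supNorm x + √t * |r| := by
    have e : x k - (Real.exp (-lam k * t) * x k + scale lam t k * r) =
        (1 - Real.exp (-lam k * t)) * x k - scale lam t k * r := by ring
    rw [e]
    refine (abs_sub _ _).trans ?_
    rw [abs_mul, abs_mul, abs_of_nonneg he0, abs_of_pos hσ]
    have := abs_apply_le_supNorm x k
    gcongr
  calc _ ≤ (√t * (√κlam⁻¹ * ((k : ℝ) + 1)) * supNorm x + √t * |r|) ^ α :=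
        Real.rpow_le_rpow (abs_nonneg _) h1 hα.le
    _ ≤ (√t * (√κlam⁻¹ * ((k : ℝ) + 1)) * supNorm x) ^ α + (√t * |r|) ^ α :=
        Real.rpow_add_le_add_rpow (by positivity) (by positivity) hα.le hα'
    _ = √t ^ α * (√κlam⁻¹ ^ α * ((k : ℝ) + 1) ^ α * supNorm x ^ α + |r| ^ α) := by
        rw [Real.mul_rpow (by positivity) hX, Real.mul_rpow (by positivity) (by positivity),
          Real.mul_rpow (by positivity) (by positivity), Real.mul_rpow (by positivity)
          (by positivity)]
        ring
    _ ≤ _ := by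
        have := rpow_le_one_add hα.le hα' (abs_nonneg r)
        gcongr

lemma abs_diagDiff_le_holder {α β κβ κlam : ℝ} (ht : 0 < t) (hα : 0 < α) (hα' : α ≤ 1)
    (hβ : 9 / 2 - α < β) (hκ : 0 < κlam) (hlam : QuadraticGrowth κlam lam)
    (hH : CoordHolder α β κβ a) (x : EllTwo) (z : ℕ → ℝ) (n : ℕ) :
    |diagDiff lam a K x t z n| ≤
      holderConst α κβ κlam * √t ^ α * ((1 + supNorm x ^ α) * (1 + weightedAbs K z)) := by
  have hκβ := hH.nonneg
  have hX : 0 ≤ supNorm x ^ α := Real.rpow_nonneg (supNorm_nonneg x) α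
  have hY := weightedAbs_nonneg K z
  have hS := invSqSum_nonneg
  set B := √κlam⁻¹ ^ α with hB
  have hB0 : 0 ≤ B := by positivity
  have hterm : ∀ k : ℕ, κβ * |x k - (Real.exp (-lam k * t) * x k + scale lam t k * z k)| ^ α *
      ((k : ℝ) + 1) ^ (-β) ≤ κβ * √t ^ α * ((B * supNorm x ^ α + 1) * (((k : ℝ) + 1) ^ 2)⁻¹ +
        (((k : ℝ) + 1) ^ 2)⁻¹ * |z k|) := fun k => by
    have hk : (0 : ℝ) < (k : ℝ) + 1 := by positivity
    have hk1 : (1 : ℝ) ≤ (k : ℝ) + 1 := by have : (0 : ℝ) ≤ k := k.cast_nonneg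
                                           linarith
    have e2 : (((k : ℝ) + 1) ^ 2)⁻¹ = ((k : ℝ) + 1) ^ (-2 : ℝ) := by
      rw [Real.rpow_neg hk.le]; norm_num
    -- Here `β - α > 9/2 - 2α ≥ 5/2`, so the growth of the drift in `k` is paid for with room to
    -- spare.
    have p1 : ((k : ℝ) + 1) ^ α * ((k : ℝ) + 1) ^ (-β) ≤ (((k : ℝ) + 1) ^ 2)⁻¹ := by
      rw [e2, ← Real.rpow_add hk]
      exact Real.rpow_le_rpow_of_exponent_le hk1 (by linarith)
    have p2 : ((k : ℝ) + 1) ^ (-β) ≤ (((k : ℝ) + 1) ^ 2)⁻¹ := by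
      rw [e2]
      exact Real.rpow_le_rpow_of_exponent_le hk1 (by linarith)
    calc _ ≤ κβ * (√t ^ α * (B * ((k : ℝ) + 1) ^ α * supNorm x ^ α + (1 + |z k|))) *
          ((k : ℝ) + 1) ^ (-β) := by
          have := abs_displacement_rpow_le ht hα hα' hκ hlam x (z k) k
          gcongr
      _ = κβ * √t ^ α * (B * supNorm x ^ α * (((k : ℝ) + 1) ^ α * ((k : ℝ) + 1) ^ (-β)) +
          (1 + |z k|) * ((k : ℝ) + 1) ^ (-β)) := by ring
      _ ≤ κβ * √t ^ α * (B * supNorm x ^ α * (((k : ℝ) + 1) ^ 2)⁻¹ +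
          (1 + |z k|) * (((k : ℝ) + 1) ^ 2)⁻¹) := by gcongr
      _ = _ := by ring
  have h1 : |diagDiff lam a K x t z n| ≤ ∑ k ∈ range K, κβ *
      |x k - (Real.exp (-lam k * t) * x k + scale lam t k * z k)| ^ α * ((k : ℝ) + 1) ^ (-β) := by
    rw [← Fin.sum_univ_eq_sum_range (fun k => κβ *
      |x k - (Real.exp (-lam k * t) * x k + scale lam t k * z k)| ^ α * ((k : ℝ) + 1) ^ (-β)),
      diagDiff, ← embed_affine]
    exact abs_entry_embed_sub_le hH K _ _ n 0
  refine (h1.trans (sum_le_sum fun k _ => hterm k)).trans ?_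
  rw [← mul_sum, sum_add_distrib, ← mul_sum, ← weightedAbs]
  have hS' := sum_inv_sq_le_invSqSum K
  calc _ ≤ κβ * √t ^ α * ((B * supNorm x ^ α + 1) * invSqSum + weightedAbs K z) := by gcongr
    _ ≤ κβ * √t ^ α * ((B * invSqSum + invSqSum + 1) *
        ((1 + supNorm x ^ α) * (1 + weightedAbs K z))) := by
        gcongr
        have q1 : 0 ≤ B * invSqSum := by positivity
        have q2 : 0 ≤ supNorm x ^ α * weightedAbs K z := by positivity
        nlinarith [mul_nonneg q1 hY, mul_nonneg q1 q2, mul_nonneg hS hX, mul_nonneg hS hY,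
          mul_nonneg hS q2]
    _ = _ := by rw [holderConst]; ring

/-- The interpolated bound on the entry differences. -/
lemma abs_diagDiff_le {α β γ κβ κγ κlam θ : ℝ} (ht : 0 < t) (hα : 0 < α) (hα' : α ≤ 1)
    (hβ : 9 / 2 - α < β) (hκ : 0 < κlam) (hθ : 0 ≤ θ) (hθ' : θ ≤ 1) (hγ : 0 < γ)
    (hlam : QuadraticGrowth κlam lam) (hoff : OffDiagonalDecay γ κγ a)
    (hH : CoordHolder α β κβ a) (x : EllTwo) (z : ℕ → ℝ) (n : ℕ) :
    |diagDiff lam a K x t z n| ≤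
      (2 * κγ) ^ (1 - θ) * (1 / (1 + (n : ℝ) ^ γ)) ^ (1 - θ) *
        (holderConst α κβ κlam ^ θ * t ^ (α * θ / 2)) *
        ((1 + supNorm x ^ α) * (1 + weightedAbs K z)) := by
  have hκβ := hH.nonneg
  have hκγ := hoff.nonneg hγ
  have hX : 0 ≤ supNorm x ^ α := Real.rpow_nonneg (supNorm_nonneg x) α
  have hY := weightedAbs_nonneg K z
  have hC : 0 ≤ holderConst α κβ κlam := by
    have := invSqSum_nonneg
    unfold holderConst; positivity
  have hd := abs_nonneg (diagDiff lam a K x t z n)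
  set Z := (1 + supNorm x ^ α) * (1 + weightedAbs K z) with hZ
  -- This permits `Z ^ θ ≤ Z` at the end, so that only integer moments of the coordinates are
  -- needed.
  have hZ1 : 1 ≤ Z := by nlinarith [mul_nonneg hX hY]
  calc |diagDiff lam a K x t z n| = |diagDiff lam a K x t z n| ^ (1 - θ) *
        |diagDiff lam a K x t z n| ^ θ := by
        rw [← Real.rpow_add_of_nonneg hd (by linarith) hθ]; simp
    _ ≤ (2 * κγ * (1 / (1 + (n : ℝ) ^ γ))) ^ (1 - θ) *
        (holderConst α κβ κlam * √t ^ α * Z) ^ θ := by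
        have h1 := abs_diagDiff_le_decay (lam := lam) (K := K) (t := t) hoff x z n
        have h2 := abs_diagDiff_le_holder (K := K) ht hα hα' hβ hκ hlam hH x z n
        have h3 := Real.rpow_le_rpow hd h1 (show 0 ≤ 1 - θ by linarith)
        have h4 := Real.rpow_le_rpow hd h2 hθ
        exact mul_le_mul h3 h4 (Real.rpow_nonneg hd _) ((Real.rpow_nonneg hd _).trans h3)
    _ = (2 * κγ) ^ (1 - θ) * (1 / (1 + (n : ℝ) ^ γ)) ^ (1 - θ) *
        (holderConst α κβ κlam ^ θ * t ^ (α * θ / 2)) * Z ^ θ := by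
        rw [Real.mul_rpow (x := 2 * κγ) (by positivity) (by positivity),
          Real.mul_rpow (y := Z) (by positivity) (by positivity),
          Real.mul_rpow (y := √t ^ α) (by positivity) (by positivity),
          ← Real.rpow_mul (Real.sqrt_nonneg _),
          Real.sqrt_eq_rpow, ← Real.rpow_mul ht.le, show 1 / 2 * (α * θ) = α * θ / 2 by ring]
        ring
    _ ≤ _ := by
        have : Z ^ θ ≤ Z := by
          calc Z ^ θ ≤ Z ^ (1 : ℝ) := Real.rpow_le_rpow_of_exponent_le hZ1 hθ'
            _ = Z := Real.rpow_one Z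
        gcongr

/-! ### Bounds on the damping factors -/

/-- Each damping factor squared is at most `t⁻¹`, and one of them keeps its exponential, replaced by
`2 / (1 + √(κ t) (i + 1))²`. Only about `t^{-1/2}` indices matter, which gives `t^{-2-1/2}`
uniformly in `n`. -/
lemma sum_damp_sq_le {κlam : ℝ} (ht : 0 < t) (hκ : 0 < κlam) (hlam : QuadraticGrowth κlam lam)
    (n N : ℕ) : ∑ i ∈ range N, (damp lam t i * damp lam t (i + n)) ^ 2 ≤
      2 * (√κlam)⁻¹ * t ^ (-(5 / 2) : ℝ) := by
  set s := √(κlam * t) with hs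
  have hs0 : 0 < s := Real.sqrt_pos.2 (by positivity)
  have hs2 : s ^ 2 = κlam * t := Real.sq_sqrt (by positivity)
  have h1 : ∀ i, (damp lam t i * damp lam t (i + n)) ^ 2 ≤
      2 * (t⁻¹) ^ 2 * ((1 + s * ((i : ℝ) + 1)) ^ 2)⁻¹ := fun i => by
    have a1 := exp_div_scale_sq_le ht (hlam.pos hκ i)
    have a2 := exp_div_scale_sq_le ht (hlam.pos hκ (i + n))
    have hl := hlam.pos hκ (i + n)
    have a3 : Real.exp (-(lam (i + n) * t)) ≤ 1 := Real.exp_le_one_iff.2 (by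
      have : 0 < lam (i + n) * t := by positivity
      linarith)
    have a4 : Real.exp (-(lam i * t)) ≤ 2 * ((1 + s * ((i : ℝ) + 1)) ^ 2)⁻¹ := by
      have b1 : (s * ((i : ℝ) + 1)) ^ 2 ≤ lam i * t := by
        rw [mul_pow, hs2]
        have := mul_le_mul_of_nonneg_right (hlam i).1 ht.le
        linarith
      have b2 : 0 < s * ((i : ℝ) + 1) := by positivity
      set q := s * ((i : ℝ) + 1)
      have b3 := Real.add_one_le_exp (lam i * t)
      rw [Real.exp_neg, ← div_eq_mul_inv, inv_le_comm₀ (Real.exp_pos _) (by positivity), inv_div,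
        div_le_iff₀ (by norm_num)]
      nlinarith [sq_nonneg (q - 1)]
    rw [mul_pow]
    calc _ ≤ (t⁻¹ * (2 * ((1 + s * ((i : ℝ) + 1)) ^ 2)⁻¹)) * (t⁻¹ * 1) := by
          refine mul_le_mul (a1.trans ?_) (a2.trans ?_) (sq_nonneg _) (by positivity) <;> gcongr
      _ = _ := by ring
  calc _ ≤ 2 * (t⁻¹) ^ 2 * ∑ i ∈ range N, ((1 + s * ((i : ℝ) + 1)) ^ 2)⁻¹ := by
        rw [mul_sum]; exact sum_le_sum fun i _ => h1 i
    _ ≤ 2 * (t⁻¹) ^ 2 * (1 / s) := by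
        have := sum_inv_sq_le hs0 N
        gcongr
    _ = _ := by
        have e : t ^ (-(5 / 2) : ℝ) = (t⁻¹) ^ 2 * (√t)⁻¹ := by
          rw [Real.sqrt_eq_rpow, ← Real.rpow_neg ht.le, ← Real.rpow_neg_one t,
            ← Real.rpow_mul_natCast ht.le, ← Real.rpow_add ht]
          norm_num
        rw [e, hs, Real.sqrt_mul hκ.le, one_div, mul_inv]
        ring

/-! ### Second moments of the coordinates -/

lemma iterInt_sum_le {m : ℕ} {ι : Type*} (s : Finset ι) {c B : ι → ℝ} {g : ι → (ℕ → ℝ) → ℝ}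
    (hc : ∀ i, 0 ≤ c i) (hB : ∀ i, 0 ≤ B i) (hg : ∀ i z, 0 ≤ g i z) (hm : ∀ i, Measurable (g i))
    (h : ∀ i, iterInt m (fun z => ENNReal.ofReal (g i z)) ≤ ENNReal.ofReal (B i)) :
    iterInt m (fun z => ENNReal.ofReal (∑ i ∈ s, c i * g i z)) ≤
      ENNReal.ofReal (∑ i ∈ s, c i * B i) := by
  have e : ∀ z, ENNReal.ofReal (∑ i ∈ s, c i * g i z) =
      ∑ i ∈ s, ENNReal.ofReal (c i) * ENNReal.ofReal (g i z) := fun z => by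
    rw [ENNReal.ofReal_sum_of_nonneg fun i _ => mul_nonneg (hc i) (hg i z)]
    exact sum_congr rfl fun i _ => ENNReal.ofReal_mul (hc i)
  rw [iterInt_congr m e, iterInt_sum m s fun i => (hm i).ennreal_ofReal.const_mul _,
    ENNReal.ofReal_sum_of_nonneg fun i _ => mul_nonneg (hc i) (hB i)]
  refine sum_le_sum fun i _ => ?_
  rw [iterInt_const_mul m (hm i).ennreal_ofReal, ENNReal.ofReal_mul (hc i)]
  gcongr
  exact h i

/-- A uniform bound on the row sums of the coefficient matrix. -/
def rowBound (γ κγ : ℝ) : ℝ := 2 * ∑' n : ℕ, κγ * (1 / (1 + (n : ℝ) ^ γ))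

lemma abs_gram_le {γ κγ : ℝ} (ht : 0 < t) (hoff : OffDiagonalDecay γ κγ a) (x : EllTwo)
    (m : ℕ) (z : ℕ → ℝ) (i j : ℕ) :
    |gram lam a K x t m z i j| ≤ κγ * (1 / (1 + (idxDist i j : ℝ) ^ γ)) := by
  rw [gram, abs_mul, abs_of_nonneg (corr_nonneg ht i j), cast_idxDist]
  have h1 := hoff (point lam K x t m z) i j
  have h2 := corr_le_one (lam := lam) ht i j
  have h3 := corr_nonneg (lam := lam) ht i j
  calc _ ≤ κγ / (1 + |(i : ℝ) - j| ^ γ) * 1 :=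
        mul_le_mul h1 h2 h3 ((abs_nonneg _).trans h1)
    _ = _ := by ring

lemma sum_decay_le {γ κγ : ℝ} (hγ : 1 < γ) (hκγ : 0 ≤ κγ) (i m : ℕ) :
    ∑ j ∈ range m, κγ * (1 / (1 + (idxDist i j : ℝ) ^ γ)) ≤ rowBound γ κγ := by
  have := summable_inv_one_add_rpow (γ := γ) one_pos (by linarith)
  simp only [Real.rpow_one] at this
  exact sum_idxDist_le (f := fun n => κγ * (1 / (1 + (n : ℝ) ^ γ))) (fun n => by positivity)
    (this.mul_left κγ) i m

/-- Since `z = G v` with `G` of bounded row sums, two weighted Cauchy–Schwarz inequalities transfer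
the moment bounds from the components of `v` to those of `z`. -/
lemma sq_weightedAbs_le {γ κγ Λ₀ Λ₁ Γ : ℝ} (h0 : 0 < Λ₀) (ht : 0 < t) (hγ : 1 < γ)
    (hoff : OffDiagonalDecay γ κγ a) (x : EllTwo) (z : ℕ → ℝ)
    (hG : Admissible Λ₀ Λ₁ Γ (gram lam a K x t K z)) :
    weightedAbs K z ^ 2 ≤ ∑ k ∈ range K, invSqSum * rowBound γ κγ * (((k : ℝ) + 1) ^ 2)⁻¹ *
      ∑ j ∈ range K, κγ * (1 / (1 + (idxDist k j : ℝ) ^ γ)) *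
        solve (gram lam a K x t K z) K z j ^ 2 := by
  have hκγ := hoff.nonneg (by linarith)
  set v := solve (gram lam a K x t K z) K z with hv
  have hrow : ∀ k < K, z k ^ 2 ≤ rowBound γ κγ * ∑ j ∈ range K,
      κγ * (1 / (1 + (idxDist k j : ℝ) ^ γ)) * v j ^ 2 := fun k hk => by
    have e := sum_mul_solve h0 hG K z hk
    have h1 : |z k| ≤ ∑ j ∈ range K, κγ * (1 / (1 + (idxDist k j : ℝ) ^ γ)) * |v j| := by
      rw [← e]
      refine (abs_sum_le_sum_abs _ _).trans (sum_le_sum fun j _ => ?_)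
      rw [abs_mul]
      have := abs_gram_le (K := K) (lam := lam) ht hoff x K z k j
      gcongr
    have h2 := sum_sq_le_sum_mul_sum_of_sq_le_mul (range K)
      (r := fun j => κγ * (1 / (1 + (idxDist k j : ℝ) ^ γ)) * |v j|)
      (f := fun j => κγ * (1 / (1 + (idxDist k j : ℝ) ^ γ)))
      (g := fun j => κγ * (1 / (1 + (idxDist k j : ℝ) ^ γ)) * v j ^ 2)
      (fun j _ => by positivity) (fun j _ => by positivity)
      (fun j _ => le_of_eq (by rw [mul_pow, sq_abs]; ring))
    calc z k ^ 2 = |z k| ^ 2 := (sq_abs _).symm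
      _ ≤ _ := pow_le_pow_left₀ (abs_nonneg _) h1 2
      _ ≤ _ := h2
      _ ≤ _ := by
        have := sum_decay_le hγ hκγ k K
        gcongr
  have h3 := sum_sq_le_sum_mul_sum_of_sq_le_mul (range K)
    (r := fun k : ℕ => (((k : ℝ) + 1) ^ 2)⁻¹ * |z k|) (f := fun k : ℕ => (((k : ℝ) + 1) ^ 2)⁻¹)
    (g := fun k : ℕ => (((k : ℝ) + 1) ^ 2)⁻¹ * z k ^ 2)
    (fun j _ => by positivity) (fun j _ => by positivity)
    (fun j _ => le_of_eq (by rw [mul_pow, sq_abs]; ring))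
  calc _ ≤ _ := h3
    _ ≤ invSqSum * ∑ k ∈ range K, (((k : ℝ) + 1) ^ 2)⁻¹ * (rowBound γ κγ * ∑ j ∈ range K,
        κγ * (1 / (1 + (idxDist k j : ℝ) ^ γ)) * v j ^ 2) := by
        refine mul_le_mul (sum_inv_sq_le_invSqSum K) (sum_le_sum fun k hk => ?_)
          (sum_nonneg fun j _ => by positivity) invSqSum_nonneg
        have := hrow k (mem_range.1 hk)
        gcongr
    _ = _ := by
        rw [mul_sum]
        exact sum_congr rfl fun k _ => by ring

lemma iterInt_weightedAbs_le {γ κγ Λ₀ Λ₁ Γ L V : ℝ} (h0 : 0 < Λ₀) (ht : 0 < t) (hγ : 1 < γ)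
    (hV : 0 ≤ V) (hoff : OffDiagonalDecay γ κγ a) (x : EllTwo)
    (hG : AdaptedFamily Λ₀ Λ₁ Γ L (gram lam a K x t))
    (hm : ∀ j : ℕ, iterInt K (fun z => ENNReal.ofReal
      ((1 + solve (gram lam a K x t K z) K z j ^ 2) * density (gram lam a K x t K z) K z)) ≤
        ENNReal.ofReal V) :
    iterInt K (fun z => ENNReal.ofReal ((1 + weightedAbs K z) ^ 2 *
      density (gram lam a K x t K z) K z)) ≤
      ENNReal.ofReal (2 * V + 2 * ((invSqSum * rowBound γ κγ) ^ 2 * V)) := by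
  have hκγ := hoff.nonneg (by linarith)
  have hS := invSqSum_nonneg
  have hR : 0 ≤ rowBound γ κγ := mul_nonneg two_pos.le (tsum_nonneg fun n => by positivity)
  have hmeas : ∀ j, Measurable fun z => (1 + solve (gram lam a K x t K z) K z j ^ 2) *
      density (gram lam a K x t K z) K z := fun j => by
    have e1 := measurable_density (hG.meas K) K
    have e2 := measurable_solve (hG.meas K) K j
    exact ((e2.pow_const 2).const_add 1).mul e1
  have hd : ∀ z, 0 ≤ density (gram lam a K x t K z) K z := fun z =>
    (density_pos h0 (hG.adm K z) K z).le
  set c : ℕ × ℕ → ℝ := fun p => invSqSum * rowBound γ κγ * (((p.1 : ℝ) + 1) ^ 2)⁻¹ *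
    (κγ * (1 / (1 + (idxDist p.1 p.2 : ℝ) ^ γ))) with hc
  have hc0 : ∀ p, 0 ≤ c p := fun p => by positivity
  have hsum : ∑ p ∈ range K ×ˢ range K, c p ≤ (invSqSum * rowBound γ κγ) ^ 2 := by
    rw [sum_product]
    calc _ ≤ ∑ k ∈ range K, invSqSum * rowBound γ κγ * (((k : ℝ) + 1) ^ 2)⁻¹ *
          rowBound γ κγ := by
          refine sum_le_sum fun k _ => ?_
          simp only [hc]
          rw [← mul_sum]
          have := sum_decay_le hγ hκγ k K
          gcongr
      _ ≤ invSqSum * rowBound γ κγ * invSqSum * rowBound γ κγ := by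
          rw [← sum_mul, ← mul_sum]
          have := sum_inv_sq_le_invSqSum K
          gcongr
      _ = _ := by ring
  -- The index `none` carries the constant in `1 + weightedAbs`. Any component would serve there,
  -- because `1 ≤ 1 + v_0²`.
  set g : Option (ℕ × ℕ) → (ℕ → ℝ) → ℝ := fun o z =>
    (1 + solve (gram lam a K x t K z) K z (o.elim 0 Prod.snd) ^ 2) *
      density (gram lam a K x t K z) K z with hg
  have key := iterInt_sum_le (m := K) (insertNone (range K ×ˢ range K))
    (c := fun o => 2 * o.elim 1 c) (B := fun _ => V) (g := g)
    (fun o => by cases o <;> simp [hc0]) (fun _ => hV)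
    (fun o z => mul_nonneg (by positivity) (hd z)) (fun o => hmeas _) (fun o => hm _)
  refine (iterInt_mono K fun z => ENNReal.ofReal_le_ofReal ?_).trans
    (key.trans (ENNReal.ofReal_le_ofReal ?_))
  · rw [sum_insertNone]
    have h1 := sq_weightedAbs_le h0 ht hγ hoff x z (hG.adm K z)
    set v := solve (gram lam a K x t K z) K z
    have h2 : (1 + weightedAbs K z) ^ 2 ≤ 2 * (1 + v 0 ^ 2) +
        ∑ p ∈ range K ×ˢ range K, 2 * c p * (1 + v p.2 ^ 2) := by
      have h3 : weightedAbs K z ^ 2 ≤ ∑ p ∈ range K ×ˢ range K, c p * (1 + v p.2 ^ 2) := by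
        refine h1.trans ?_
        rw [sum_product]
        refine sum_le_sum fun k _ => ?_
        rw [mul_sum]
        refine sum_le_sum fun j _ => ?_
        rw [← mul_assoc]
        exact mul_le_mul_of_nonneg_left (by linarith) (hc0 (k, j))
      have h4 : ∑ p ∈ range K ×ˢ range K, 2 * c p * (1 + v p.2 ^ 2) =
          2 * ∑ p ∈ range K ×ˢ range K, c p * (1 + v p.2 ^ 2) := by
        rw [mul_sum]; exact sum_congr rfl fun p _ => by ring
      rw [h4]
      nlinarith [sq_nonneg (weightedAbs K z - 1), sq_nonneg (v 0)]
    have h5 := mul_le_mul_of_nonneg_right h2 (hd z)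
    refine h5.trans_eq ?_
    rw [add_mul, sum_mul]
    simp only [hg, Option.elim, mul_one]
    congr 1
    · ring
    · exact sum_congr rfl fun p _ => by ring
  · rw [sum_insertNone]
    simp only [Option.elim, mul_one]
    rw [← sum_mul, ← mul_sum, mul_assoc]
    gcongr

end OUKernel

end

/-! ### Estimate of a single diagonal and conclusion -/

noncomputable section

namespace OUKernel

open Finset TriGauss

variable {lam : ℕ → ℝ} {a : EllTwo → EllTwo →L[ℝ] EllTwo} {t : ℝ} {K : ℕ}

/-- Interpolation between the two second-moment bounds. -/
lemma iterInt_mul_abs_le {m : ℕ} {Y S Q : (ℕ → ℝ) → ℝ} (hY : Measurable Y) (hS : Measurable S)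
    (hQ : Measurable Q) (hQ0 : ∀ z, 0 ≤ Q z) {A B r : ℝ} (hr : 0 < r) (hA : 0 ≤ A) (hB : 0 ≤ B)
    (h1 : iterInt m (fun z => ENNReal.ofReal (Y z ^ 2 * Q z)) ≤ ENNReal.ofReal A)
    (h2 : iterInt m (fun z => ENNReal.ofReal (S z ^ 2 * Q z)) ≤ ENNReal.ofReal B) :
    iterInt m (fun z => ENNReal.ofReal (Y z * |S z| * Q z)) ≤
      ENNReal.ofReal (r / 2 * A + r⁻¹ / 2 * B) := by
  have key := iterInt_sum_le (m := m) (univ : Finset Bool)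
    (c := fun b => cond b (r / 2) (r⁻¹ / 2)) (B := fun b => cond b A B)
    (g := fun b z => cond b (Y z ^ 2 * Q z) (S z ^ 2 * Q z))
    (fun b => by cases b <;> simp only [cond] <;> positivity)
    (fun b => by cases b <;> simpa only [cond])
    (fun b z => by cases b <;> exact mul_nonneg (sq_nonneg _) (hQ0 z))
    (fun b => by
      cases b
      · exact (hS.pow_const 2).mul hQ
      · exact (hY.pow_const 2).mul hQ)
    (fun b => by cases b <;> assumption)
  simp only [Fintype.sum_bool, cond] at key
  refine (iterInt_mono m fun z => ENNReal.ofReal_le_ofReal ?_).trans key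
  have h3 : Y z * |S z| ≤ r / 2 * Y z ^ 2 + r⁻¹ / 2 * S z ^ 2 := by
    have h4 : 0 ≤ (r * Y z - |S z|) ^ 2 * (r⁻¹ / 2) := by positivity
    have h5 : (r * Y z - |S z|) ^ 2 * (r⁻¹ / 2) =
        r / 2 * Y z ^ 2 + r⁻¹ / 2 * |S z| ^ 2 - Y z * |S z| := by
      field_simp
      ring
    rw [sq_abs] at h5
    linarith
  have := mul_le_mul_of_nonneg_right h3 (hQ0 z)
  linarith

lemma measurable_weightedAbs : Measurable (weightedAbs K) :=
  Finset.measurable_fun_sum _ fun k _ => ((measurable_pi_apply k).abs).const_mul _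

/-- The estimate of one diagonal. -/
lemma iterInt_diag_le {α β γ κβ κγ κlam θ Λ₀ Λ₁ Γ L W C : ℝ} (h0 : 0 < Λ₀) (ht : 0 < t)
    (hα : 0 < α) (hα' : α ≤ 1) (hβ : 9 / 2 - α < β) (hκ : 0 < κlam) (hθ : 0 ≤ θ) (hθ' : θ ≤ 1)
    (hγ : 0 < γ) (hlam : QuadraticGrowth κlam lam) (hoff : OffDiagonalDecay γ κγ a)
    (hH : CoordHolder α β κβ a) (x : EllTwo)
    (hG : AdaptedFamily Λ₀ Λ₁ Γ L (gram lam a K x t)) (hW : 0 ≤ W) (hC : 0 ≤ C)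
    (h1 : iterInt K (fun z => ENNReal.ofReal ((1 + weightedAbs K z) ^ 2 *
      density (gram lam a K x t K z) K z)) ≤ ENNReal.ofReal W)
    (h2 : ∀ (n : ℕ) (b : ℕ → ℝ), iterInt K (fun z => ENNReal.ofReal
      (bandForm K n b (gram lam a K x t K z) K z ^ 2 * density (gram lam a K x t K z) K z)) ≤
        ENNReal.ofReal (C * ∑ i ∈ range K, b i ^ 2)) (n : ℕ) :
    iterInt K (fun z => ENNReal.ofReal (|diagDiff lam a K x t z n| *
      |bandForm K n (fun i => damp lam t i * damp lam t (i + n)) (gram lam a K x t K z) K z| *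
        density (gram lam a K x t K z) K z)) ≤
      ENNReal.ofReal ((2 * κγ) ^ (1 - θ) * (1 / (1 + (n : ℝ) ^ γ)) ^ (1 - θ) *
        holderConst α κβ κlam ^ θ * (W / 2 + C * (√κlam)⁻¹) *
          (t ^ (-1 + (α * θ / 2 - 1 / 4)) * (1 + supNorm x ^ α))) := by
  have hκβ := hH.nonneg
  have hκγ := hoff.nonneg hγ
  have hX : 0 ≤ supNorm x ^ α := Real.rpow_nonneg (supNorm_nonneg x) α
  have hHC : 0 ≤ holderConst α κβ κlam := by
    have := invSqSum_nonneg
    unfold holderConst; positivity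
  have hd : ∀ z, 0 ≤ density (gram lam a K x t K z) K z := fun z =>
    (density_pos h0 (hG.adm K z) K z).le
  have mQ := measurable_density (hG.meas K) K
  have mS := measurable_bandForm (hG.meas K) K n (fun i => damp lam t i * damp lam t (i + n)) K
  have mY : Measurable fun z => 1 + weightedAbs K z := measurable_weightedAbs.const_add 1
  have hB := (h2 n fun i => damp lam t i * damp lam t (i + n)).trans (ENNReal.ofReal_le_ofReal
    (mul_le_mul_of_nonneg_left (sum_damp_sq_le ht hκ hlam n K) hC))
  -- This `r` balances the two moments: the first is of order `1` and the second of order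
  -- `t^{-5/2}`, so both terms become `t^{-5/4}`.
  have key := iterInt_mul_abs_le mY mS mQ hd (r := t ^ (-(5 / 4) : ℝ)) (by positivity) hW
    (by positivity) h1 hB
  set c := (2 * κγ) ^ (1 - θ) * (1 / (1 + (n : ℝ) ^ γ)) ^ (1 - θ) *
        (holderConst α κβ κlam ^ θ * t ^ (α * θ / 2)) * (1 + supNorm x ^ α) with hc
  have hc0 : 0 ≤ c := by positivity
  have mF : Measurable fun z => ENNReal.ofReal ((1 + weightedAbs K z) *
      |bandForm K n (fun i => damp lam t i * damp lam t (i + n)) (gram lam a K x t K z) K z| *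
        density (gram lam a K x t K z) K z) := ((mY.mul mS.abs).mul mQ).ennreal_ofReal
  calc _ ≤ iterInt K (fun z => ENNReal.ofReal c * ENNReal.ofReal ((1 + weightedAbs K z) *
      |bandForm K n (fun i => damp lam t i * damp lam t (i + n)) (gram lam a K x t K z) K z| *
        density (gram lam a K x t K z) K z)) := by
        refine iterInt_mono K fun z => ?_
        rw [← ENNReal.ofReal_mul hc0]
        refine ENNReal.ofReal_le_ofReal ?_
        rw [← mul_assoc, ← mul_assoc]
        have h3 := abs_diagDiff_le (K := K) ht hα hα' hβ hκ hθ hθ' hγ hlam hoff hH x z n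
        rw [← mul_assoc, ← hc] at h3
        have := hd z
        gcongr
    _ ≤ ENNReal.ofReal (c * (t ^ (-(5 / 4) : ℝ) / 2 * W + (t ^ (-(5 / 4) : ℝ))⁻¹ / 2 *
        (C * (2 * (√κlam)⁻¹ * t ^ (-(5 / 2) : ℝ))))) := by
        rw [iterInt_const_mul K mF, ENNReal.ofReal_mul hc0]
        gcongr
    _ = _ := by
        have e1 : (t ^ (-(5 / 4) : ℝ))⁻¹ * t ^ (-(5 / 2) : ℝ) = t ^ (-(5 / 4) : ℝ) := by
          rw [← Real.rpow_neg ht.le, ← Real.rpow_add ht]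
          norm_num
        have e2 : t ^ (-1 + (α * θ / 2 - 1 / 4)) = t ^ (α * θ / 2) * t ^ (-(5 / 4) : ℝ) := by
          rw [← Real.rpow_add ht]
          congr 1; ring
        have e3 : (t ^ (-(5 / 4) : ℝ))⁻¹ / 2 * (C * (2 * (√κlam)⁻¹ * t ^ (-(5 / 2) : ℝ))) =
            C * (√κlam)⁻¹ * t ^ (-(5 / 4) : ℝ) := by
          linear_combination (C * (√κlam)⁻¹) * e1
        rw [e3, e2, hc]
        congr 1
        ring

/-- The two requirements on `θ` read `1 / (2α) < θ < 1 - 1/γ`, an interval that is nonempty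
precisely when `γ > 2α / (2α - 1)`. -/
lemma exists_interpolation_exponent {α γ : ℝ} (hα : 1 / 2 < α)
    (hγ : 2 * α / (2 * α - 1) < γ) :
    ∃ θ : ℝ, 0 < θ ∧ θ < 1 ∧ 1 / 2 < α * θ ∧ 1 < γ * (1 - θ) := by
  have h1 : 0 < 2 * α - 1 := by linarith
  have hγ0 : 0 < γ := lt_trans (by positivity) hγ
  have hlt : 1 / (2 * α) < 1 - 1 / γ := by
    rw [div_lt_iff₀ h1] at hγ
    rw [lt_sub_iff_add_lt, div_add_div _ _ (by positivity) hγ0.ne', div_lt_one (by positivity)]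
    linarith
  obtain ⟨θ, h2, h3⟩ := exists_between hlt
  have hα0 : 0 < α := by linarith
  have h4 : 0 < 1 / γ := by positivity
  refine ⟨θ, lt_trans (by positivity) h2, by linarith, ?_, ?_⟩
  · rw [div_lt_iff₀ (by positivity)] at h2
    linarith
  · have h5 : 1 / γ < 1 - θ := by linarith
    rwa [div_lt_iff₀ hγ0, mul_comm] at h5

end OUKernel

end

theorem theorem7p1 (α γ : ℝ) (hα : 1 / 2 < α) (hα' : α ≤ 1)
    (hγ : 2 * α / (2 * α - 1) < γ) :
    ∃ η : ℝ, 0 < η ∧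
      ∀ β κβ κγ κlam Λ₀ Λ₁ : ℝ, 9 / 2 - α < β → 0 < κlam → 0 < Λ₀ → Λ₀ ≤ Λ₁ →
        ∃ c : ℝ, 0 < c ∧
          ∀ (lam : ℕ → ℝ) (a : EllTwo → EllTwo →L[ℝ] EllTwo),
            OUKernel.QuadraticGrowth κlam lam →
            (∀ x, IsSelfAdjoint (a x)) →
            OUKernel.UniformlyElliptic Λ₀ Λ₁ a →
            OUKernel.IsToeplitz a →
            OUKernel.OffDiagonalDecay γ κγ a →
            OUKernel.CoordHolder α β κβ a →
            ∀ (K : ℕ) (x : EllTwo) (t : ℝ), 0 < t →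
              Integrable
                (fun y : Fin K → ℝ => OUKernel.perturbation lam a K t x (OUKernel.embed K y)) ∧
              ∫ y : Fin K → ℝ, |OUKernel.perturbation lam a K t x (OUKernel.embed K y)|
                ≤ c * t ^ (-1 + η) * (1 + OUKernel.supNorm x ^ α) := by
  obtain ⟨θ, hθ, hθ', hαθ, hγθ⟩ := OUKernel.exists_interpolation_exponent hα hγ
  have hα0 : 0 < α := by linarith
  -- For `α ≤ 1` the threshold `2α / (2α - 1)` is at least `2`.
  have hγ2 : 2 < γ := by
    refine lt_of_le_of_lt ?_ hγ
    rw [le_div_iff₀ (by linarith)]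
    linarith
  -- Hölder continuity gains `t^{αθ/2}` against the `t^{-5/4}` of the banded functional.
  refine ⟨α * θ / 2 - 1 / 4, by linarith, fun β κβ κγ κlam Λ₀ Λ₁ hβ hκ h0 h01 => ?_⟩
  obtain ⟨V, hV, hmom⟩ := TriGauss.exists_moment_bound h0 h01 (OUKernel.momentBound γ κγ)
    (OUKernel.incrBound α κlam κβ)
  obtain ⟨C, hC, hband⟩ := TriGauss.exists_band_bound h0 h01 (OUKernel.momentBound γ κγ)
    (OUKernel.incrBound α κlam κβ)
  set W := 2 * V + 2 * ((OUKernel.invSqSum * OUKernel.rowBound γ κγ) ^ 2 * V) with hW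
  have hW0 : 0 ≤ W := by positivity
  set f : ℕ → ℝ := fun n => (1 / (1 + (n : ℝ) ^ γ)) ^ (1 - θ) with hf
  have hfs : Summable f := OUKernel.summable_inv_one_add_rpow (by linarith) hγθ
  have hf0 : ∀ n, 0 ≤ f n := fun n => by positivity
  set c := 2 * ((2 * κγ) ^ (1 - θ) * (∑' n, f n) * OUKernel.holderConst α κβ κlam ^ θ *
    (W / 2 + C * (√κlam)⁻¹)) with hc
  -- The constant is fixed before `a` is given, when the signs of `κγ` and `κβ` are not yet known;
  -- the absolute value and the added `1` make it positive in any case.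
  refine ⟨|c| + 1, by positivity, fun lam a hlam ha hell hT hoff hH K x t ht => ?_⟩
  have hκβ := hH.nonneg
  have hκγ := hoff.nonneg (by linarith)
  have hHC : 0 ≤ OUKernel.holderConst α κβ κlam := by
    have := OUKernel.invSqSum_nonneg
    unfold OUKernel.holderConst; positivity
  have hX : 0 ≤ OUKernel.supNorm x ^ α := Real.rpow_nonneg (OUKernel.supNorm_nonneg x) α
  have hG := OUKernel.adaptedFamily_gram ht hγ2 hα0 hα' hβ hκ hlam ha hell hoff hH K x
  have h1 := OUKernel.iterInt_weightedAbs_le h0 ht (by linarith) hV hoff x hG (hmom _ hG K)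
  have h2 := OUKernel.iterInt_diag_le h0 ht hα0 hα' hβ hκ hθ.le hθ'.le (by linarith) hlam hoff hH x
    hG hW0 hC h1 (fun n b => hband _ hG K n b K)
  have hmeas := OUKernel.measurable_perturbation h0 ht hα0 hH x hG
  set T := t ^ (-1 + (α * θ / 2 - 1 / 4)) * (1 + OUKernel.supNorm x ^ α) with hTdef
  have hT0 : 0 ≤ T := by positivity
  have hbound : ∫⁻ y : Fin K → ℝ,
      ENNReal.ofReal |OUKernel.perturbation lam a K t x (OUKernel.embed K y)| ≤
        ENNReal.ofReal (c * T) := by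
    refine (OUKernel.lintegral_perturbation_le h0 ht hα0 ha hT hH x hG).trans ?_
    refine (mul_le_mul_right (Finset.sum_le_sum fun n _ => h2 n) _).trans ?_
    rw [← ENNReal.ofReal_sum_of_nonneg fun n _ => by positivity, ← ENNReal.ofReal_ofNat 2,
      ← ENNReal.ofReal_mul (by norm_num)]
    refine ENNReal.ofReal_le_ofReal ?_
    have hs := hfs.sum_le_tsum (Finset.range K) fun n _ => hf0 n
    calc _ = 2 * ((2 * κγ) ^ (1 - θ) * (∑ n ∈ Finset.range K, f n) *
          OUKernel.holderConst α κβ κlam ^ θ * (W / 2 + C * (√κlam)⁻¹)) * T := by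
          rw [Finset.mul_sum, Finset.mul_sum, Finset.sum_mul, Finset.sum_mul, Finset.mul_sum,
            Finset.sum_mul]
          exact Finset.sum_congr rfl fun n _ => by ring
      _ ≤ c * T := by
          rw [hc]
          gcongr
  have hcT : c * T ≤ (|c| + 1) * T := by
    have := le_abs_self c
    gcongr
    linarith
  constructor
  · refine ⟨hmeas.aestronglyMeasurable, ?_⟩
    rw [hasFiniteIntegral_iff_norm]
    exact hbound.trans_lt ENNReal.ofReal_lt_top
  · rw [integral_eq_lintegral_of_nonneg_ae (Filter.Eventually.of_forall fun y => abs_nonneg _)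
      hmeas.abs.aestronglyMeasurable, mul_assoc]
    exact ENNReal.toReal_le_of_le_ofReal (by positivity)
      (hbound.trans (ENNReal.ofReal_le_ofReal hcT))
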